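/- Let $n\ge 0$, and let $\Omega\subset\mathbb{R}^{n+1}$ be a non-empty bounded open set whose boundary $M=\partial\Omega$ is a generalised hypersurface, i.e. for some $\kappa\in[0,1)$ one has $\mathcal{H}^{n+\kappa}(M)<\infty$ and there are $\delta,\theta>0$ with $\mathcal{H}^{n+\kappa}(M\cap B(p,\gamma))\ge\theta\gamma^{n+\kappa}$ for all $p\in M$, $\gamma\in(0,\delta]$ (this includes the boundary of any bounded open set with smooth closed embedded boundary). Let $d(x)=\mathrm{dist}(x,M)$ for $x\in\Omega$ and $d(x)=-\mathrm{dist}(x,M)$ for $x\notin\Omega$. For $s\in\mathbb{R}$ let $M_s=\{d=s\}$, and let $\chi_{M_s}$ denote the indicator function of the compact region $\{d\ge s\}$ bounded by $M_s$. Let $f(u)=2u(u^2-1)$, and let $\eta>0$. For given $\varepsilon>0$ and $u_0\in L^\infty(\mathbb{R}^{n+1})$, a solution of the initial value problem $$\partial_t u=\Delta u-\frac{1}{\varepsilon^2}f(u),\qquad u(\cdot,0)=u_0, \tag{$*$}$$ means a function $u$ that belongs to $L^\infty(\mathbb{R}^{n+1}\times[0,T])$ for all $T>0$, is continuous from $[0,\infty)$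 to $\mathcal{D}'(\mathbb{R}^{n+1})$ (each $u(\cdot,t)$, $t\ge 0$, being a locally integrable function), equals $u_0$ at time $0$ almost everywhere, and satisfies the equation in the sense of distributions on $\mathbb{R}^{n+1}\times(0,\infty)$. Then for each $\varepsilon\in(0,1)$ there exists a family $\{u^\varepsilon_s\}_{s\in[-\eta,\eta]}$ such that: 1. for each $s$, $u^\varepsilon_s$ is a solution of $(*)$ with $u_0=2\chi_{M_s}-1$; it equals $2\chi_{M_s}-1$ everywhere at $t=0$, and for $t>0$ it is $C^2$ in $x$, differentiable in $t$, and satisfies the equation at every point; 2. $u^\varepsilon_s$ is the unique solution: any solution $v$ of $(*)$ with $u_0=2\chi_{M_s}-1$ satisfies $v(\cdot,t)=u^\varepsilon_s(\cdot,t)$ almost everywhere, for every $t\ge 0$; 3. the family is continuous: $(s,x,t)\mapsto u^\varepsilon_s(x,t)$ is continuous on $[-\eta,\eta]\times\mathbb{R}^{n+1}\times(0,\infty)$, and for each $\varphi\in C_c^\infty(\mathbb{R}^{n+1})$ the map $(s,t)\mapsto\int u^\varepsilon_s(x,t)\varphi(x)\,dx$ is continuous on $[-\eta,\eta]\times[0,\infty)$;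 4. the family is monotone: if $-\eta\le s_1\le s_2\le\eta$, then $u^\varepsilon_{s_2}(x,t)\le u^\varepsilon_{s_1}(x,t)$ for all $x\in\mathbb{R}^{n+1}$ and $t\ge 0$. -/

import Mathlib

open MeasureTheory Set
open scoped ContDiff Laplacian

/-- `Ω ⊆ ℝⁿ⁺¹` is a bounded open set whose boundary `M = ∂Ω` is a generalised hypersurface: for some
`κ ∈ [0,1)` the Hausdorff measure `ℋ^{n+κ}(M)` is finite and `M` has a lower `(n+κ)`-density
bound at all scales `γ ∈ (0, δ]`. -/
structure BoundsGeneralisedHypersurface {n : ℕ} (Ω : Set (EuclideanSpace ℝ (Fin (n + 1)))) :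
    Prop where
  isOpen : IsOpen Ω
  isBounded : Bornology.IsBounded Ω
  density : ∃ κ : ℝ, 0 ≤ κ ∧ κ < 1 ∧
    Measure.hausdorffMeasure ((n : ℝ) + κ) (frontier Ω) < ⊤ ∧
    ∃ δ : ℝ, 0 < δ ∧ ∃ θ : ℝ, 0 < θ ∧ ∀ p ∈ frontier Ω, ∀ γ : ℝ, 0 < γ → γ ≤ δ →
      ENNReal.ofReal (θ * γ ^ ((n : ℝ) + κ)) ≤
        Measure.hausdorffMeasure ((n : ℝ) + κ) (frontier Ω ∩ Metric.ball p γ)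

open Classical in
/-- The signed distance to `M = ∂Ω`, positive in the interior region `Ω`. -/
noncomputable def signedDistance {n : ℕ} (Ω : Set (EuclideanSpace ℝ (Fin (n + 1))))
    (x : EuclideanSpace ℝ (Fin (n + 1))) : ℝ :=
  if x ∈ Ω then Metric.infDist x (frontier Ω) else -Metric.infDist x (frontier Ω)

/-- The compact region `{x | d(x, M) ≥ s}` bounded by the leaf `M_s = {x | d(x, M) = s}`. -/
def leafRegion {n : ℕ} (Ω : Set (EuclideanSpace ℝ (Fin (n + 1)))) (s : ℝ) :
    Set (EuclideanSpace ℝ (Fin (n + 1))) :=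
  {x | s ≤ signedDistance Ω x}

/-- The initial datum `2 χ_{M_s} - 1`. -/
noncomputable def leafInitialDatum {n : ℕ} (Ω : Set (EuclideanSpace ℝ (Fin (n + 1)))) (s : ℝ)
    (x : EuclideanSpace ℝ (Fin (n + 1))) : ℝ :=
  2 * (leafRegion Ω s).indicator (fun _ => (1 : ℝ)) x - 1

/-- `f = F'` for the double-well potential `F(u) = (1 - u²)² / 2`. -/
def allenCahnReaction (u : ℝ) : ℝ := 2 * u * (u ^ 2 - 1)

/-- `u : [0,∞) × ℝⁿ⁺¹ → ℝ` (values at negative times are irrelevant) is a bounded distributional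
solution of `∂ₜ u = Δ u - ε⁻² f(u)` with initial datum `u₀`: it lies in `L^∞([0,T] × ℝⁿ⁺¹)` for
all `T > 0`, is continuous from `[0,∞)` to the space of distributions on `ℝⁿ⁺¹`, takes the value
`u₀` at time `0`, and solves the equation in the sense of distributions on `(0,∞) × ℝⁿ⁺¹`. -/
structure IsAllenCahnSolution {n : ℕ} (ε : ℝ) (u₀ : EuclideanSpace ℝ (Fin (n + 1)) → ℝ)
    (u : ℝ → EuclideanSpace ℝ (Fin (n + 1)) → ℝ) : Prop where
  bounded : ∀ T : ℝ, 0 < T →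
    MemLp (fun p : ℝ × EuclideanSpace ℝ (Fin (n + 1)) => u p.1 p.2) ⊤
      (volume.restrict (Icc 0 T ×ˢ univ))
  locallyIntegrable : ∀ t : ℝ, 0 ≤ t → LocallyIntegrable (u t) volume
  continuous_distribution : ∀ φ : EuclideanSpace ℝ (Fin (n + 1)) → ℝ,
    ContDiff ℝ ∞ φ → HasCompactSupport φ → ContinuousOn (fun t => ∫ x, u t x * φ x) (Ici 0)
  initial : u 0 =ᵐ[volume] u₀
  equation : ∀ φ : ℝ × EuclideanSpace ℝ (Fin (n + 1)) → ℝ,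
    ContDiff ℝ ∞ φ → HasCompactSupport φ → tsupport φ ⊆ Ioi 0 ×ˢ univ →
    ∫ p in Ioi (0 : ℝ) ×ˢ (univ : Set (EuclideanSpace ℝ (Fin (n + 1)))),
      (u p.1 p.2 * (deriv (fun t => φ (t, p.2)) p.1 + Δ (fun x => φ (p.1, x)) p.2)
        - 1 / ε ^ 2 * allenCahnReaction (u p.1 p.2) * φ p) = 0

set_option linter.unusedSectionVars false

/-! With Λ = 4/ε² the equation becomes ∂ₜu = Δu - Λu + g(u), where g(a) = Λa - ε⁻²f(a) = ε⁻²(6a -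
2a³) is nondecreasing on [-1,1] and equals ±Λ at ±1. Made constant outside [-1,1], g is monotone,
bounded by Λ and Lipschitz with constant L = 6/ε². A solution with datum U, |U| ≤ 1, is a fixed
point of Duhamel's map u ↦ e^{-Λt} e^{tΔ}U + ∫₀ᵗ e^{-Λσ} e^{σΔ} g(u(t-σ)) dσ. This map has values in
[-1,1] because e^{-Λt} + (1 - e^{-Λt}) = 1; it is increasing in U and u because the heat kernel is
positive and g monotone; and it halves distances in the supremum norm with weight e^{-2Lt}. Its
iterates from 0 therefore converge to a solution that is monotone in U (`mildSolution_mono`). The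
data decrease in s, hence so do the solutions. Throughout, e^{tΔ}F(x) is the expectation of F(x +
√(2t) Z) with Z standard Gaussian.

Continuity in s. At a point x the datum is locally constant in s away from s = d(x), so everything
rests on the level sets {d = s} being null. For s = 0 this follows from ℋ^{n+κ}(M) < ∞ with κ < 1;
for s ≠ 0 the level set is porous and hence has no density point (`volume_infDist_eq_zero`).
Dominated convergence then carries continuity through each iterate, and the convergence is uniform
on bounded times. Up to t = 0 continuity is weak: the solution is O(t)-close to the heat flow, whose
pairing with a test function is continuous.

Regularity. Duhamel's formula may be restarted at any positive time. The gradient of the heat kernel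
costs σ^{-1/2}, integrable at 0, so bounded continuous data give a continuous gradient; each
directional derivative again has Duhamel form, with source g'(u)∂ᵥu, so a second round gives C². The
time derivative is read off the restarted formula. The classical equation implies the weak one by
integration by parts.

Uniqueness. Product test functions turn the weak equation into an integral identity in time for each
spatial test function. The difference w of two bounded weak solutions satisfies ∂ₜw = Δw + k with
|k| ≤ L'|w|. Mollified in space, w follows the heat flow over a short time step up to the source and
an error quadratic in the step; summing the steps gives ‖w(t)‖∞ ≤ ∫₀ᵗ ‖k‖∞. Iterating yields
C(L't)^j/j! for every j, so w = 0. -/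

open ProbabilityTheory Filter Topology Module in
theorem stdGaussian_eq_withDensity (E : Type*) [NormedAddCommGroup E] [InnerProductSpace ℝ E]
    [FiniteDimensional ℝ E] [MeasurableSpace E] [BorelSpace E] :
    stdGaussian E = (volume : Measure E).withDensity fun z =>
      ENNReal.ofReal (((2 * Real.pi) ^ (finrank ℝ E / 2 : ℝ))⁻¹ * Real.exp (-(1 / 2) * ‖z‖ ^ 2)) := by
  set c : ℝ := ((2 * Real.pi) ^ (finrank ℝ E / 2 : ℝ))⁻¹ with hc
  have hc0 : 0 < c := by positivity
  have hI : Integrable (fun z : E => c * Real.exp (-(1 / 2) * ‖z‖ ^ 2)) := by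
    have := GaussianFourier.integrable_cexp_neg_mul_sq_norm_add (V := E) (b := 1 / 2)
      (by norm_num) 0 0
    refine (this.re.const_mul c).congr (Eventually.of_forall fun z => ?_)
    simp only [RCLike.re_eq_complex_re, zero_mul, add_zero]
    rw [← Complex.exp_ofReal_re]
    push_cast
    rfl
  have : IsFiniteMeasure ((volume : Measure E).withDensity fun z =>
      ENNReal.ofReal (c * Real.exp (-(1 / 2) * ‖z‖ ^ 2))) :=
    isFiniteMeasure_withDensity_ofReal hI.2
  -- Both measures are finite, so it suffices to compare Fourier transforms, and that of the density
  -- is an explicit Gaussian integral.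
  apply Measure.ext_of_charFun
  ext t
  rw [charFun_stdGaussian, charFun_apply, integral_withDensity_eq_integral_toReal_smul (by fun_prop)
    (Eventually.of_forall fun _ => ENNReal.ofReal_lt_top)]
  have h1 : ∀ z : E, (ENNReal.ofReal (c * Real.exp (-(1 / 2) * ‖z‖ ^ 2))).toReal •
      Complex.exp (inner ℝ z t * Complex.I) =
      c * Complex.exp (-(1 / 2 : ℂ) * ‖z‖ ^ 2 + Complex.I * inner ℝ t z) := by
    intro z
    rw [ENNReal.toReal_ofReal (by positivity), Complex.exp_add, real_inner_comm,
      mul_comm Complex.I, Complex.real_smul]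
    push_cast
    ring
  simp_rw [h1]
  rw [integral_const_mul, GaussianFourier.integral_cexp_neg_mul_sq_norm_add (by norm_num)]
  have h2 : ((Real.pi : ℂ) / (1 / 2)) ^ (finrank ℝ E / 2 : ℂ) = ((c⁻¹ : ℝ) : ℂ) := by
    rw [hc, inv_inv, Complex.ofReal_cpow (by positivity)]
    push_cast
    ring_nf
  rw [h2, ← mul_assoc, ← Complex.ofReal_mul, mul_inv_cancel₀ hc0.ne']
  simp
  ring_nf


/-! ### Gaussian averages as a model of the heat semigroup -/

section Gaussian

open ProbabilityTheory Filter Topology Module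

variable {E : Type*} [NormedAddCommGroup E] [InnerProductSpace ℝ E] [FiniteDimensional ℝ E]
  [MeasurableSpace E] [BorelSpace E] {H : Type*} [NormedAddCommGroup H] [NormedSpace ℝ H]

/-- The density of the standard Gaussian measure. -/
noncomputable def gaussianDensity (z : E) : ℝ :=
  ((2 * Real.pi) ^ (finrank ℝ E / 2 : ℝ))⁻¹ * Real.exp (-(1 / 2) * ‖z‖ ^ 2)

theorem gaussianDensity_pos (z : E) : 0 < gaussianDensity z := by
  unfold gaussianDensity; positivity

theorem continuous_gaussianDensity : Continuous (gaussianDensity : E → ℝ) := by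
  unfold gaussianDensity; fun_prop

theorem integrable_exp_neg_mul_sq_norm {b : ℝ} (hb : 0 < b) (y : E) :
    Integrable (fun z : E => Real.exp (-b * ‖z - y‖ ^ 2)) := by
  have := GaussianFourier.integrable_cexp_neg_mul_sq_norm_add (V := E) (b := b) (by simpa) 0 0
  have h : Integrable (fun z : E => Real.exp (-b * ‖z‖ ^ 2)) := by
    refine this.re.congr (Eventually.of_forall fun z => ?_)
    simp only [RCLike.re_eq_complex_re, zero_mul, add_zero]
    rw [← Complex.exp_ofReal_re]
    push_cast
    rfl
  exact h.comp_sub_right y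

theorem integral_stdGaussian_eq (f : E → H) :
    ∫ z, f z ∂stdGaussian E = ∫ z, gaussianDensity z • f z := by
  rw [stdGaussian_eq_withDensity, integral_withDensity_eq_integral_toReal_smul
    (by fun_prop) (Eventually.of_forall fun _ => ENNReal.ofReal_lt_top)]
  refine integral_congr_ae (Eventually.of_forall fun z => ?_)
  simp only
  rw [ENNReal.toReal_ofReal (by positivity)]
  rfl

theorem hasFDerivAt_gaussianDensity_sub (z k : E) :
    HasFDerivAt (fun k => gaussianDensity (z - k)) (gaussianDensity (z - k) • innerSL ℝ (z - k)) k := by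
  have h1 : HasFDerivAt (fun k => z - k) (-ContinuousLinearMap.id ℝ E) k := by
    simpa using (hasFDerivAt_id k).const_sub z
  have h2 := ((h1.norm_sq.const_mul (-(1 / 2) : ℝ)).exp).const_mul
    (((2 * Real.pi) ^ (finrank ℝ E / 2 : ℝ))⁻¹)
  refine h2.congr_fderiv ?_
  ext v
  simp [gaussianDensity]
  ring

/-- An integrable majorant, uniform over the unit ball of translations, for the gradient of the
translated density: a factor e^{r²/4} absorbs the linear factor r = ‖z - k‖, and ‖z‖² ≤ 2‖z - k‖² +
2 removes k from what remains. -/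
theorem gaussianDensity_sub_mul_norm_le {z k : E} (hk : ‖k‖ ≤ 1) :
    gaussianDensity (z - k) * ‖z - k‖ ≤
      ((2 * Real.pi) ^ (finrank ℝ E / 2 : ℝ))⁻¹ * Real.exp (1 / 4) *
        Real.exp (-(1 / 8) * ‖z‖ ^ 2) := by
  have h1 : ‖z - k‖ ≤ Real.exp (‖z - k‖ ^ 2 / 4) := by
    have := Real.add_one_le_exp (‖z - k‖ ^ 2 / 4)
    nlinarith [sq_nonneg (1 - ‖z - k‖ / 2)]
  have h2 : ‖z‖ ^ 2 ≤ 2 * ‖z - k‖ ^ 2 + 2 := by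
    have : ‖z‖ ≤ ‖z - k‖ + 1 := by
      have := norm_add_le (z - k) k
      rw [sub_add_cancel] at this
      linarith
    nlinarith [norm_nonneg z, norm_nonneg (z - k), sq_nonneg (‖z - k‖ - 1)]
  unfold gaussianDensity
  rw [mul_assoc, mul_assoc]
  refine mul_le_mul_of_nonneg_left ?_ (by positivity)
  calc Real.exp (-(1 / 2) * ‖z - k‖ ^ 2) * ‖z - k‖
      ≤ Real.exp (-(1 / 2) * ‖z - k‖ ^ 2) * Real.exp (‖z - k‖ ^ 2 / 4) := by gcongr
    _ = Real.exp (-(1 / 4) * ‖z - k‖ ^ 2) := by rw [← Real.exp_add]; ring_nf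
    _ ≤ Real.exp (1 / 4 + -(1 / 8) * ‖z‖ ^ 2) := Real.exp_le_exp.2 (by linarith)
    _ = _ := Real.exp_add _ _

/-- The average of `F` against a Gaussian of standard deviation `r` centred at `x`; the heat
semigroup at time `t` is `gaussianAverage √(2 * t)`. -/
noncomputable def gaussianAverage (r : ℝ) (F : E → H) (x : E) : H :=
  ∫ z, F (x + r • z) ∂stdGaussian E

/-- Translating the integration variable moves the dependence on the centre y from F to the smooth
density, so that a merely measurable F can be averaged and differentiated. -/
theorem gaussianAverage_eq_integral_translate (F : E → H) {r : ℝ} (hr : r ≠ 0) (x y : E) :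
    gaussianAverage r F y = ∫ z, gaussianDensity (z - r⁻¹ • (y - x)) • F (x + r • z) := by
  rw [gaussianAverage, integral_stdGaussian_eq, ← integral_sub_right_eq_self _ (r⁻¹ • (y - x))]
  refine integral_congr_ae (Eventually.of_forall fun z => ?_)
  simp only
  congr 2
  rw [smul_sub, smul_smul, mul_inv_cancel₀ hr]
  module

/-- Smoothing: the derivative falls on the kernel. For r = √(2t) the factor r⁻¹ is the usual
t^{-1/2} loss, whose integrability in time drives the whole regularity argument. -/
theorem hasFDerivAt_gaussianAverage {F : E → ℝ} (hF : Measurable F) {C : ℝ}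
    (hC : ∀ y, ‖F y‖ ≤ C) {r : ℝ} (hr : r ≠ 0) (x : E) :
    HasFDerivAt (gaussianAverage r F)
      (r⁻¹ • ∫ z, F (x + r • z) • innerSL ℝ z ∂stdGaussian E) x := by
  have hC0 : 0 ≤ C := (norm_nonneg _).trans (hC 0)
  have key : HasFDerivAt (fun k => ∫ z, gaussianDensity (z - k) • F (x + r • z))
      (∫ z, F (x + r • z) • (gaussianDensity (z - 0) • innerSL ℝ (z - 0))) (0 : E) := by
    refine hasFDerivAt_integral_of_dominated_of_fderiv_le
      (F' := fun k z => F (x + r • z) • (gaussianDensity (z - k) • innerSL ℝ (z - k)))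
      (bound := fun z => C * (((2 * Real.pi) ^ (finrank ℝ E / 2 : ℝ))⁻¹ * Real.exp (1 / 4) *
        Real.exp (-(1 / 8) * ‖z - 0‖ ^ 2)))
      (Metric.ball_mem_nhds 0 one_pos) ?_ ?_ ?_ ?_ ?_ ?_
    · refine Eventually.of_forall fun k => AEStronglyMeasurable.fun_smul ?_ ?_
      · exact (continuous_gaussianDensity.comp (by fun_prop)).aestronglyMeasurable
      · exact (hF.comp (by fun_prop)).aestronglyMeasurable
    · have h1 : Integrable (fun z : E => gaussianDensity (z - 0)) := by
        refine ((integrable_exp_neg_mul_sq_norm (b := 1 / 2) (by norm_num) (0 : E)).const_mul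
          (((2 * Real.pi) ^ (finrank ℝ E / 2 : ℝ))⁻¹)).congr (Eventually.of_forall fun z => ?_)
        rfl
      refine h1.smul_bdd C ?_ (Eventually.of_forall fun z => hC _)
      exact (hF.comp (by fun_prop)).aestronglyMeasurable
    · refine AEStronglyMeasurable.fun_smul (hF.comp (by fun_prop)).aestronglyMeasurable ?_
      exact ((continuous_gaussianDensity.comp (by fun_prop)).smul (by fun_prop)).aestronglyMeasurable
    · refine Eventually.of_forall fun z k hk => ?_
      rw [norm_smul, norm_smul, innerSL_apply_norm, Real.norm_of_nonneg (gaussianDensity_pos _).le,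
        sub_zero]
      exact mul_le_mul (hC _) (gaussianDensity_sub_mul_norm_le (mem_ball_zero_iff.1 hk).le)
        (mul_nonneg (gaussianDensity_pos _).le (norm_nonneg _)) hC0
    · exact ((integrable_exp_neg_mul_sq_norm (by norm_num) _).const_mul _).const_mul _
    · refine Eventually.of_forall fun z k hk => ?_
      simp only [smul_eq_mul]
      simpa [mul_comm] using (hasFDerivAt_gaussianDensity_sub z k).const_mul (F (x + r • z))
  have h1 : HasFDerivAt (fun y : E => r⁻¹ • (y - x)) (r⁻¹ • ContinuousLinearMap.id ℝ E) x :=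
    ((hasFDerivAt_id x).sub_const x).const_smul _
  have h2 : r⁻¹ • (x - x) = (0 : E) := by simp
  rw [← h2] at key
  have h3 := key.comp x h1
  have h4 : gaussianAverage r F =
      (fun k => ∫ z, gaussianDensity (z - k) • F (x + r • z)) ∘ fun y : E => r⁻¹ • (y - x) := by
    ext y
    exact gaussianAverage_eq_integral_translate F hr x y
  rw [h4]
  refine h3.congr_fderiv ?_
  rw [integral_stdGaussian_eq]
  ext v
  simp only [sub_self, smul_zero, sub_zero, ContinuousLinearMap.comp_smul,
    ContinuousLinearMap.comp_id]
  congr 3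
  ext z : 1
  rw [smul_comm]

theorem integrable_norm_stdGaussian : Integrable (fun z : E => ‖z‖) (stdGaussian E) :=
  (IsGaussian.integrable_id (μ := stdGaussian E)).norm

theorem hasFDerivAt_gaussianAverage_of_hasFDerivAt {F : E → ℝ} {F' : E → E →L[ℝ] ℝ}
    (hF : ∀ x, HasFDerivAt F (F' x) x) (hF' : Continuous F') {C C' : ℝ} (hC : ∀ y, ‖F y‖ ≤ C)
    (hC' : ∀ y, ‖F' y‖ ≤ C') (r : ℝ) (x : E) :
    HasFDerivAt (gaussianAverage r F) (gaussianAverage r F' x) x := by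
  have hFc : Continuous F := continuous_iff_continuousAt.2 fun x => (hF x).continuousAt
  refine hasFDerivAt_integral_of_dominated_of_fderiv_le (F' := fun y z => F' (y + r • z))
    (bound := fun _ => C') (s := univ) univ_mem ?_ ?_ ?_ ?_ ?_ ?_
  · exact Eventually.of_forall fun y => (by fun_prop : Continuous _).aestronglyMeasurable
  · exact Integrable.of_bound (by fun_prop : Continuous _).aestronglyMeasurable C
      (Eventually.of_forall fun z => hC _)
  · exact (by fun_prop : Continuous _).aestronglyMeasurable
  · exact Eventually.of_forall fun z y _ => hC' _
  · exact integrable_const _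
  · refine Eventually.of_forall fun z y _ => ?_
    have h1 : HasFDerivAt (fun y : E => y + r • z) (ContinuousLinearMap.id ℝ E) y :=
      (hasFDerivAt_id y).add_const _
    simpa [Function.comp_def] using (hF _).comp y h1

theorem norm_gaussianAverage_le {F : E → H} {C : ℝ} (hC : ∀ y, ‖F y‖ ≤ C) (r : ℝ) (x : E) :
    ‖gaussianAverage r F x‖ ≤ C := by
  simpa [gaussianAverage] using norm_integral_le_of_norm_le_const (μ := stdGaussian E)
    (Eventually.of_forall fun z => hC (x + r • z))

theorem gaussianAverage_zero [CompleteSpace H] (F : E → H) (x : E) : gaussianAverage 0 F x = F x := by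
  simp [gaussianAverage]

/-- Variances of independent Gaussians add, as the product of characteristic functions shows. With
a² = 2s and b² = 2t this is the semigroup law of the heat flow. -/
theorem map_prod_stdGaussian (a b : ℝ) :
    ((stdGaussian E).prod (stdGaussian E)).map (fun p => a • p.1 + b • p.2) =
      (stdGaussian E).map (fun z => √(a ^ 2 + b ^ 2) • z) := by
  have hm : Measurable (fun p : E × E => a • p.1 + b • p.2) := by fun_prop
  have : IsProbabilityMeasure (((stdGaussian E).prod (stdGaussian E)).map
    (fun p => a • p.1 + b • p.2)) := Measure.isProbabilityMeasure_map hm.aemeasurable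
  have : IsProbabilityMeasure ((stdGaussian E).map (fun z => √(a ^ 2 + b ^ 2) • z)) :=
    Measure.isProbabilityMeasure_map (by fun_prop)
  apply Measure.ext_of_charFun
  ext t
  rw [charFun_map_smul, charFun_stdGaussian, charFun_apply, integral_map hm.aemeasurable
    (by fun_prop : Continuous _).aestronglyMeasurable]
  have h1 : ∀ p : E × E, Complex.exp (inner ℝ (a • p.1 + b • p.2) t * Complex.I) =
      Complex.exp (inner ℝ p.1 (a • t) * Complex.I) *
        Complex.exp (inner ℝ p.2 (b • t) * Complex.I) := by
    intro p
    rw [← Complex.exp_add, inner_add_left, inner_smul_left, inner_smul_left, inner_smul_right,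
      inner_smul_right]
    push_cast
    simp
    ring_nf
  simp_rw [h1]
  rw [integral_prod_mul (fun z : E => Complex.exp (inner ℝ z (a • t) * Complex.I))
    (fun z : E => Complex.exp (inner ℝ z (b • t) * Complex.I)), ← charFun_apply, ← charFun_apply,
    charFun_stdGaussian, charFun_stdGaussian, ← Complex.exp_add]
  congr 1
  rw [norm_smul, norm_smul, norm_smul, Real.norm_of_nonneg (Real.sqrt_nonneg _)]
  simp only [Complex.ofReal_mul, mul_pow, ← Complex.ofReal_pow]
  rw [Real.sq_sqrt (by positivity), Real.norm_eq_abs, Real.norm_eq_abs, sq_abs, sq_abs]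
  push_cast
  ring

theorem gaussianAverage_gaussianAverage {F : E → ℝ} (hF : Measurable F) {C : ℝ}
    (hC : ∀ y, ‖F y‖ ≤ C) (a b : ℝ) (x : E) :
    gaussianAverage a (gaussianAverage b F) x = gaussianAverage √(a ^ 2 + b ^ 2) F x := by
  have h1 := map_prod_stdGaussian (E := E) a b
  have h2 : ∫ y, F (x + y) ∂(((stdGaussian E).prod (stdGaussian E)).map
      (fun p => a • p.1 + b • p.2)) = ∫ y, F (x + y) ∂((stdGaussian E).map
      (fun z => √(a ^ 2 + b ^ 2) • z)) := by rw [h1]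
  have hm : StronglyMeasurable (fun y => F (x + y)) :=
    (hF.comp (measurable_const_add x)).stronglyMeasurable
  rw [integral_map (by fun_prop) hm.aestronglyMeasurable,
    integral_map (by fun_prop) hm.aestronglyMeasurable, integral_prod] at h2
  · simpa only [gaussianAverage, add_assoc] using h2
  · exact Integrable.of_bound (hm.measurable.comp (by fun_prop)).aestronglyMeasurable C
      (Eventually.of_forall fun z => hC _)

theorem continuous_gaussianAverage {F : E → H} (hF : Continuous F) {C : ℝ} (hC : ∀ y, ‖F y‖ ≤ C) :
    Continuous (fun p : ℝ × E => gaussianAverage p.1 F p.2) := by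
  refine continuous_of_dominated (bound := fun _ => C) ?_ ?_ (integrable_const _) ?_
  · exact fun p => (by fun_prop : Continuous _).aestronglyMeasurable
  · exact fun p => Eventually.of_forall fun z => hC _
  · exact Eventually.of_forall fun z => by fun_prop

/-- Gaussian integration by parts. -/
theorem integral_mul_inner_stdGaussian {F : E → ℝ} {F' : E → E →L[ℝ] ℝ}
    (hF : ∀ x, HasFDerivAt F (F' x) x) (hF' : Continuous F') {C C' : ℝ} (hC : ∀ y, ‖F y‖ ≤ C)
    (hC' : ∀ y, ‖F' y‖ ≤ C') {r : ℝ} (hr : r ≠ 0) (x v : E) :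
    ∫ z, F (x + r • z) * inner ℝ z v ∂stdGaussian E = r * ∫ z, F' (x + r • z) v ∂stdGaussian E := by
  have hFc : Continuous F := continuous_iff_continuousAt.2 fun x => (hF x).continuousAt
  -- The gradient of the average is computed twice, once on the kernel and once on `F`; uniqueness
  -- of the derivative is the integration by parts.
  have h := (hasFDerivAt_gaussianAverage hFc.measurable hC hr x).unique
    (hasFDerivAt_gaussianAverage_of_hasFDerivAt hF hF' hC hC' r x)
  have h2 := congrArg (fun L : E →L[ℝ] ℝ => L v) h
  simp only [gaussianAverage, smul_apply] at h2
  rw [ContinuousLinearMap.integral_apply, ContinuousLinearMap.integral_apply] at h2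
  · rw [← h2]
    simp only [smul_apply, innerSL_apply_apply, smul_eq_mul]
    rw [mul_inv_cancel_left₀ hr]
  · exact Integrable.of_bound (by fun_prop : Continuous _).aestronglyMeasurable C'
      (Eventually.of_forall fun z => hC' _)
  · refine Integrable.bdd_smul ?_ C (by fun_prop : Continuous fun z => F (x + r • z)).aestronglyMeasurable
      (Eventually.of_forall fun z => hC _)
    refine Integrable.mono' integrable_norm_stdGaussian (by fun_prop : Continuous _).aestronglyMeasurable
      (Eventually.of_forall fun z => by simp)

end Gaussian

/-! ### The heat equation and Duhamel potentials -/

section Heat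

open ProbabilityTheory Filter Topology Module

variable {E : Type*} [NormedAddCommGroup E] [InnerProductSpace ℝ E] [FiniteDimensional ℝ E]
  [MeasurableSpace E] [BorelSpace E] {H : Type*} [NormedAddCommGroup H] [NormedSpace ℝ H]

/-- Differentiating F(x + rZ) in r produces F'(x + rZ)Z; expanding Z in the basis and integrating by
parts turns each component into r times a second derivative. This is the heat equation in the
variable r = √(2t), where dr/dt = 1/r. Second derivatives enter one basis direction at a time, the
form in which iterated first-order smoothing supplies them. -/
theorem hasDerivAt_gaussianAverage_radius {ι : Type*} [Fintype ι] (b : OrthonormalBasis ι ℝ E)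
    {F : E → ℝ} {F' : E → E →L[ℝ] ℝ} {F'' : ι → E → E →L[ℝ] ℝ}
    (hF : ∀ x, HasFDerivAt F (F' x) x) (hF' : ∀ i x, HasFDerivAt (fun y => F' y (b i)) (F'' i x) x)
    (hc' : Continuous F') (hc'' : ∀ i, Continuous (F'' i)) {C C' C'' : ℝ} (hC : ∀ y, ‖F y‖ ≤ C)
    (hC' : ∀ y, ‖F' y‖ ≤ C') (hC'' : ∀ i y, ‖F'' i y‖ ≤ C'') {r : ℝ} (hr : r ≠ 0) (x : E) :
    HasDerivAt (fun r => gaussianAverage r F x)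
      (r * gaussianAverage r (fun y => ∑ i, F'' i y (b i)) x) r := by
  have hFc : Continuous F := continuous_iff_continuousAt.2 fun x => (hF x).continuousAt
  have h1 : HasDerivAt (fun r => gaussianAverage r F x)
      (∫ z, F' (x + r • z) z ∂stdGaussian E) r := by
    refine (hasDerivAt_integral_of_dominated_loc_of_deriv_le (F' := fun q z => F' (x + q • z) z)
      (bound := fun z => C' * ‖z‖) (s := univ) univ_mem ?_ ?_ ?_ ?_ ?_ ?_).2
    · exact Eventually.of_forall fun q => (by fun_prop : Continuous _).aestronglyMeasurable
    · exact Integrable.of_bound (by fun_prop : Continuous _).aestronglyMeasurable C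
        (Eventually.of_forall fun z => hC _)
    · exact (by fun_prop : Continuous _).aestronglyMeasurable
    · exact Eventually.of_forall fun z q _ => (F' (x + q • z)).le_of_opNorm_le (hC' _) z
    · exact integrable_norm_stdGaussian.const_mul _
    · refine Eventually.of_forall fun z q _ => ?_
      have h2 : HasDerivAt (fun q : ℝ => x + q • z) z q := by
        simpa using ((hasDerivAt_id q).smul_const z).const_add x
      simpa [Function.comp_def] using (hF _).comp_hasDerivAt q h2
  convert h1 using 1
  have h3 : ∀ z : E, F' (x + r • z) z = ∑ i, F' (x + r • z) (b i) * inner ℝ z (b i) := by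
    intro z
    have h := congrArg (F' (x + r • z)) (b.sum_repr z)
    rw [map_sum] at h
    rw [← h]
    refine Finset.sum_congr rfl fun i _ => ?_
    rw [map_smul, b.repr_apply_apply, smul_eq_mul, mul_comm, real_inner_comm]
  simp_rw [h3]
  rw [integral_finsetSum, gaussianAverage, integral_finsetSum, Finset.mul_sum]
  · refine Finset.sum_congr rfl fun i _ => ?_
    rw [integral_mul_inner_stdGaussian (hF' i) (hc'' i) (C := C') (C' := C'') ?_ (hC'' i) hr]
    intro y
    simpa using (F' y).le_of_opNorm_le (hC' y) (b i)
  · intro i _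
    refine Integrable.of_bound (C := C'') ?_ (Eventually.of_forall fun z => ?_)
    · have := hc'' i
      exact (by fun_prop : Continuous _).aestronglyMeasurable
    · simpa using (F'' i (x + r • z)).le_of_opNorm_le (hC'' i _) (b i)
  · intro i _
    refine Integrable.mono' (integrable_norm_stdGaussian.const_mul C')
      (by fun_prop : Continuous _).aestronglyMeasurable (Eventually.of_forall fun z => ?_)
    rw [norm_mul]
    refine mul_le_mul ?_ ?_ (norm_nonneg _) ((norm_nonneg _).trans (hC' 0))
    · simpa using (F' (x + r • z)).le_of_opNorm_le (hC' _) (b i)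
    · simpa using norm_inner_le_norm (𝕜 := ℝ) z (b i)

/-- The heat flow of a `C²` function is the time integral of the heat flow of its Laplacian. -/
theorem gaussianAverage_sub_eq_integral {ι : Type*} [Fintype ι] (b : OrthonormalBasis ι ℝ E)
    {F : E → ℝ} {F' : E → E →L[ℝ] ℝ} {F'' : ι → E → E →L[ℝ] ℝ}
    (hF : ∀ x, HasFDerivAt F (F' x) x) (hF' : ∀ i x, HasFDerivAt (fun y => F' y (b i)) (F'' i x) x)
    (hc' : Continuous F') (hc'' : ∀ i, Continuous (F'' i)) {C C' C'' : ℝ} (hC : ∀ y, ‖F y‖ ≤ C)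
    (hC' : ∀ y, ‖F' y‖ ≤ C') (hC'' : ∀ i y, ‖F'' i y‖ ≤ C'') {h : ℝ} (hh : 0 ≤ h) (x : E) :
    gaussianAverage √(2 * h) F x - F x =
      ∫ r in 0..h, gaussianAverage √(2 * r) (fun y => ∑ i, F'' i y (b i)) x := by
  have hFc : Continuous F := continuous_iff_continuousAt.2 fun x => (hF x).continuousAt
  have hLc : Continuous fun y => ∑ i, F'' i y (b i) := by fun_prop
  have hL : ∀ y, ‖∑ i, F'' i y (b i)‖ ≤ ∑ _i : ι, C'' := fun y =>
    (norm_sum_le _ _).trans (Finset.sum_le_sum fun i _ => by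
      simpa using (F'' i y).le_of_opNorm_le (hC'' i y) (b i))
  -- The radius √(2r) is not differentiable at r = 0, so the derivative is used only inside the
  -- interval, with continuity at its ends.
  have key := intervalIntegral.integral_eq_sub_of_hasDeriv_right_of_le hh
    (f := fun r => gaussianAverage √(2 * r) F x)
    (f' := fun r => gaussianAverage √(2 * r) (fun y => ∑ i, F'' i y (b i)) x) ?_ ?_ ?_
  · rw [key]
    simp [gaussianAverage_zero]
  · exact ((continuous_gaussianAverage hFc hC).comp (by fun_prop :
      Continuous fun r : ℝ => (√(2 * r), x))).continuousOn
  · intro r hr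
    have h1 : √(2 * r) ≠ 0 := (Real.sqrt_pos.2 (by linarith [hr.1])).ne'
    have h2 : HasDerivAt (fun r : ℝ => √(2 * r)) (1 / √(2 * r)) r := by
      have := ((hasDerivAt_id r).const_mul 2).sqrt (by simpa using hr.1.ne')
      simp only [id, mul_one] at this
      convert this using 1
      field_simp
    have h3 := (hasDerivAt_gaussianAverage_radius b hF hF' hc' hc'' hC hC' hC'' h1 x).comp r h2
    refine (h3.congr_deriv ?_).hasDerivWithinAt
    field_simp
  · exact ((continuous_gaussianAverage hLc hL).comp (by fun_prop :
      Continuous fun r : ℝ => (√(2 * r), x))).intervalIntegrable _ _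

/-- Second order expansion of the heat flow in time, with an explicit error. -/
theorem norm_gaussianAverage_sub_le {ι : Type*} [Fintype ι] (b : OrthonormalBasis ι ℝ E)
    {F : E → ℝ} {F' : E → E →L[ℝ] ℝ} {F'' : ι → E → E →L[ℝ] ℝ}
    (hF : ∀ x, HasFDerivAt F (F' x) x) (hF' : ∀ i x, HasFDerivAt (fun y => F' y (b i)) (F'' i x) x)
    (hc' : Continuous F') (hc'' : ∀ i, Continuous (F'' i)) {C C' C'' K : ℝ} (hC : ∀ y, ‖F y‖ ≤ C)
    (hC' : ∀ y, ‖F' y‖ ≤ C') (hC'' : ∀ i y, ‖F'' i y‖ ≤ C'')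
    (hK : ∀ y, ‖∑ i, F'' i y (b i)‖ ≤ K) {h : ℝ} (hh : 0 ≤ h) (x : E) :
    ‖gaussianAverage √(2 * h) F x - F x‖ ≤ K * h := by
  rw [gaussianAverage_sub_eq_integral b hF hF' hc' hc'' hC hC' hC'' hh]
  simpa [abs_of_nonneg hh] using intervalIntegral.norm_integral_le_of_norm_le_const (a := 0) (b := h)
    fun r _ => norm_gaussianAverage_le hK √(2 * r) x

variable (E) in
/-- The uniform measure on `(0, 1)` times the standard Gaussian measure. -/
noncomputable def duhamelMeasure : Measure (ℝ × E) :=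
  (volume.restrict (Ioo (0 : ℝ) 1)).prod (stdGaussian E)

instance : IsProbabilityMeasure (volume.restrict (Ioo (0 : ℝ) 1)) := ⟨by simp⟩

instance : IsProbabilityMeasure (duhamelMeasure E) := by
  unfold duhamelMeasure; infer_instance

theorem ae_duhamelMeasure : ∀ᵐ p ∂duhamelMeasure E, p.1 ∈ Ioo (0 : ℝ) 1 := by
  have h : ∀ᵐ q ∂(volume.restrict (Ioo (0 : ℝ) 1)), q ∈ Ioo (0 : ℝ) 1 :=
    ae_restrict_mem measurableSet_Ioo
  exact Measure.quasiMeasurePreserving_fst.ae h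

/-- The average over `τ ∈ (0, t)` of `e^{-Λ (t - τ)}` times the heat flow for the time `t - τ`
of the source `G τ`, in variables that make the domain of integration independent of `t`. -/
noncomputable def duhamelPotential (Λ : ℝ) (G : ℝ → E → H) (t : ℝ) (x : E) : H :=
  ∫ p, Real.exp (-(Λ * t * p.1)) • G (t * (1 - p.1)) (x + √(2 * (t * p.1)) • p.2) ∂duhamelMeasure E

theorem integrable_inv_sqrt_Ioo : IntegrableOn (fun q : ℝ => (√q)⁻¹) (Ioo 0 1) := by
  have h := intervalIntegral.intervalIntegrable_rpow' (a := 0) (b := 1) (r := -(1 / 2)) (by norm_num)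
  rw [intervalIntegrable_iff_integrableOn_Ioo_of_le zero_le_one] at h
  refine h.congr_fun (fun q hq => ?_) measurableSet_Ioo
  simp only
  rw [Real.sqrt_eq_rpow, Real.rpow_neg hq.1.le]

/-- The majorant for the differentiated Duhamel integrand, up to a constant. -/
theorem integrable_inv_sqrt_mul_norm :
    Integrable (fun p : ℝ × E => (√p.1)⁻¹ * ‖p.2‖) (duhamelMeasure E) :=
  integrable_inv_sqrt_Ioo.mul_prod integrable_norm_stdGaussian

theorem exp_neg_mul_le_one {Λ t q : ℝ} (hΛ : 0 ≤ Λ) (ht : 0 ≤ t) (hq : 0 ≤ q) :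
    Real.exp (-(Λ * t * q)) ≤ 1 := Real.exp_le_one_iff.2 (by
  have : 0 ≤ Λ * t * q := by positivity
  linarith)

theorem measurable_duhamelPotential {G : ℝ → E → ℝ} (hG : Measurable (Function.uncurry G)) (Λ : ℝ) :
    Measurable (fun p : ℝ × E => duhamelPotential Λ G p.1 p.2) := by
  refine StronglyMeasurable.measurable (StronglyMeasurable.integral_prod_right
    (f := fun (p : ℝ × E) (q : ℝ × E) => Real.exp (-(Λ * p.1 * q.1)) •
      G (p.1 * (1 - q.1)) (p.2 + √(2 * (p.1 * q.1)) • q.2)) ?_)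
  refine Measurable.stronglyMeasurable ?_
  have h : Measurable fun a : (ℝ × E) × ℝ × E =>
    G (a.1.1 * (1 - a.2.1)) (a.1.2 + √(2 * (a.1.1 * a.2.1)) • a.2.2) :=
    hG.comp (f := fun a : (ℝ × E) × ℝ × E =>
      (a.1.1 * (1 - a.2.1), a.1.2 + √(2 * (a.1.1 * a.2.1)) • a.2.2)) (by fun_prop)
  simp only [Function.uncurry_def]
  exact Measurable.smul (f := fun a : (ℝ × E) × ℝ × E => Real.exp (-(Λ * a.1.1 * a.2.1)))
    (by fun_prop) h

theorem measurable_gaussianAverage {F : E → ℝ} (hF : Measurable F) :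
    Measurable (fun p : ℝ × E => gaussianAverage √(2 * p.1) F p.2) := by
  refine StronglyMeasurable.measurable (StronglyMeasurable.integral_prod_right
    (f := fun (p : ℝ × E) (z : E) => F (p.2 + √(2 * p.1) • z)) ?_)
  exact (hF.comp (by fun_prop)).stronglyMeasurable

theorem norm_duhamelPotential_le {Λ : ℝ} (hΛ : 0 ≤ Λ) {G : ℝ → E → H} {C : ℝ}
    (hC : ∀ t y, ‖G t y‖ ≤ C) {t : ℝ} (ht : 0 ≤ t) (x : E) : ‖duhamelPotential Λ G t x‖ ≤ C := by
  have := norm_integral_le_of_norm_le_const (μ := duhamelMeasure E) (C := C)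
    (f := fun p => Real.exp (-(Λ * t * p.1)) • G (t * (1 - p.1)) (x + √(2 * (t * p.1)) • p.2)) ?_
  · simpa [duhamelPotential] using this
  · filter_upwards [ae_duhamelMeasure] with p hp
    rw [norm_smul, Real.norm_of_nonneg (Real.exp_pos _).le]
    exact (mul_le_of_le_one_left (norm_nonneg _) (exp_neg_mul_le_one hΛ ht hp.1.le)).trans (hC _ _)

theorem integrable_duhamel {Λ : ℝ} (hΛ : 0 ≤ Λ) {G : ℝ → E → ℝ}
    (hG : Measurable (Function.uncurry G)) {C : ℝ}
    (hC : ∀ t y, ‖G t y‖ ≤ C) {t : ℝ} (ht : 0 ≤ t) (x : E) :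
    Integrable (fun p : ℝ × E =>
      Real.exp (-(Λ * t * p.1)) • G (t * (1 - p.1)) (x + √(2 * (t * p.1)) • p.2))
      (duhamelMeasure E) := by
  refine Integrable.of_bound (C := C) ?_ ?_
  · refine AEStronglyMeasurable.fun_smul (by fun_prop : Continuous _).aestronglyMeasurable ?_
    exact (hG.comp (f := fun p : ℝ × E => (t * (1 - p.1), x + √(2 * (t * p.1)) • p.2))
      (by fun_prop)).aestronglyMeasurable
  · filter_upwards [ae_duhamelMeasure] with p hp
    rw [norm_smul, Real.norm_of_nonneg (Real.exp_pos _).le]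
    exact (mul_le_of_le_one_left (norm_nonneg _) (exp_neg_mul_le_one hΛ ht hp.1.le)).trans (hC _ _)

theorem duhamelPotential_eq_integral_gaussianAverage {Λ : ℝ} (hΛ : 0 ≤ Λ) {G : ℝ → E → ℝ}
    (hG : Measurable (Function.uncurry G)) {C : ℝ}
    (hC : ∀ t y, ‖G t y‖ ≤ C) {t : ℝ} (ht : 0 ≤ t) (x : E) :
    duhamelPotential Λ G t x = ∫ q in Ioo 0 1, Real.exp (-(Λ * t * q)) *
      gaussianAverage √(2 * (t * q)) (G (t * (1 - q))) x := by
  have h := integrable_duhamel hΛ hG hC ht x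
  rw [duhamelMeasure] at h
  rw [duhamelPotential, duhamelMeasure, integral_prod _ h]
  simp only [smul_eq_mul, integral_const_mul, gaussianAverage]

/-- Continuity of the source at positive times is enough: for t > 0 and q < 1 the source is
evaluated at time t(1 - q) > 0, never at the singular initial time. -/
theorem continuousOn_duhamelPotential {S : Type*} [TopologicalSpace S] [FirstCountableTopology S]
    {Λ : ℝ} (hΛ : 0 ≤ Λ) {G : S → ℝ → E → ℝ} (hm : ∀ s, Measurable (Function.uncurry (G s)))
    (hG : ContinuousOn (fun q : S × ℝ × E => G q.1 q.2.1 q.2.2) (univ ×ˢ Ioi 0 ×ˢ univ)) {C : ℝ}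
    (hC : ∀ s t y, ‖G s t y‖ ≤ C) :
    ContinuousOn (fun q : S × ℝ × E => duhamelPotential Λ (G q.1) q.2.1 q.2.2)
      (univ ×ˢ Ioi 0 ×ˢ univ) := by
  have hop : IsOpen ((univ : Set S) ×ˢ Ioi (0 : ℝ) ×ˢ (univ : Set E)) :=
    isOpen_univ.prod (isOpen_Ioi.prod isOpen_univ)
  intro q₀ hq₀
  refine ContinuousAt.continuousWithinAt ?_
  have hnh := hop.mem_nhds hq₀
  refine continuousAt_of_dominated (bound := fun _ => C) ?_ ?_ (integrable_const _) ?_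
  · filter_upwards [hnh] with q hq
    exact (integrable_duhamel hΛ (hm q.1) (hC q.1) hq.2.1.le q.2.2).1
  · filter_upwards [hnh] with q hq
    filter_upwards [ae_duhamelMeasure] with p hp
    rw [norm_smul, Real.norm_of_nonneg (Real.exp_pos _).le]
    exact (mul_le_of_le_one_left (norm_nonneg _)
      (exp_neg_mul_le_one hΛ hq.2.1.le hp.1.le)).trans (hC _ _ _)
  · filter_upwards [ae_duhamelMeasure] with p hp
    have h0 : ContinuousAt (fun q : S × ℝ × E => Real.exp (-(Λ * q.2.1 * p.1))) q₀ := by fun_prop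
    have h1 : ContinuousAt (fun q : S × ℝ × E => G q.1 q.2.1 q.2.2)
        (q₀.1, q₀.2.1 * (1 - p.1), q₀.2.2 + √(2 * (q₀.2.1 * p.1)) • p.2) :=
      hG.continuousAt (hop.mem_nhds ⟨mem_univ _, mul_pos hq₀.2.1 (sub_pos.2 hp.2), mem_univ _⟩)
    have h2 : ContinuousAt (fun q : S × ℝ × E =>
      (q.1, q.2.1 * (1 - p.1), q.2.2 + √(2 * (q.2.1 * p.1)) • p.2)) q₀ := by fun_prop
    exact h0.smul (ContinuousAt.comp (f := fun q : S × ℝ × E =>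
      (q.1, q.2.1 * (1 - p.1), q.2.2 + √(2 * (q.2.1 * p.1)) • p.2)) h1 h2)

/-- For a globally continuous source continuity holds across t = 0 too, which is needed to
differentiate h ↦ h times the potential at h = 0. For t of arbitrary sign the exponential factor is
only locally bounded. -/
theorem continuous_duhamelPotential {Λ : ℝ} {G : ℝ → E → H}
    (hG : Continuous (Function.uncurry G)) {C : ℝ} (hC : ∀ t y, ‖G t y‖ ≤ C) :
    Continuous (fun q : ℝ × E => duhamelPotential Λ G q.1 q.2) := by
  refine continuous_iff_continuousAt.2 fun q₀ => ?_
  have hb : ∀ᶠ q : ℝ × E in 𝓝 q₀, |Λ * q.1| < |Λ * q₀.1| + 1 :=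
    (by fun_prop : Continuous fun q : ℝ × E => |Λ * q.1|).continuousAt.eventually_lt
      continuousAt_const (lt_add_one _)
  have hc : ∀ q : ℝ × E, Continuous fun p : ℝ × E =>
      Real.exp (-(Λ * q.1 * p.1)) • G (q.1 * (1 - p.1)) (q.2 + √(2 * (q.1 * p.1)) • p.2) := fun q =>
    (by fun_prop : Continuous fun p : ℝ × E => Real.exp (-(Λ * q.1 * p.1))).smul
      (hG.comp (f := fun p : ℝ × E => (q.1 * (1 - p.1), q.2 + √(2 * (q.1 * p.1)) • p.2))
        (by fun_prop))
  refine continuousAt_of_dominated (bound := fun _ => Real.exp (|Λ * q₀.1| + 1) * C) ?_ ?_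
    (integrable_const _) ?_
  · exact Eventually.of_forall fun q => (hc q).aestronglyMeasurable
  · filter_upwards [hb] with q hq
    filter_upwards [ae_duhamelMeasure] with p hp
    rw [norm_smul, Real.norm_of_nonneg (Real.exp_pos _).le]
    refine mul_le_mul (Real.exp_le_exp.2 ?_) (hC _ _) (norm_nonneg _) (Real.exp_pos _).le
    have h1 : |Λ * q.1 * p.1| ≤ |Λ * q.1| := by
      rw [abs_mul]
      exact mul_le_of_le_one_right (abs_nonneg _) (abs_le.2 ⟨by linarith [hp.1], hp.2.le⟩)
    linarith [neg_abs_le (Λ * q.1 * p.1)]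
  · refine Eventually.of_forall fun p => ContinuousAt.fun_smul
      (f := fun q : ℝ × E => Real.exp (-(Λ * q.1 * p.1))) (by fun_prop) ?_
    exact (hG.comp (f := fun q : ℝ × E => (q.1 * (1 - p.1), q.2 + √(2 * (q.1 * p.1)) • p.2))
      (by fun_prop : Continuous fun q : ℝ × E =>
        (q.1 * (1 - p.1), q.2 + √(2 * (q.1 * p.1)) • p.2))).continuousAt

/-- Here the derivative falls on the source, so the gradient is again a Duhamel potential; this is
what makes a second round of smoothing possible. -/
theorem hasFDerivAt_duhamelPotential_of_hasFDerivAt {Λ : ℝ} (hΛ : 0 ≤ Λ) {G : ℝ → E → ℝ}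
    {G' : ℝ → E → E →L[ℝ] ℝ} (hG : Continuous (Function.uncurry G))
    (hG' : Continuous (Function.uncurry G')) {C C' : ℝ} (hC : ∀ t y, ‖G t y‖ ≤ C)
    (hC' : ∀ t y, ‖G' t y‖ ≤ C') (h : ∀ t x, HasFDerivAt (G t) (G' t x) x) {t : ℝ} (ht : 0 ≤ t)
    (x : E) : HasFDerivAt (duhamelPotential Λ G t) (duhamelPotential Λ G' t x) x := by
  refine hasFDerivAt_integral_of_dominated_of_fderiv_le (F' := fun y (p : ℝ × E) =>
    Real.exp (-(Λ * t * p.1)) • G' (t * (1 - p.1)) (y + √(2 * (t * p.1)) • p.2))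
    (bound := fun _ => C') (s := univ) univ_mem ?_ ?_ ?_ ?_ ?_ ?_
  · exact Eventually.of_forall fun y => (integrable_duhamel hΛ hG.measurable hC ht y).1
  · exact integrable_duhamel hΛ hG.measurable hC ht x
  · refine Continuous.aestronglyMeasurable (Continuous.fun_smul
      (f := fun p : ℝ × E => Real.exp (-(Λ * t * p.1))) (by fun_prop) ?_)
    exact hG'.comp (f := fun p : ℝ × E => (t * (1 - p.1), x + √(2 * (t * p.1)) • p.2)) (by fun_prop)
  · filter_upwards [ae_duhamelMeasure] with p hp y _
    rw [norm_smul, Real.norm_of_nonneg (Real.exp_pos _).le]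
    exact (mul_le_of_le_one_left (norm_nonneg _) (exp_neg_mul_le_one hΛ ht hp.1.le)).trans (hC' _ _)
  · exact integrable_const _
  · refine Eventually.of_forall fun p y _ => HasFDerivAt.fun_const_smul ?_ _
    have h1 : HasFDerivAt (fun y : E => y + √(2 * (t * p.1)) • p.2) (ContinuousLinearMap.id ℝ E) y :=
      (hasFDerivAt_id y).add_const _
    simpa [Function.comp_def] using (h _ _).comp y h1

/-- The gradient of `duhamelPotential`, with the derivative on the Gaussian kernel. -/
noncomputable def duhamelGradient (Λ : ℝ) (G : ℝ → E → ℝ) (t : ℝ) (x : E) : E →L[ℝ] ℝ :=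
  ∫ p, (Real.exp (-(Λ * t * p.1)) * (√(2 * (t * p.1)))⁻¹ *
    G (t * (1 - p.1)) (x + √(2 * (t * p.1)) • p.2)) • innerSL ℝ p.2 ∂duhamelMeasure E

/-- The lower bound δ ≤ t separates the singularity q^{-1/2} from t, giving one majorant for all t ≥
δ. -/
theorem norm_duhamelGradient_integrand_le {Λ : ℝ} (hΛ : 0 ≤ Λ) {G : ℝ → E → ℝ} {C : ℝ}
    (hC : ∀ t y, ‖G t y‖ ≤ C) {δ t : ℝ} (hδ : 0 < δ) (ht : δ ≤ t) (x : E) {p : ℝ × E}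
    (hp : p.1 ∈ Ioo (0 : ℝ) 1) :
    ‖(Real.exp (-(Λ * t * p.1)) * (√(2 * (t * p.1)))⁻¹ *
      G (t * (1 - p.1)) (x + √(2 * (t * p.1)) • p.2)) • innerSL ℝ p.2‖ ≤
      (√(2 * δ))⁻¹ * C * ((√p.1)⁻¹ * ‖p.2‖) := by
  have hp1 := hp.1
  have h1 : (√(2 * (t * p.1)))⁻¹ ≤ (√(2 * δ))⁻¹ * (√p.1)⁻¹ := by
    rw [← mul_inv, ← Real.sqrt_mul (by positivity)]
    apply inv_anti₀ (Real.sqrt_pos.2 (by positivity))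
    apply Real.sqrt_le_sqrt
    nlinarith
  rw [norm_smul, norm_mul, norm_mul, innerSL_apply_norm, Real.norm_of_nonneg (Real.exp_pos _).le,
    Real.norm_of_nonneg (by positivity)]
  calc _ ≤ 1 * ((√(2 * δ))⁻¹ * (√p.1)⁻¹) * C * ‖p.2‖ := by
        gcongr
        · exact exp_neg_mul_le_one hΛ (hδ.le.trans ht) hp1.le
        · exact hC _ _
    _ = _ := by ring

theorem aestronglyMeasurable_duhamelGradient_integrand (Λ : ℝ) {G : ℝ → E → ℝ}
    (hG : Continuous (Function.uncurry G)) (t : ℝ) (x : E) :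
    AEStronglyMeasurable (fun p : ℝ × E => (Real.exp (-(Λ * t * p.1)) * (√(2 * (t * p.1)))⁻¹ *
      G (t * (1 - p.1)) (x + √(2 * (t * p.1)) • p.2)) • innerSL ℝ p.2) (duhamelMeasure E) := by
  refine AEStronglyMeasurable.fun_smul ?_ (by fun_prop : Continuous _).aestronglyMeasurable
  refine AEStronglyMeasurable.mul (by fun_prop : Measurable _).aestronglyMeasurable ?_
  exact (hG.comp (f := fun p : ℝ × E => (t * (1 - p.1), x + √(2 * (t * p.1)) • p.2))
    (by fun_prop)).aestronglyMeasurable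

theorem continuousOn_duhamelGradient {Λ : ℝ} (hΛ : 0 ≤ Λ) {G : ℝ → E → ℝ}
    (hG : Continuous (Function.uncurry G)) {C : ℝ} (hC : ∀ t y, ‖G t y‖ ≤ C) :
    ContinuousOn (fun q : ℝ × E => duhamelGradient Λ G q.1 q.2) (Ioi 0 ×ˢ univ) := by
  intro q₀ hq₀
  refine ContinuousAt.continuousWithinAt ?_
  have h0 : 0 < q₀.1 := hq₀.1
  have hnh : Ioi (q₀.1 / 2) ×ˢ (univ : Set E) ∈ 𝓝 q₀ :=
    (isOpen_Ioi.prod isOpen_univ).mem_nhds ⟨half_lt_self h0, mem_univ _⟩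
  refine continuousAt_of_dominated
    (bound := fun p => (√(2 * (q₀.1 / 2)))⁻¹ * C * ((√p.1)⁻¹ * ‖p.2‖)) ?_ ?_ ?_ ?_
  · exact Eventually.of_forall fun q => aestronglyMeasurable_duhamelGradient_integrand Λ hG q.1 q.2
  · filter_upwards [hnh] with q hq
    filter_upwards [ae_duhamelMeasure] with p hp
    exact norm_duhamelGradient_integrand_le hΛ hC (half_pos hq₀.1) hq.1.le q.2 hp
  · exact integrable_inv_sqrt_mul_norm.const_mul _
  · filter_upwards [ae_duhamelMeasure] with p hp
    have hp1 := hp.1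
    refine ContinuousAt.fun_smul (g := fun _ : ℝ × E => innerSL ℝ p.2)
      (ContinuousAt.fun_mul (ContinuousAt.fun_mul
        (f := fun q : ℝ × E => Real.exp (-(Λ * q.1 * p.1))) (by fun_prop) ?_) ?_) continuousAt_const
    · exact ContinuousAt.inv₀ (by fun_prop) (Real.sqrt_pos.2 (by positivity)).ne'
    · exact (hG.comp (f := fun q : ℝ × E => (q.1 * (1 - p.1), q.2 + √(2 * (q.1 * p.1)) • p.2))
        (by fun_prop)).continuousAt

theorem norm_duhamelGradient_le {Λ : ℝ} (hΛ : 0 ≤ Λ) {G : ℝ → E → ℝ} {C : ℝ}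
    (hC : ∀ t y, ‖G t y‖ ≤ C) {δ t : ℝ} (hδ : 0 < δ) (ht : δ ≤ t) (x : E) :
    ‖duhamelGradient Λ G t x‖ ≤
      ∫ p, (√(2 * δ))⁻¹ * C * ((√p.1)⁻¹ * ‖p.2‖) ∂duhamelMeasure E := by
  refine norm_integral_le_of_norm_le (integrable_inv_sqrt_mul_norm.const_mul _) ?_
  filter_upwards [ae_duhamelMeasure] with p hp
  exact norm_duhamelGradient_integrand_le hΛ hC hδ ht x hp

/-- For fixed (q, z) the integrand need not be differentiable in x, because G is only continuous.
Integrating over z first gives a Gaussian average, which is differentiable for each q; the resulting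
q^{-1/2} then allows differentiation under the integral over q. -/
theorem hasFDerivAt_duhamelPotential {Λ : ℝ} (hΛ : 0 ≤ Λ) {G : ℝ → E → ℝ}
    (hG : Continuous (Function.uncurry G)) {C : ℝ} (hC : ∀ t y, ‖G t y‖ ≤ C) {t : ℝ} (ht : 0 < t)
    (x : E) : HasFDerivAt (duhamelPotential Λ G t) (duhamelGradient Λ G t x) x := by
  have hI : ∀ y, Integrable (fun p : ℝ × E => (Real.exp (-(Λ * t * p.1)) * (√(2 * (t * p.1)))⁻¹ *
      G (t * (1 - p.1)) (y + √(2 * (t * p.1)) • p.2)) • innerSL ℝ p.2)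
      ((volume.restrict (Ioo (0 : ℝ) 1)).prod (stdGaussian E)) := fun y =>
    Integrable.mono' (integrable_inv_sqrt_mul_norm.const_mul _)
      (aestronglyMeasurable_duhamelGradient_integrand Λ hG t y)
      (ae_duhamelMeasure.mono fun p hp => norm_duhamelGradient_integrand_le hΛ hC ht le_rfl y hp)
  have h1 : duhamelPotential Λ G t = fun x => ∫ q in Ioo 0 1, Real.exp (-(Λ * t * q)) *
      gaussianAverage √(2 * (t * q)) (G (t * (1 - q))) x :=
    funext fun y => duhamelPotential_eq_integral_gaussianAverage hΛ hG.measurable hC ht.le y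
  have hJ : ∀ y, Integrable (fun q => Real.exp (-(Λ * t * q)) *
      gaussianAverage √(2 * (t * q)) (G (t * (1 - q))) y) (volume.restrict (Ioo (0 : ℝ) 1)) := by
    intro y
    have := (integrable_duhamel hΛ hG.measurable hC ht.le y)
    rw [duhamelMeasure] at this
    simpa only [smul_eq_mul, integral_const_mul, gaussianAverage] using this.integral_prod_left
  rw [h1, duhamelGradient, duhamelMeasure, integral_prod _ (hI x)]
  refine hasFDerivAt_integral_of_dominated_of_fderiv_le (s := univ)
    (F' := fun y q => ∫ z, (Real.exp (-(Λ * t * q)) * (√(2 * (t * q)))⁻¹ *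
      G (t * (1 - q)) (y + √(2 * (t * q)) • z)) • innerSL ℝ z ∂stdGaussian E)
    (bound := fun q => ∫ z, (√(2 * t))⁻¹ * C * ((√q)⁻¹ * ‖z‖) ∂stdGaussian E) univ_mem ?_ ?_ ?_ ?_ ?_ ?_
  · exact Eventually.of_forall fun y => (hJ y).1
  · exact hJ x
  · exact (hI x).integral_prod_left.1
  · refine (ae_restrict_mem measurableSet_Ioo).mono fun q hq y _ => ?_
    refine norm_integral_le_of_norm_le ((integrable_norm_stdGaussian.const_mul _).const_mul _) ?_
    exact Eventually.of_forall fun z =>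
      norm_duhamelGradient_integrand_le hΛ hC ht le_rfl y (p := (q, z)) hq
  · exact (integrable_inv_sqrt_mul_norm.const_mul _).integral_prod_left
  · refine (ae_restrict_mem measurableSet_Ioo).mono fun q hq y _ => ?_
    have h2 : √(2 * (t * q)) ≠ 0 :=
      (Real.sqrt_pos.2 (mul_pos two_pos (mul_pos ht hq.1))).ne'
    have h3 : Measurable (G (t * (1 - q))) :=
      (hG.comp (f := fun y => (t * (1 - q), y)) (by fun_prop)).measurable
    refine ((hasFDerivAt_gaussianAverage h3 (hC _) h2 y).const_mul _).congr_fderiv ?_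
    rw [← integral_smul, ← integral_smul]
    simp only [smul_smul, mul_assoc]

theorem continuousOn_gaussianAverage_gradient {F : E → ℝ} (hF : Continuous F) {C : ℝ}
    (hC : ∀ y, ‖F y‖ ≤ C) :
    ContinuousOn (fun q : ℝ × E => (√(2 * q.1))⁻¹ •
      ∫ z, F (q.2 + √(2 * q.1) • z) • innerSL ℝ z ∂stdGaussian E) (Ioi 0 ×ˢ univ) := by
  refine ContinuousOn.fun_smul (f := fun q : ℝ × E => (√(2 * q.1))⁻¹) ?_ (Continuous.continuousOn ?_)
  · refine ContinuousOn.inv₀ (by fun_prop) fun q hq => (Real.sqrt_pos.2 ?_).ne'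
    exact mul_pos two_pos hq.1
  · refine continuous_of_dominated (bound := fun z => C * ‖z‖) ?_ ?_
      (integrable_norm_stdGaussian.const_mul _) ?_
    · exact fun q => (by fun_prop : Continuous _).aestronglyMeasurable
    · refine fun q => Eventually.of_forall fun z => ?_
      rw [norm_smul, innerSL_apply_norm]
      exact mul_le_mul_of_nonneg_right (hC _) (norm_nonneg _)
    · exact Eventually.of_forall fun z => by fun_prop

theorem norm_integral_smul_innerSL_le {F : E → ℝ} {C : ℝ} (hC : ∀ y, ‖F y‖ ≤ C) (r : ℝ) (x : E) :
    ‖∫ z, F (x + r • z) • innerSL ℝ z ∂stdGaussian E‖ ≤ ∫ z, C * ‖z‖ ∂stdGaussian E := by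
  refine norm_integral_le_of_norm_le (integrable_norm_stdGaussian.const_mul _)
    (Eventually.of_forall fun z => ?_)
  rw [norm_smul, innerSL_apply_norm]
  exact mul_le_mul_of_nonneg_right (hC _) (norm_nonneg _)

/-- Smoothing for the inhomogeneous heat equation `∂ₜ h = Δ h - Λ h + G`. -/
theorem exists_gradient_of_duhamel {Λ : ℝ} (hΛ : 0 ≤ Λ) {F : E → ℝ} (hF : Continuous F)
    {G : ℝ → E → ℝ} (hG : Continuous (Function.uncurry G)) {C : ℝ} (hFC : ∀ y, ‖F y‖ ≤ C)
    (hGC : ∀ t y, ‖G t y‖ ≤ C) :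
    ∃ U : ℝ → E → E →L[ℝ] ℝ,
      (∀ t, 0 < t → ∀ x, HasFDerivAt (fun x => Real.exp (-(Λ * t)) * gaussianAverage √(2 * t) F x +
        t * duhamelPotential Λ G t x) (U t x) x) ∧
      ContinuousOn (fun q : ℝ × E => U q.1 q.2) (Ioi 0 ×ˢ univ) ∧
      ∀ δ T, 0 < δ → ∃ K, ∀ t ∈ Icc δ T, ∀ x, ‖U t x‖ ≤ K := by
  refine ⟨fun t x => Real.exp (-(Λ * t)) • ((√(2 * t))⁻¹ •
    ∫ z, F (x + √(2 * t) • z) • innerSL ℝ z ∂stdGaussian E) + t • duhamelGradient Λ G t x,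
    fun t ht x => HasFDerivAt.fun_add ?_ ?_, ContinuousOn.fun_add ?_ ?_, fun δ T hδ => ?_⟩
  · exact (hasFDerivAt_gaussianAverage hF.measurable hFC
      (Real.sqrt_pos.2 (by positivity)).ne' x).const_mul _
  · exact (hasFDerivAt_duhamelPotential hΛ hG hGC ht x).const_mul _
  · exact ContinuousOn.fun_smul (f := fun q : ℝ × E => Real.exp (-(Λ * q.1))) (by fun_prop)
      (continuousOn_gaussianAverage_gradient hF hFC)
  · exact ContinuousOn.fun_smul (f := fun q : ℝ × E => q.1) (by fun_prop)
      (continuousOn_duhamelGradient hΛ hG hGC)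
  · refine ⟨1 * ((√(2 * δ))⁻¹ * ∫ z, C * ‖z‖ ∂stdGaussian E) +
      T * ∫ p, (√(2 * δ))⁻¹ * C * ((√p.1)⁻¹ * ‖p.2‖) ∂duhamelMeasure E, fun t ht x => ?_⟩
    have ht0 : 0 < t := hδ.trans_le ht.1
    refine (norm_add_le _ _).trans (add_le_add ?_ ?_)
    · rw [norm_smul, norm_smul, Real.norm_of_nonneg (Real.exp_pos _).le,
        Real.norm_of_nonneg (by positivity)]
      refine mul_le_mul (Real.exp_le_one_iff.2 ?_) (mul_le_mul ?_
        (norm_integral_smul_innerSL_le hFC _ _) (norm_nonneg _) (by positivity)) (by positivity)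
        zero_le_one
      · have := mul_nonneg hΛ ht0.le
        linarith
      · exact inv_anti₀ (Real.sqrt_pos.2 (by positivity)) (Real.sqrt_le_sqrt (by linarith [ht.1]))
    · rw [norm_smul, Real.norm_of_nonneg ht0.le]
      exact mul_le_mul ht.2 (norm_duhamelGradient_le hΛ hGC hδ ht.1 x) (norm_nonneg _)
        (ht0.le.trans ht.2)

end Heat

/-! ### Picard iteration: existence, order and continuous dependence -/

section Picard

open ProbabilityTheory Filter Topology Module

variable {E : Type*} [NormedAddCommGroup E] [InnerProductSpace ℝ E] [FiniteDimensional ℝ E]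
  [MeasurableSpace E] [BorelSpace E]

/-- In kernel form `F` is evaluated at the integration variable itself, so a null set of bad points
stays a fixed null set as x and r vary. -/
theorem gaussianAverage_eq_integral_kernel (F : E → ℝ) {r : ℝ} (hr : r ≠ 0) (x : E) :
    gaussianAverage r F x =
      |(r ^ finrank ℝ E)⁻¹| * ∫ y, gaussianDensity (r⁻¹ • (y - x)) * F y := by
  rw [gaussianAverage, integral_stdGaussian_eq,
    ← integral_add_right_eq_self (fun y => gaussianDensity (r⁻¹ • (y - x)) * F y) x,
    ← smul_eq_mul, ← Measure.integral_comp_smul volume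
      (fun w => gaussianDensity (r⁻¹ • (w + x - x)) * F (w + x)) r]
  refine integral_congr_ae (Eventually.of_forall fun z => ?_)
  simp only
  rw [add_sub_cancel_right, smul_smul, inv_mul_cancel₀ hr, one_smul, smul_eq_mul, add_comm x]

theorem continuousOn_gaussianAverage_family {S : Type*} [TopologicalSpace S]
    [FirstCountableTopology S] {U : S → E → ℝ} (hm : ∀ s, Measurable (U s)) {C : ℝ}
    (hC : ∀ s y, ‖U s y‖ ≤ C) (hU : ∀ s, ∀ᵐ y, ContinuousAt (fun s => U s y) s) :
    ContinuousOn (fun q : S × ℝ × E => gaussianAverage √(2 * q.2.1) (U q.1) q.2.2)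
      (univ ×ˢ Ioi 0 ×ˢ univ) := by
  have hpos : ∀ q ∈ (univ : Set S) ×ˢ Ioi (0 : ℝ) ×ˢ (univ : Set E), √(2 * q.2.1) ≠ 0 :=
    fun q hq => (Real.sqrt_pos.2 (mul_pos two_pos hq.2.1)).ne'
  suffices h : ContinuousOn (fun q : S × ℝ × E => |(√(2 * q.2.1) ^ finrank ℝ E)⁻¹| *
      ∫ y, gaussianDensity ((√(2 * q.2.1))⁻¹ • (y - q.2.2)) * U q.1 y) (univ ×ˢ Ioi 0 ×ˢ univ) from
    h.congr fun q hq => gaussianAverage_eq_integral_kernel _ (hpos q hq) _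
  refine ContinuousOn.mul ?_ ?_
  · refine ContinuousOn.abs (ContinuousOn.inv₀ (by fun_prop) fun q hq => pow_ne_zero _ (hpos q hq))
  intro q₀ hq₀
  have h0 : 0 < q₀.2.1 := hq₀.2.1
  refine ContinuousAt.continuousWithinAt ?_
  have hnh : (univ : Set S) ×ˢ Ioo 0 (2 * q₀.2.1) ×ˢ Metric.ball q₀.2.2 1 ∈ 𝓝 q₀ :=
    (isOpen_univ.prod (isOpen_Ioo.prod Metric.isOpen_ball)).mem_nhds
      ⟨mem_univ _, ⟨h0, by linarith⟩, Metric.mem_ball_self one_pos⟩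
  -- For times below 2t₀ and centres within 1 of x₀, the inequality ‖y - x₀‖² ≤ 2‖y - x‖² + 2
  -- dominates every kernel by one wider Gaussian centred at x₀.
  refine continuousAt_of_dominated (bound := fun y =>
    (((2 * Real.pi) ^ (finrank ℝ E / 2 : ℝ))⁻¹ * Real.exp (1 / (4 * (2 * q₀.2.1)))) *
      Real.exp (-(1 / (8 * (2 * q₀.2.1))) * ‖y - q₀.2.2‖ ^ 2) * C) ?_ ?_ ?_ ?_
  · refine Eventually.of_forall fun q => AEStronglyMeasurable.mul ?_ (hm q.1).aestronglyMeasurable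
    exact (continuous_gaussianDensity.comp (by fun_prop)).aestronglyMeasurable
  · filter_upwards [hnh] with q hq
    refine Eventually.of_forall fun y => ?_
    have ht : 0 < q.2.1 := hq.2.1.1
    rw [norm_mul, Real.norm_of_nonneg (gaussianDensity_pos _).le]
    refine mul_le_mul ?_ (hC _ _) (norm_nonneg _) (by positivity)
    rw [gaussianDensity, mul_assoc]
    refine mul_le_mul_of_nonneg_left ?_ (by positivity)
    rw [← Real.exp_add]
    refine Real.exp_le_exp.2 ?_
    have h1 : ‖y - q₀.2.2‖ ^ 2 ≤ 2 * ‖y - q.2.2‖ ^ 2 + 2 := by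
      have h2 : ‖y - q₀.2.2‖ ≤ ‖y - q.2.2‖ + 1 := by
        have h3 := norm_add_le (y - q.2.2) (q.2.2 - q₀.2.2)
        rw [sub_add_sub_cancel] at h3
        have h4 : ‖q.2.2 - q₀.2.2‖ < 1 := mem_ball_iff_norm.1 hq.2.2
        linarith
      nlinarith [norm_nonneg (y - q₀.2.2), norm_nonneg (y - q.2.2), sq_nonneg (‖y - q.2.2‖ - 1)]
    rw [norm_smul, norm_inv, mul_pow, inv_pow, Real.norm_of_nonneg (Real.sqrt_nonneg _),
      Real.sq_sqrt (by positivity)]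
    have h5 : (2 * (2 * q₀.2.1))⁻¹ ≤ (2 * q.2.1)⁻¹ :=
      inv_anti₀ (by positivity) (by linarith [hq.2.1.2])
    have h6 := mul_le_mul_of_nonneg_right h5 (sq_nonneg ‖y - q.2.2‖)
    have h7 := mul_le_mul_of_nonneg_left h1
      (show (0 : ℝ) ≤ 1 / (8 * (2 * q₀.2.1)) by positivity)
    have h8 : 1 / (8 * (2 * q₀.2.1)) * (2 * ‖y - q.2.2‖ ^ 2 + 2) =
        1 / 2 * ((2 * (2 * q₀.2.1))⁻¹ * ‖y - q.2.2‖ ^ 2) + 1 / (4 * (2 * q₀.2.1)) := by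
      field_simp
      ring
    linarith
  · exact ((integrable_exp_neg_mul_sq_norm (by positivity) _).const_mul _).mul_const _
  · filter_upwards [hU q₀.1] with y hy
    refine ContinuousAt.mul ?_ (ContinuousAt.comp (f := fun q : S × ℝ × E => q.1) hy (by fun_prop))
    refine continuous_gaussianDensity.continuousAt.comp ?_
    refine ContinuousAt.smul (ContinuousAt.inv₀ (by fun_prop) (hpos q₀ hq₀)) (by fun_prop)

/-- Fubini and a translation move the displacement √(2t) z from `U s` to the test function. No
singular kernel is left, so t = 0 needs no separate treatment. -/
theorem continuous_integral_gaussianAverage_mul {S : Type*} [TopologicalSpace S]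
    [FirstCountableTopology S] {U : S → E → ℝ} (hm : ∀ s, Measurable (U s)) {C : ℝ}
    (hC : ∀ s y, ‖U s y‖ ≤ C) (hU : ∀ s, ∀ᵐ y, ContinuousAt (fun s => U s y) s) {φ : E → ℝ}
    (hφ : Continuous φ) (hφc : HasCompactSupport φ) :
    Continuous (fun q : S × ℝ => ∫ x, gaussianAverage √(2 * q.2) (U q.1) x * φ x) := by
  have hφi : Integrable φ := hφ.integrable_of_hasCompactSupport hφc
  obtain ⟨K, hK⟩ := hφc.exists_bound_of_continuous hφ
  have hmeas : ∀ (s : S) (r : ℝ), Measurable fun p : E × E => U s (p.1 + r • p.2) := fun s r =>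
    (hm s).comp (by fun_prop)
  have hint : ∀ (s : S) (r : ℝ), Integrable (fun p : E × E => U s (p.1 + r • p.2) * φ p.1)
      (volume.prod (stdGaussian E)) := by
    intro s r
    refine Integrable.mono' (g := fun p : E × E => (C * ‖φ p.1‖) * 1)
      (Integrable.mul_prod (hφi.norm.const_mul C) (integrable_const 1))
      ((hmeas s r).aestronglyMeasurable.mul (by fun_prop : Continuous _).aestronglyMeasurable)
      (Eventually.of_forall fun p => ?_)
    rw [norm_mul, mul_one]
    exact mul_le_mul_of_nonneg_right (hC _ _) (norm_nonneg _)
  have heq : ∀ q : S × ℝ, ∫ x, gaussianAverage √(2 * q.2) (U q.1) x * φ x =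
      ∫ z, (∫ y, U q.1 y * φ (y - √(2 * q.2) • z)) ∂stdGaussian E := by
    intro q
    have h1 := integral_integral_swap
      (f := fun x z => U q.1 (x + √(2 * q.2) • z) * φ x) (hint q.1 √(2 * q.2))
    simp only [integral_mul_const] at h1
    simp only [gaussianAverage]
    rw [h1]
    refine integral_congr_ae (Eventually.of_forall fun z => ?_)
    simp only
    rw [← integral_add_right_eq_self (fun y => U q.1 y * φ (y - √(2 * q.2) • z)) (√(2 * q.2) • z)]
    simp
  simp_rw [heq]
  refine continuous_iff_continuousAt.2 fun q₀ => ?_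
  refine continuousAt_of_dominated (bound := fun _ => C * ∫ y, ‖φ y‖) ?_ ?_ (integrable_const _) ?_
  · refine Eventually.of_forall fun q => ?_
    have h1 := (hint q.1 √(2 * q.2)).integral_prod_right.1
    refine h1.congr (Eventually.of_forall fun z => ?_)
    simp only
    rw [← integral_add_right_eq_self (fun y => U q.1 y * φ (y - √(2 * q.2) • z)) (√(2 * q.2) • z)]
    simp
  · refine Eventually.of_forall fun q => Eventually.of_forall fun z => ?_
    have h1 : Integrable (fun y => C * ‖φ (y - √(2 * q.2) • z)‖) :=
      (hφi.norm.comp_sub_right _).const_mul _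
    refine (norm_integral_le_of_norm_le h1 (Eventually.of_forall fun y => ?_)).trans_eq ?_
    · rw [norm_mul]
      exact mul_le_mul_of_nonneg_right (hC _ _) (norm_nonneg _)
    · rw [integral_const_mul, integral_sub_right_eq_self (fun y => ‖φ y‖)]
  · refine Eventually.of_forall fun z => ?_
    obtain ⟨R, hR⟩ := hφc.isCompact.isBounded.subset_closedBall (0 : E)
    have hb : ∀ᶠ q : S × ℝ in 𝓝 q₀, ‖√(2 * q.2) • z‖ < ‖√(2 * q₀.2) • z‖ + 1 :=
      (by fun_prop : Continuous fun q : S × ℝ => ‖√(2 * q.2) • z‖).continuousAt.eventually_lt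
        continuousAt_const (lt_add_one _)
    -- This ball contains the supports of the translates of `φ` for all parameters near `q₀`.
    set B := Metric.closedBall (0 : E) (R + (‖√(2 * q₀.2) • z‖ + 1)) with hB
    refine continuousAt_of_dominated (bound := B.indicator fun _ => C * K) ?_ ?_ ?_ ?_
    · exact Eventually.of_forall fun q => (hm q.1).aestronglyMeasurable.mul
        (by fun_prop : Continuous _).aestronglyMeasurable
    · filter_upwards [hb] with q hq
      refine Eventually.of_forall fun y => ?_
      by_cases hy : y ∈ B
      · rw [indicator_of_mem hy, norm_mul]
        exact mul_le_mul (hC _ _) (hK _) (norm_nonneg _) ((norm_nonneg _).trans (hC q.1 y))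
      · have h1 : φ (y - √(2 * q.2) • z) = 0 := by
          by_contra h2
          have h3 := hR (subset_tsupport φ h2)
          rw [mem_closedBall_zero_iff] at h3
          refine hy (mem_closedBall_zero_iff.2 ?_)
          have h4 := norm_add_le (y - √(2 * q.2) • z) (√(2 * q.2) • z)
          rw [sub_add_cancel] at h4
          linarith
        rw [h1, indicator_of_notMem hy]
        simp
    · exact (integrable_indicator_iff Metric.isClosed_closedBall.measurableSet).2
        (integrableOn_const (measure_closedBall_lt_top).ne)
    · filter_upwards [hU q₀.1] with y hy
      exact ContinuousAt.mul (ContinuousAt.comp (f := fun q : S × ℝ => q.1) hy (by fun_prop))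
        (by fun_prop)

theorem integral_fst_duhamelMeasure (f : ℝ → ℝ) :
    ∫ p, f p.1 ∂duhamelMeasure E = ∫ q in (0 : ℝ)..1, f q := by
  rw [duhamelMeasure, integral_fun_fst, intervalIntegral.integral_of_le zero_le_one,
    integral_Ioc_eq_integral_Ioo]
  simp

/-- Used with a = Λ for the bound by 1 and with a = 2L for the contraction; keeping the factor a
under the integral avoids dividing by it. -/
theorem mul_integral_exp_unit (a t : ℝ) :
    t * ∫ q in (0 : ℝ)..1, a * Real.exp (-(a * t * q)) = 1 - Real.exp (-(a * t)) := by
  rw [← intervalIntegral.integral_const_mul]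
  have h : ∀ q ∈ uIcc (0 : ℝ) 1, HasDerivAt (fun q => -Real.exp (-(a * t * q)))
      (t * (a * Real.exp (-(a * t * q)))) q := by
    intro q _
    have h1 : HasDerivAt (fun q => -(a * t * q)) (-(a * t)) q := by
      simpa using ((hasDerivAt_id q).const_mul (a * t)).fun_neg
    exact h1.exp.fun_neg.congr_deriv (by ring)
  rw [intervalIntegral.integral_eq_sub_of_hasDerivAt h
    ((by fun_prop : Continuous fun q => t * (a * Real.exp (-(a * t * q)))).intervalIntegrable _ _)]
  simp
  ring

/-- One Picard step for `∂ₜ u = Δ u - Λ u + g u` with initial datum `U`. -/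
noncomputable def picardStep (Λ : ℝ) (g : ℝ → ℝ) (U : E → ℝ) (u : ℝ → E → ℝ) (t : ℝ) (x : E) : ℝ :=
  Real.exp (-(Λ * t)) * gaussianAverage √(2 * t) U x +
    t * duhamelPotential Λ (fun τ y => g (u τ y)) t x

/-- A nonlinearity for which the Picard scheme preserves `[-1, 1]` and the order. -/
structure IsMonotoneReaction (Λ L : ℝ) (g : ℝ → ℝ) : Prop where
  nonneg : 0 ≤ Λ
  pos : 0 < L
  continuous : Continuous g
  monotone : Monotone g
  bound : ∀ a, ‖g a‖ ≤ Λ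
  lipschitz : ∀ a b, ‖g a - g b‖ ≤ L * ‖a - b‖

variable {Λ L : ℝ} {g : ℝ → ℝ}

theorem norm_exp_mul_gaussianAverage_le {U : E → ℝ} (hU : ∀ y, ‖U y‖ ≤ 1) (t : ℝ) (x : E) :
    ‖Real.exp (-(Λ * t)) * gaussianAverage √(2 * t) U x‖ ≤ Real.exp (-(Λ * t)) := by
  rw [norm_mul, Real.norm_of_nonneg (Real.exp_pos _).le]
  exact mul_le_of_le_one_right (Real.exp_pos _).le (norm_gaussianAverage_le hU _ _)

theorem norm_mul_duhamelPotential_le {G : ℝ → E → ℝ} (hG : ∀ t y, ‖G t y‖ ≤ Λ) {t : ℝ}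
    (ht : 0 ≤ t) (x : E) : ‖t * duhamelPotential Λ G t x‖ ≤ 1 - Real.exp (-(Λ * t)) := by
  rw [norm_mul, Real.norm_of_nonneg ht, ← mul_integral_exp_unit, ← integral_fst_duhamelMeasure (E := E)]
  refine mul_le_mul_of_nonneg_left (norm_integral_le_of_norm_le ?_ (Eventually.of_forall fun p => ?_)) ht
  · have h := integral_fst_duhamelMeasure (E := E)
    refine Integrable.of_bound (C := Λ * Real.exp |Λ * t|)
      (by fun_prop : Continuous _).aestronglyMeasurable ?_
    have hΛ : 0 ≤ Λ := (norm_nonneg _).trans (hG 0 0)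
    filter_upwards [ae_duhamelMeasure] with p hp
    rw [norm_mul, Real.norm_of_nonneg hΛ, Real.norm_of_nonneg (Real.exp_pos _).le]
    refine mul_le_mul_of_nonneg_left (Real.exp_le_exp.2 ?_) hΛ
    refine (neg_le_abs _).trans ?_
    rw [abs_mul _ p.1]
    exact mul_le_of_le_one_right (abs_nonneg _) (abs_le.2 ⟨by linarith [hp.1], hp.2.le⟩)
  · rw [norm_smul, Real.norm_of_nonneg (Real.exp_pos _).le, mul_comm]
    exact mul_le_mul_of_nonneg_right (hG _ _) (Real.exp_pos _).le

/-- The damped heat flow contributes at most e^{-Λt}, and the source, bounded by Λ, at most 1 -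
e^{-Λt}. No bound on `u` enters, since `g` is bounded everywhere. -/
theorem norm_picardStep_le (hg : IsMonotoneReaction Λ L g) {U : E → ℝ} (hU : ∀ y, ‖U y‖ ≤ 1)
    (u : ℝ → E → ℝ) {t : ℝ} (ht : 0 ≤ t) (x : E) : ‖picardStep Λ g U u t x‖ ≤ 1 := by
  have h1 := norm_exp_mul_gaussianAverage_le (Λ := Λ) hU t x
  have h2 := norm_mul_duhamelPotential_le (G := fun τ y => g (u τ y)) (fun _ _ => hg.bound _) ht x
  exact (norm_add_le _ _).trans (by linarith)

theorem measurable_picardStep (hg : IsMonotoneReaction Λ L g) {U : E → ℝ} (hU : Measurable U)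
    {u : ℝ → E → ℝ} (hu : Measurable (Function.uncurry u)) :
    Measurable (Function.uncurry (picardStep Λ g U u)) :=
  ((by fun_prop : Measurable fun p : ℝ × E => Real.exp (-(Λ * p.1))).mul
    (measurable_gaussianAverage hU)).add (measurable_fst.mul
      (measurable_duhamelPotential (G := fun τ y => g (u τ y)) (hg.continuous.measurable.comp hu) Λ))

/-- Contraction by 1/2 in the weight e^{2Lt}: the integral over σ ∈ (0,t) of L·D e^{2L(t-σ)} is at
most (D/2) e^{2Lt}. The weight gives convergence for all times at once. -/
theorem norm_picardStep_sub_le (hg : IsMonotoneReaction Λ L g) (U : E → ℝ)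
    {u v : ℝ → E → ℝ} (hu : Measurable (Function.uncurry u)) (hv : Measurable (Function.uncurry v))
    {D : ℝ} (hD : ∀ t, 0 ≤ t → ∀ x, ‖u t x - v t x‖ ≤ D * Real.exp (2 * L * t)) {t : ℝ}
    (ht : 0 ≤ t) (x : E) :
    ‖picardStep Λ g U u t x - picardStep Λ g U v t x‖ ≤ D / 2 * Real.exp (2 * L * t) := by
  have hD0 : 0 ≤ D := by simpa using (norm_nonneg _).trans (hD 0 le_rfl 0)
  have hL := hg.pos
  have h1 : picardStep Λ g U u t x - picardStep Λ g U v t x =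
      t * ∫ p, Real.exp (-(Λ * t * p.1)) • (g (u (t * (1 - p.1)) (x + √(2 * (t * p.1)) • p.2)) -
        g (v (t * (1 - p.1)) (x + √(2 * (t * p.1)) • p.2))) ∂duhamelMeasure E := by
    simp only [smul_sub]
    rw [integral_sub]
    · simp only [picardStep, duhamelPotential]
      ring
    · exact integrable_duhamel hg.nonneg (G := fun τ y => g (u τ y))
        (hg.continuous.measurable.comp hu) (fun _ _ => hg.bound _) ht x
    · exact integrable_duhamel hg.nonneg (G := fun τ y => g (v τ y))
        (hg.continuous.measurable.comp hv) (fun _ _ => hg.bound _) ht x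
  have h2 : t * ∫ q in (0 : ℝ)..1, (2 * L) * Real.exp (-(2 * L * t * q)) ≤ 1 := by
    rw [mul_integral_exp_unit]
    linarith [Real.exp_pos (-(2 * L * t))]
  rw [h1, norm_mul, Real.norm_of_nonneg ht]
  calc t * ‖∫ p, Real.exp (-(Λ * t * p.1)) • (g (u (t * (1 - p.1)) (x + √(2 * (t * p.1)) • p.2)) -
        g (v (t * (1 - p.1)) (x + √(2 * (t * p.1)) • p.2))) ∂duhamelMeasure E‖
      ≤ t * ∫ p : ℝ × E, D / 2 * Real.exp (2 * L * t) * (2 * L * Real.exp (-(2 * L * t * p.1)))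
          ∂duhamelMeasure E := by
        refine mul_le_mul_of_nonneg_left (norm_integral_le_of_norm_le ?_ ?_) ht
        · refine Integrable.of_bound (C := D / 2 * Real.exp (2 * L * t) * (2 * L))
            (by fun_prop : Continuous _).aestronglyMeasurable ?_
          filter_upwards [ae_duhamelMeasure] with p hp
          have := exp_neg_mul_le_one (Λ := 2 * L) (by positivity) ht hp.1.le
          rw [Real.norm_of_nonneg (by positivity), ← mul_assoc]
          exact mul_le_of_le_one_right (by positivity) this
        · filter_upwards [ae_duhamelMeasure] with p hp
          have h3 : 0 ≤ t * (1 - p.1) := mul_nonneg ht (by linarith [hp.2])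
          rw [norm_smul, Real.norm_of_nonneg (Real.exp_pos _).le]
          calc _ ≤ 1 * (L * (D * Real.exp (2 * L * (t * (1 - p.1))))) := by
                refine mul_le_mul (exp_neg_mul_le_one hg.nonneg ht hp.1.le) ?_ (norm_nonneg _)
                  zero_le_one
                exact (hg.lipschitz _ _).trans (mul_le_mul_of_nonneg_left (hD _ h3 _) hL.le)
            _ = _ := by
                rw [show 2 * L * (t * (1 - p.1)) = 2 * L * t + -(2 * L * t * p.1) by ring,
                  Real.exp_add]
                ring
    _ = D / 2 * Real.exp (2 * L * t) *
          (t * ∫ q in (0 : ℝ)..1, (2 * L) * Real.exp (-(2 * L * t * q))) := by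
        rw [integral_const_mul, integral_fst_duhamelMeasure
          (fun q => 2 * L * Real.exp (-(2 * L * t * q)))]
        ring
    _ ≤ _ := mul_le_of_le_one_right (by positivity) h2

/-- The comparison principle reduces to positivity of the Gaussian measure and monotonicity of `g`;
this is the reason for adding Λu to both sides of the equation. -/
theorem picardStep_mono (hg : IsMonotoneReaction Λ L g) {U V : E → ℝ} (hU : Measurable U)
    (hV : Measurable V) (hU1 : ∀ y, ‖U y‖ ≤ 1) (hV1 : ∀ y, ‖V y‖ ≤ 1) (hUV : ∀ y, U y ≤ V y)
    {u v : ℝ → E → ℝ} (hu : Measurable (Function.uncurry u)) (hv : Measurable (Function.uncurry v))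
    (huv : ∀ t, 0 ≤ t → ∀ x, u t x ≤ v t x) {t : ℝ} (ht : 0 ≤ t) (x : E) :
    picardStep Λ g U u t x ≤ picardStep Λ g V v t x := by
  refine add_le_add (mul_le_mul_of_nonneg_left ?_ (Real.exp_pos _).le)
    (mul_le_mul_of_nonneg_left ?_ ht)
  · refine integral_mono ?_ ?_ fun z => hUV _
    · exact Integrable.of_bound (hU.comp (by fun_prop)).aestronglyMeasurable 1
        (Eventually.of_forall fun _ => hU1 _)
    · exact Integrable.of_bound (hV.comp (by fun_prop)).aestronglyMeasurable 1
        (Eventually.of_forall fun _ => hV1 _)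
  · refine integral_mono_ae (integrable_duhamel hg.nonneg (G := fun τ y => g (u τ y))
        (hg.continuous.measurable.comp hu) (fun _ _ => hg.bound _) ht x)
      (integrable_duhamel hg.nonneg (G := fun τ y => g (v τ y))
        (hg.continuous.measurable.comp hv) (fun _ _ => hg.bound _) ht x) ?_
    filter_upwards [ae_duhamelMeasure] with p hp
    refine smul_le_smul_of_nonneg_left (hg.monotone (huv _ ?_ _)) (Real.exp_pos _).le
    exact mul_nonneg ht (by linarith [hp.2])

/-- The Picard iterates, starting from `0`. -/
noncomputable def picardIterate (Λ : ℝ) (g : ℝ → ℝ) (U : E → ℝ) (k : ℕ) : ℝ → E → ℝ :=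
  (picardStep Λ g U)^[k] 0

theorem picardIterate_succ (U : E → ℝ) (k : ℕ) :
    picardIterate Λ g U (k + 1) = picardStep Λ g U (picardIterate Λ g U k) :=
  Function.iterate_succ_apply' _ _ _

theorem measurable_picardIterate (hg : IsMonotoneReaction Λ L g) {U : E → ℝ} (hU : Measurable U)
    (k : ℕ) : Measurable (Function.uncurry (picardIterate Λ g U k)) := by
  induction k with
  | zero => exact measurable_const
  | succ k ih =>
    rw [picardIterate_succ]
    exact measurable_picardStep hg hU ih

theorem norm_picardIterate_le (hg : IsMonotoneReaction Λ L g) {U : E → ℝ} (hU : ∀ y, ‖U y‖ ≤ 1)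
    (k : ℕ) {t : ℝ} (ht : 0 ≤ t) (x : E) : ‖picardIterate Λ g U k t x‖ ≤ 1 := by
  cases k with
  | zero => simp [picardIterate]
  | succ k =>
    rw [picardIterate_succ]
    exact norm_picardStep_le hg hU _ ht x

theorem dist_picardIterate_succ_le (hg : IsMonotoneReaction Λ L g) {U : E → ℝ} (hU : Measurable U)
    (hU1 : ∀ y, ‖U y‖ ≤ 1) (k : ℕ) {t : ℝ} (ht : 0 ≤ t) (x : E) :
    dist (picardIterate Λ g U k t x) (picardIterate Λ g U (k + 1) t x) ≤
      Real.exp (2 * L * t) / 2 ^ k := by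
  have key : ∀ t, 0 ≤ t → ∀ x, ‖picardIterate Λ g U (k + 1) t x - picardIterate Λ g U k t x‖ ≤
      1 / 2 ^ k * Real.exp (2 * L * t) := by
    induction k with
    | zero =>
      intro t ht x
      have h1 := norm_picardIterate_le hg hU1 1 ht x
      have h2 : 1 ≤ Real.exp (2 * L * t) := Real.one_le_exp (by have := hg.pos; positivity)
      simpa [picardIterate] using h1.trans h2
    | succ k ih =>
      intro t ht x
      rw [picardIterate_succ, picardIterate_succ U k]
      rw [picardIterate_succ] at ih
      have := norm_picardStep_sub_le hg U (picardIterate_succ (Λ := Λ) (g := g) U k ▸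
        measurable_picardIterate hg hU (k + 1)) (measurable_picardIterate hg hU k) ih ht x
      rwa [pow_succ, ← div_div]
  rw [dist_comm, dist_eq_norm]
  exact (key t ht x).trans_eq (by ring)

/-- The limit of the Picard iterates (frozen at negative times). -/
noncomputable def mildSolution (Λ : ℝ) (g : ℝ → ℝ) (U : E → ℝ) (t : ℝ) (x : E) : ℝ :=
  limUnder atTop fun k => picardIterate Λ g U k (max t 0) x

theorem tendsto_picardIterate (hg : IsMonotoneReaction Λ L g) {U : E → ℝ} (hU : Measurable U)
    (hU1 : ∀ y, ‖U y‖ ≤ 1) (t : ℝ) (x : E) :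
    Tendsto (fun k => picardIterate Λ g U k (max t 0) x) atTop (𝓝 (mildSolution Λ g U t x)) := by
  refine CauchySeq.tendsto_limUnder (cauchySeq_of_le_geometric_two
    (C := 2 * Real.exp (2 * L * max t 0)) fun k => ?_)
  have := dist_picardIterate_succ_le hg hU hU1 k (le_max_right t 0) x
  refine this.trans_eq (by ring)

theorem norm_mildSolution_sub_picardIterate_le (hg : IsMonotoneReaction Λ L g) {U : E → ℝ}
    (hU : Measurable U) (hU1 : ∀ y, ‖U y‖ ≤ 1) (k : ℕ) {t : ℝ} (ht : 0 ≤ t) (x : E) :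
    ‖mildSolution Λ g U t x - picardIterate Λ g U k t x‖ ≤
      2 / 2 ^ k * Real.exp (2 * L * t) := by
  have h := dist_le_of_le_geometric_two_of_tendsto
    (C := 2 * Real.exp (2 * L * t)) (f := fun k => picardIterate Λ g U k t x)
    (a := mildSolution Λ g U t x) (fun k => ?_) ?_ k
  · rw [← dist_eq_norm, dist_comm]
    exact h.trans_eq (by ring)
  · exact (dist_picardIterate_succ_le hg hU hU1 k ht x).trans_eq (by ring)
  · simpa [max_eq_left ht] using tendsto_picardIterate hg hU hU1 t x

theorem measurable_mildSolution (hg : IsMonotoneReaction Λ L g) {U : E → ℝ}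
    (hU : Measurable U) (hU1 : ∀ y, ‖U y‖ ≤ 1) :
    Measurable (Function.uncurry (mildSolution Λ g U)) := by
  refine measurable_of_tendsto_metrizable (f := fun k (p : ℝ × E) =>
    picardIterate Λ g U k (max p.1 0) p.2) (fun k => ?_)
    (tendsto_pi_nhds.2 fun p => tendsto_picardIterate hg hU hU1 p.1 p.2)
  exact (measurable_picardIterate hg hU k).comp (f := fun p : ℝ × E => (max p.1 0, p.2))
    (by fun_prop)

theorem norm_mildSolution_le (hg : IsMonotoneReaction Λ L g) {U : E → ℝ}
    (hU : Measurable U) (hU1 : ∀ y, ‖U y‖ ≤ 1) (t : ℝ) (x : E) : ‖mildSolution Λ g U t x‖ ≤ 1 :=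
  le_of_tendsto (tendsto_picardIterate hg hU hU1 t x).norm
    (Eventually.of_forall fun k => norm_picardIterate_le hg hU1 k (le_max_right t 0) x)

theorem mildSolution_eq_picardStep (hg : IsMonotoneReaction Λ L g) {U : E → ℝ}
    (hU : Measurable U) (hU1 : ∀ y, ‖U y‖ ≤ 1) {t : ℝ} (ht : 0 ≤ t) (x : E) :
    mildSolution Λ g U t x = picardStep Λ g U (mildSolution Λ g U) t x := by
  have h1 := (tendsto_picardIterate hg hU hU1 t x).comp (tendsto_add_atTop_nat 1)
  rw [max_eq_left ht] at h1
  refine tendsto_nhds_unique h1 ?_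
  rw [tendsto_iff_dist_tendsto_zero]
  refine squeeze_zero (g := fun k : ℕ => Real.exp (2 * L * t) * (1 / 2) ^ k)
    (fun _ => dist_nonneg) (fun k => ?_) ?_
  · have h2 := norm_picardStep_sub_le hg U (measurable_mildSolution hg hU hU1)
      (measurable_picardIterate hg hU k)
      (fun t ht x => norm_mildSolution_sub_picardIterate_le hg hU hU1 k ht x) ht x
    rw [Function.comp_apply, picardIterate_succ, dist_comm, dist_eq_norm]
    refine h2.trans_eq ?_
    rw [one_div, inv_pow]
    ring
  · simpa using (tendsto_pow_atTop_nhds_zero_of_lt_one (by norm_num : (0 : ℝ) ≤ 1 / 2)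
      (by norm_num)).const_mul (Real.exp (2 * L * t))

theorem mildSolution_zero (hg : IsMonotoneReaction Λ L g) {U : E → ℝ}
    (hU : Measurable U) (hU1 : ∀ y, ‖U y‖ ≤ 1) : mildSolution Λ g U 0 = U := by
  ext x
  rw [mildSolution_eq_picardStep hg hU hU1 le_rfl]
  simp [picardStep, gaussianAverage_zero]

theorem mildSolution_mono (hg : IsMonotoneReaction Λ L g) {U V : E → ℝ} (hU : Measurable U)
    (hV : Measurable V) (hU1 : ∀ y, ‖U y‖ ≤ 1) (hV1 : ∀ y, ‖V y‖ ≤ 1) (hUV : ∀ y, U y ≤ V y)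
    (t : ℝ) (x : E) : mildSolution Λ g U t x ≤ mildSolution Λ g V t x := by
  have key : ∀ k t, 0 ≤ t → ∀ x, picardIterate Λ g U k t x ≤ picardIterate Λ g V k t x := by
    intro k
    induction k with
    | zero => intro t _ x; exact le_rfl
    | succ k ih =>
      intro t ht x
      rw [picardIterate_succ, picardIterate_succ]
      exact picardStep_mono hg hU hV hU1 hV1 hUV (measurable_picardIterate hg hU k)
        (measurable_picardIterate hg hV k) ih ht x
  exact le_of_tendsto_of_tendsto' (tendsto_picardIterate hg hU hU1 t x)
    (tendsto_picardIterate hg hV hV1 t x) fun k => key k _ (le_max_right t 0) x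

/-- Each iterate is jointly continuous at positive times, and the geometric error is uniform in the
parameter and in x on bounded time intervals. -/
theorem continuousOn_mildSolution {S : Type*} [TopologicalSpace S] [FirstCountableTopology S]
    (hg : IsMonotoneReaction Λ L g) {U : S → E → ℝ} (hm : ∀ s, Measurable (U s))
    (hU1 : ∀ s y, ‖U s y‖ ≤ 1) (hU : ∀ s, ∀ᵐ y, ContinuousAt (fun s => U s y) s) :
    ContinuousOn (fun q : S × ℝ × E => mildSolution Λ g (U q.1) q.2.1 q.2.2)
      (univ ×ˢ Ioi 0 ×ˢ univ) := by
  have hop : IsOpen ((univ : Set S) ×ˢ Ioi (0 : ℝ) ×ˢ (univ : Set E)) :=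
    isOpen_univ.prod (isOpen_Ioi.prod isOpen_univ)
  have key : ∀ k, ContinuousOn (fun q : S × ℝ × E => picardIterate Λ g (U q.1) k q.2.1 q.2.2)
      (univ ×ˢ Ioi 0 ×ˢ univ) := by
    intro k
    induction k with
    | zero => exact continuousOn_const
    | succ k ih =>
      simp only [picardIterate_succ, picardStep]
      refine ContinuousOn.add (ContinuousOn.mul (by fun_prop)
        (continuousOn_gaussianAverage_family hm hU1 hU)) (ContinuousOn.mul (by fun_prop) ?_)
      exact continuousOn_duhamelPotential hg.nonneg
        (G := fun s τ y => g (picardIterate Λ g (U s) k τ y))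
        (fun s => hg.continuous.measurable.comp (measurable_picardIterate hg (hm s) k))
        (hg.continuous.comp_continuousOn ih) (fun _ _ _ => hg.bound _)
  intro q₀ hq₀
  refine ContinuousAt.continuousWithinAt ?_
  refine continuousAt_of_locally_uniform_approx_of_continuousAt fun V hV => ?_
  obtain ⟨ε, hε, hεV⟩ := Metric.mem_uniformity_dist.1 hV
  have hlim : Tendsto (fun k : ℕ => 2 / 2 ^ k * Real.exp (2 * L * (q₀.2.1 + 1))) atTop (𝓝 0) := by
    have h1 := ((tendsto_pow_atTop_nhds_zero_of_lt_one (by norm_num : (0 : ℝ) ≤ 1 / 2)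
      (by norm_num)).const_mul 2).mul_const (Real.exp (2 * L * (q₀.2.1 + 1)))
    simpa [div_eq_mul_inv] using h1
  obtain ⟨k, hk⟩ := (hlim.eventually_lt_const hε).exists
  have hL := hg.pos
  refine ⟨(univ : Set S) ×ˢ Ioo 0 (q₀.2.1 + 1) ×ˢ (univ : Set E),
    (isOpen_univ.prod (isOpen_Ioo.prod isOpen_univ)).mem_nhds
      ⟨mem_univ _, ⟨hq₀.2.1, lt_add_one _⟩, mem_univ _⟩, _,
    (key k).continuousAt (hop.mem_nhds hq₀), fun q hq => hεV ?_⟩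
  rw [dist_eq_norm]
  refine (norm_mildSolution_sub_picardIterate_le hg (hm _) (hU1 _) k hq.2.1.1.le _).trans_lt
    (lt_of_le_of_lt ?_ hk)
  refine mul_le_mul_of_nonneg_left (Real.exp_le_exp.2 ?_) (by positivity)
  exact mul_le_mul_of_nonneg_left hq.2.1.2.le (by positivity)

/-- The bound tends to 0 with t, uniformly in `U`, so weak continuity at t = 0 is inherited from the
heat flow although the datum itself may jump. -/
theorem norm_mildSolution_sub_gaussianAverage_le (hg : IsMonotoneReaction Λ L g) {U : E → ℝ}
    (hU : Measurable U) (hU1 : ∀ y, ‖U y‖ ≤ 1) {t : ℝ} (ht : 0 ≤ t) (x : E) :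
    ‖mildSolution Λ g U t x - gaussianAverage √(2 * t) U x‖ ≤ 2 * (1 - Real.exp (-(Λ * t))) := by
  have h2 := norm_mul_duhamelPotential_le (G := fun τ y => g (mildSolution Λ g U τ y))
    (fun _ _ => hg.bound _) ht x
  have h3 : Real.exp (-(Λ * t)) ≤ 1 := by simpa using exp_neg_mul_le_one hg.nonneg ht zero_le_one
  have h4 : ‖(Real.exp (-(Λ * t)) - 1) * gaussianAverage √(2 * t) U x‖ ≤
      1 - Real.exp (-(Λ * t)) := by
    rw [norm_mul, Real.norm_of_nonpos (by linarith), neg_sub]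
    exact mul_le_of_le_one_right (by linarith) (norm_gaussianAverage_le hU1 _ _)
  rw [mildSolution_eq_picardStep hg hU hU1 ht, picardStep]
  calc _ = ‖(Real.exp (-(Λ * t)) - 1) * gaussianAverage √(2 * t) U x +
        t * duhamelPotential Λ (fun τ y => g (mildSolution Λ g U τ y)) t x‖ := by ring_nf
    _ ≤ _ := (norm_add_le _ _).trans (by linarith)

theorem continuousOn_integral_mildSolution_mul {S : Type*} [TopologicalSpace S]
    [FirstCountableTopology S] (hg : IsMonotoneReaction Λ L g) {U : S → E → ℝ}
    (hm : ∀ s, Measurable (U s)) (hU1 : ∀ s y, ‖U s y‖ ≤ 1)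
    (hU : ∀ s, ∀ᵐ y, ContinuousAt (fun s => U s y) s) {φ : E → ℝ}
    (hφ : Continuous φ) (hφc : HasCompactSupport φ) :
    ContinuousOn (fun q : S × ℝ => ∫ x, mildSolution Λ g (U q.1) q.2 x * φ x)
      (univ ×ˢ Ici 0) := by
  have hop : IsOpen ((univ : Set S) ×ˢ Ioi (0 : ℝ) ×ˢ (univ : Set E)) :=
    isOpen_univ.prod (isOpen_Ioi.prod isOpen_univ)
  have hφi : Integrable φ := hφ.integrable_of_hasCompactSupport hφc
  have hmu : ∀ s t, Measurable (mildSolution Λ g (U s) t) := fun s t =>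
    (measurable_mildSolution hg (hm s) (hU1 s)).comp (f := fun x => (t, x)) (by fun_prop)
  have hiu : ∀ s t, Integrable fun x => mildSolution Λ g (U s) t x * φ x := fun s t =>
    hφi.bdd_mul (hmu s t).aestronglyMeasurable
      (Eventually.of_forall fun x => norm_mildSolution_le hg (hm s) (hU1 s) t x)
  intro q₀ hq₀
  rcases eq_or_lt_of_le (show (0 : ℝ) ≤ q₀.2 from hq₀.2) with h0 | h0
  · have h1 := (continuous_integral_gaussianAverage_mul hm hU1 hU hφ hφc).continuousWithinAt
      (s := univ ×ˢ Ici 0) (x := q₀)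
    have h2 : Tendsto (fun q : S × ℝ => ∫ x, (mildSolution Λ g (U q.1) q.2 x -
        gaussianAverage √(2 * q.2) (U q.1) x) * φ x) (𝓝[univ ×ˢ Ici 0] q₀) (𝓝 0) := by
      refine squeeze_zero_norm' (a := fun q : S × ℝ => 2 * (1 - Real.exp (-(Λ * q.2))) *
        ∫ x, ‖φ x‖) ?_ ?_
      · filter_upwards [self_mem_nhdsWithin] with q hq
        rw [← integral_const_mul]
        refine norm_integral_le_of_norm_le (hφi.norm.const_mul _) (Eventually.of_forall fun x => ?_)
        rw [norm_mul]
        exact mul_le_mul_of_nonneg_right (norm_mildSolution_sub_gaussianAverage_le hg (hm _)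
          (hU1 _) hq.2 x) (norm_nonneg _)
      · have h3 : Continuous fun q : S × ℝ => 2 * (1 - Real.exp (-(Λ * q.2))) * ∫ x, ‖φ x‖ := by
          fun_prop
        have h4 := h3.continuousWithinAt (s := univ ×ˢ Ici 0) (x := q₀)
        rw [ContinuousWithinAt] at h4
        simpa [← h0] using h4
    have h5 : ∀ q : S × ℝ, ∫ x, mildSolution Λ g (U q.1) q.2 x * φ x =
        (∫ x, gaussianAverage √(2 * q.2) (U q.1) x * φ x) + ∫ x, (mildSolution Λ g (U q.1) q.2 x -
        gaussianAverage √(2 * q.2) (U q.1) x) * φ x := by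
      intro q
      have h6 : Integrable fun x => gaussianAverage √(2 * q.2) (U q.1) x * φ x := by
        refine hφi.bdd_mul ?_ (Eventually.of_forall fun x => norm_gaussianAverage_le (hU1 q.1) _ x)
        exact ((measurable_gaussianAverage (hm q.1)).comp (f := fun x => (q.2, x))
          (by fun_prop)).aestronglyMeasurable
      simp only [sub_mul]
      rw [integral_sub (hiu _ _) h6]
      ring
    have h7 : ∫ x, (mildSolution Λ g (U q₀.1) q₀.2 x -
        gaussianAverage √(2 * q₀.2) (U q₀.1) x) * φ x = 0 := by
      simp [← h0, mildSolution_zero hg (hm _) (hU1 _), gaussianAverage_zero]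
    rw [ContinuousWithinAt]
    simp only [h5]
    rw [h7]
    exact Tendsto.add h1 h2
  · refine ContinuousAt.continuousWithinAt ?_
    refine continuousAt_of_dominated (bound := fun x => ‖φ x‖) ?_ ?_ hφi.norm ?_
    · exact Eventually.of_forall fun q => (hiu _ _).1
    · refine Eventually.of_forall fun q => Eventually.of_forall fun x => ?_
      rw [norm_mul]
      exact mul_le_of_le_one_left (norm_nonneg _) (norm_mildSolution_le hg (hm _) (hU1 _) _ _)
    · refine Eventually.of_forall fun x => ContinuousAt.mul ?_ continuousAt_const
      have h1 : ContinuousAt (fun q : S × ℝ × E => mildSolution Λ g (U q.1) q.2.1 q.2.2)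
        (q₀.1, q₀.2, x) := (continuousOn_mildSolution hg hm hU1 hU).continuousAt
          (hop.mem_nhds ⟨mem_univ _, h0, mem_univ _⟩)
      exact h1.comp (f := fun q : S × ℝ => (q.1, q.2, x)) (by fun_prop)

end Picard

/-! ### Interior regularity and the classical equation -/

section Regularity

open ProbabilityTheory Filter Topology Module

variable {E : Type*} [NormedAddCommGroup E] [InnerProductSpace ℝ E] [FiniteDimensional ℝ E]
  [MeasurableSpace E] [BorelSpace E] {Λ L : ℝ} {g : ℝ → ℝ}

theorem mul_duhamelPotential_eq_intervalIntegral (hΛ : 0 ≤ Λ) {G : ℝ → E → ℝ}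
    (hG : Measurable (Function.uncurry G)) {C : ℝ}
    (hC : ∀ t y, ‖G t y‖ ≤ C) {t : ℝ} (ht : 0 ≤ t) (x : E) :
    t * duhamelPotential Λ G t x =
      ∫ σ in 0..t, Real.exp (-(Λ * σ)) * gaussianAverage √(2 * σ) (G (t - σ)) x := by
  rw [duhamelPotential_eq_integral_gaussianAverage hΛ hG hC ht, ← integral_Ioc_eq_integral_Ioo,
    ← intervalIntegral.integral_of_le zero_le_one]
  have h := intervalIntegral.mul_integral_comp_mul_left (a := 0) (b := 1) (c := t)
    (f := fun σ => Real.exp (-(Λ * σ)) * gaussianAverage √(2 * σ) (G (t - σ)) x)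
  rw [mul_zero, mul_one] at h
  rw [← h]
  simp only [mul_sub, mul_one, mul_assoc]

theorem measurable_gaussianAverage_source {G : ℝ → E → ℝ} (hG : Measurable (Function.uncurry G))
    (t : ℝ) : Measurable fun p : ℝ × E => gaussianAverage √(2 * p.1) (G (t - p.1)) p.2 := by
  refine StronglyMeasurable.measurable (StronglyMeasurable.integral_prod_right
    (f := fun (p : ℝ × E) (z : E) => G (t - p.1) (p.2 + √(2 * p.1) • z)) ?_)
  exact (hG.comp (f := fun a : (ℝ × E) × E => (t - a.1.1, a.1.2 + √(2 * a.1.1) • a.2))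
    (by fun_prop)).stronglyMeasurable

/-- Split the integral over (0, t + h) at σ = h. The recent part is the potential of the shifted
source; on the older part the semigroup law extracts the heat flow for time h. -/
theorem duhamelPotential_restart (hΛ : 0 ≤ Λ) {G : ℝ → E → ℝ}
    (hG : Measurable (Function.uncurry G)) {C : ℝ}
    (hC : ∀ t y, ‖G t y‖ ≤ C) {t h : ℝ} (ht : 0 ≤ t) (hh : 0 ≤ h) (x : E) :
    (t + h) * duhamelPotential Λ G (t + h) x =
      Real.exp (-(Λ * h)) * gaussianAverage √(2 * h) (fun y => t * duhamelPotential Λ G t y) x +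
        h * duhamelPotential Λ (fun τ => G (t + τ)) h x := by
  have hG' : Measurable (Function.uncurry fun τ => G (t + τ)) :=
    hG.comp (f := fun p : ℝ × E => (t + p.1, p.2)) (by fun_prop)
  have hb : ∀ (T a b : ℝ) (y : E), IntervalIntegrable
      (fun σ => Real.exp (-(Λ * σ)) * gaussianAverage √(2 * σ) (G (T - σ)) y) volume a b := by
    intro T a b y
    rw [intervalIntegrable_iff]
    refine Integrable.mul_bdd (c := C) (by fun_prop : Continuous fun σ =>
      Real.exp (-(Λ * σ))).integrableOn_uIoc ?_ ?_
    · exact ((measurable_gaussianAverage_source hG T).comp (f := fun σ => (σ, y))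
        (by fun_prop)).aestronglyMeasurable
    · exact Eventually.of_forall fun σ => norm_gaussianAverage_le (hC _) _ _
  simp only [mul_duhamelPotential_eq_intervalIntegral hΛ hG hC ht]
  rw [mul_duhamelPotential_eq_intervalIntegral hΛ hG hC (add_nonneg ht hh),
    mul_duhamelPotential_eq_intervalIntegral hΛ hG' (fun _ _ => hC _ _) hh,
    ← intervalIntegral.integral_add_adjacent_intervals (hb _ 0 h x) (hb _ h (t + h) x), add_comm]
  congr 1
  · have h1 := intervalIntegral.integral_comp_add_right (a := 0) (b := t)
      (fun σ => Real.exp (-(Λ * σ)) * gaussianAverage √(2 * σ) (G (t + h - σ)) x) h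
    rw [zero_add] at h1
    rw [← h1, intervalIntegral.integral_of_le ht, gaussianAverage]
    simp only [intervalIntegral.integral_of_le ht]
    rw [integral_integral_swap, ← integral_const_mul]
    · refine setIntegral_congr_fun measurableSet_Ioc fun σ hσ => ?_
      have hGm : Measurable (G (t - σ)) := hG.comp (f := fun y => (t - σ, y)) (by fun_prop)
      have h2 := gaussianAverage_gaussianAverage hGm (hC _) √(2 * h) √(2 * σ) x
      rw [Real.sq_sqrt (by positivity), Real.sq_sqrt (by linarith [hσ.1])] at h2
      simp only [integral_const_mul]
      rw [show t + h - (σ + h) = t - σ by ring, show 2 * (σ + h) = 2 * h + 2 * σ by ring, ← h2,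
        show -(Λ * (σ + h)) = -(Λ * h) + -(Λ * σ) by ring, Real.exp_add, mul_assoc]
      rfl
    · refine Integrable.of_bound (C := C) ?_ ?_
      · refine AEStronglyMeasurable.mul (by fun_prop : Continuous _).aestronglyMeasurable ?_
        exact ((measurable_gaussianAverage_source hG t).comp
          (f := fun p : E × ℝ => (p.2, x + √(2 * h) • p.1)) (by fun_prop)).aestronglyMeasurable
      · have h3 : ∀ᵐ σ ∂(volume.restrict (Ioc 0 t)), σ ∈ Ioc 0 t := ae_restrict_mem measurableSet_Ioc
        filter_upwards [Measure.quasiMeasurePreserving_snd.ae h3] with p hp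
        simp only [Function.uncurry]
        rw [norm_mul, Real.norm_of_nonneg (Real.exp_pos _).le]
        refine (mul_le_of_le_one_left (norm_nonneg _) ?_).trans (norm_gaussianAverage_le (hC _) _ _)
        simpa using exp_neg_mul_le_one hΛ hp.1.le zero_le_one
  · refine intervalIntegral.integral_congr fun σ _ => ?_
    simp only [add_sub_assoc]

theorem duhamelPotential_congr {G G' : ℝ → E → ℝ} {t : ℝ} (ht : 0 ≤ t)
    (h : ∀ τ ∈ Icc 0 t, G τ = G' τ) (x : E) : duhamelPotential Λ G t x = duhamelPotential Λ G' t x := by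
  refine integral_congr_ae ?_
  filter_upwards [ae_duhamelMeasure] with p hp
  rw [h]
  exact ⟨mul_nonneg ht (by linarith [hp.2]), mul_le_of_le_one_right ht (by linarith [hp.1])⟩

/-- For t > 0 this replaces the possibly discontinuous datum by the continuous function u(t), to
which the smoothing lemmas apply. -/
theorem mildSolution_restart (hg : IsMonotoneReaction Λ L g) {U : E → ℝ}
    (hU : Measurable U) (hU1 : ∀ y, ‖U y‖ ≤ 1) {t h : ℝ} (ht : 0 ≤ t) (hh : 0 ≤ h) (x : E) :
    mildSolution Λ g U (t + h) x =
      Real.exp (-(Λ * h)) * gaussianAverage √(2 * h) (mildSolution Λ g U t) x +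
        h * duhamelPotential Λ (fun τ y => g (mildSolution Λ g U (t + τ) y)) h x := by
  have hm : Measurable (Function.uncurry fun τ y => g (mildSolution Λ g U τ y)) :=
    hg.continuous.measurable.comp (measurable_mildSolution hg hU hU1)
  have hb : ∀ τ (y : E), ‖g (mildSolution Λ g U τ y)‖ ≤ Λ := fun _ _ => hg.bound _
  rw [mildSolution_eq_picardStep hg hU hU1 (add_nonneg ht hh), picardStep,
    duhamelPotential_restart hg.nonneg hm hb ht hh, ← add_assoc]
  congr 1
  have h1 : mildSolution Λ g U t = fun y => Real.exp (-(Λ * t)) * gaussianAverage √(2 * t) U y +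
      t * duhamelPotential Λ (fun τ y => g (mildSolution Λ g U τ y)) t y :=
    funext fun y => mildSolution_eq_picardStep hg hU hU1 ht y
  have hsq := gaussianAverage_gaussianAverage hU hU1 √(2 * h) √(2 * t) x
  rw [Real.sq_sqrt (by positivity), Real.sq_sqrt (by positivity)] at hsq
  rw [show 2 * (t + h) = 2 * h + 2 * t by ring, ← hsq]
  conv_rhs => rw [h1]
  have hi1 : Integrable (fun z => Real.exp (-(Λ * t)) *
      gaussianAverage √(2 * t) U (x + √(2 * h) • z)) (stdGaussian E) := by
    refine (Integrable.of_bound (C := 1) ?_ (Eventually.of_forall fun z =>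
      norm_gaussianAverage_le hU1 _ _)).const_mul _
    exact ((measurable_gaussianAverage hU).comp (f := fun z => (t, x + √(2 * h) • z))
      (by fun_prop)).aestronglyMeasurable
  have hi2 : Integrable (fun z => t * duhamelPotential Λ (fun τ y => g (mildSolution Λ g U τ y)) t
      (x + √(2 * h) • z)) (stdGaussian E) := by
    refine (Integrable.of_bound (C := Λ) ?_ (Eventually.of_forall fun z =>
      norm_duhamelPotential_le hg.nonneg hb ht _)).const_mul _
    exact ((measurable_duhamelPotential hm Λ).comp (f := fun z => (t, x + √(2 * h) • z))
      (by fun_prop)).aestronglyMeasurable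
  have hsum : gaussianAverage √(2 * h) (fun y => Real.exp (-(Λ * t)) * gaussianAverage √(2 * t) U y +
      t * duhamelPotential Λ (fun τ y => g (mildSolution Λ g U τ y)) t y) x =
      Real.exp (-(Λ * t)) * gaussianAverage √(2 * h) (gaussianAverage √(2 * t) U) x +
      gaussianAverage √(2 * h) (fun y =>
        t * duhamelPotential Λ (fun τ y => g (mildSolution Λ g U τ y)) t y) x :=
    (integral_add hi1 hi2).trans (by rw [integral_const_mul]; rfl)
  rw [hsum, show -(Λ * (t + h)) = -(Λ * h) + -(Λ * t) by ring, Real.exp_add]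
  ring

/-- On every compact interval of positive times, `w` is given by Duhamel's formula with bounded
continuous data. -/
def HasDuhamelForm (Λ : ℝ) (w : ℝ → E → ℝ) : Prop :=
  ∀ t T : ℝ, 0 < t → 0 < T → ∃ (F : E → ℝ) (G : ℝ → E → ℝ) (C : ℝ), Continuous F ∧
    Continuous (Function.uncurry G) ∧ (∀ y, ‖F y‖ ≤ C) ∧ (∀ τ y, ‖G τ y‖ ≤ C) ∧
    ∀ h ∈ Icc 0 T, ∀ x, w (t + h) x =
      Real.exp (-(Λ * h)) * gaussianAverage √(2 * h) F x + h * duhamelPotential Λ G h x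

theorem HasDuhamelForm.exists_gradient (hΛ : 0 ≤ Λ) {w : ℝ → E → ℝ} (hw : HasDuhamelForm Λ w)
    {t T : ℝ} (ht : 0 < t) (hT : 0 < T) :
    (∀ h ∈ Ioc 0 T, ∀ x, DifferentiableAt ℝ (w (t + h)) x) ∧
    ContinuousOn (fun q : ℝ × E => fderiv ℝ (w q.1) q.2) (Ioo t (t + T) ×ˢ univ) ∧
    ∀ δ, 0 < δ → ∃ K, ∀ h ∈ Icc δ T, ∀ x, ‖fderiv ℝ (w (t + h)) x‖ ≤ K := by
  obtain ⟨F, G, C, hF, hG, hFC, hGC, heq⟩ := hw t T ht hT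
  obtain ⟨V, hV, hVc, hVb⟩ := exists_gradient_of_duhamel hΛ hF hG hFC hGC
  have h1 : ∀ h ∈ Ioc 0 T, ∀ x, HasFDerivAt (w (t + h)) (V h x) x := by
    intro h hh x
    have h2 : w (t + h) = fun x => Real.exp (-(Λ * h)) * gaussianAverage √(2 * h) F x +
        h * duhamelPotential Λ G h x := funext fun y => heq h ⟨hh.1.le, hh.2⟩ y
    rw [h2]
    exact hV h hh.1 x
  refine ⟨fun h hh x => (h1 h hh x).differentiableAt, ?_, fun δ hδ => ?_⟩
  · have h2 : ContinuousOn (fun q : ℝ × E => V (q.1 - t) q.2) (Ioo t (t + T) ×ˢ univ) :=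
      hVc.comp (f := fun q : ℝ × E => (q.1 - t, q.2)) (by fun_prop)
        fun q hq => ⟨sub_pos.2 hq.1.1, mem_univ _⟩
    refine h2.congr fun q hq => ?_
    have h3 := h1 (q.1 - t) ⟨sub_pos.2 hq.1.1, by linarith [hq.1.2]⟩ q.2
    rw [add_sub_cancel] at h3
    exact h3.fderiv
  · obtain ⟨K, hK⟩ := hVb δ T hδ
    refine ⟨K, fun h hh x => ?_⟩
    rw [(h1 h ⟨hδ.trans_le hh.1, hh.2⟩ x).fderiv]
    exact hK h hh x

/-- Restarting at half the time in question leaves a positive waiting time for smoothing; restarting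
at δ/2 makes the gradient bound uniform on [δ, T]. -/
theorem HasDuhamelForm.regularity (hΛ : 0 ≤ Λ) {w : ℝ → E → ℝ} (hw : HasDuhamelForm Λ w) :
    (∀ t, 0 < t → Differentiable ℝ (w t)) ∧
    ContinuousOn (fun q : ℝ × E => fderiv ℝ (w q.1) q.2) (Ioi 0 ×ˢ univ) ∧
    ∀ δ T, 0 < δ → ∃ K, ∀ t ∈ Icc δ T, ∀ x, ‖fderiv ℝ (w t) x‖ ≤ K := by
  refine ⟨fun t ht x => ?_, fun q hq => ?_, fun δ T hδ => ?_⟩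
  · have h := (hw.exists_gradient hΛ (half_pos ht) (half_pos ht)).1 (t / 2) ⟨half_pos ht, le_rfl⟩ x
    rwa [add_halves] at h
  · have h0 : 0 < q.1 := hq.1
    have h := (hw.exists_gradient hΛ (half_pos h0) h0).2.1
    refine (h.continuousAt ((isOpen_Ioo.prod isOpen_univ).mem_nhds ?_)).continuousWithinAt
    exact ⟨⟨half_lt_self h0, by linarith⟩, mem_univ _⟩
  · rcases lt_or_ge T δ with hT | hT
    · exact ⟨0, fun t ht => absurd (ht.1.trans ht.2) (not_le.2 hT)⟩
    · obtain ⟨K, hK⟩ := (hw.exists_gradient hΛ (half_pos hδ) (hδ.trans_le hT)).2.2 (δ / 2)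
        (half_pos hδ)
      refine ⟨K, fun t ht x => ?_⟩
      have := hK (t - δ / 2) ⟨by linarith [ht.1], by linarith [ht.2]⟩ x
      rwa [add_sub_cancel] at this

/-- The truncated nonlinearity `g` agrees on `[-1, 1]` with the `C¹` function `f`. -/
structure IsReactionExtension (g f f' : ℝ → ℝ) : Prop where
  eq : ∀ a, ‖a‖ ≤ 1 → g a = f a
  hasDerivAt : ∀ a, HasDerivAt f (f' a) a
  continuous : Continuous f'

variable {f f' : ℝ → ℝ} {U : E → ℝ}

theorem continuousOn_mildSolution_uncurry (hg : IsMonotoneReaction Λ L g) (hU : Measurable U)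
    (hU1 : ∀ y, ‖U y‖ ≤ 1) :
    ContinuousOn (fun q : ℝ × E => mildSolution Λ g U q.1 q.2) (Ioi 0 ×ˢ univ) :=
  (continuousOn_mildSolution (S := Unit) hg (U := fun _ => U) (fun _ => hU) (fun _ => hU1)
    fun _ => Eventually.of_forall fun _ => continuousAt_const).comp
    (f := fun q : ℝ × E => ((), q)) (by fun_prop) fun _ hq => ⟨mem_univ _, hq⟩

theorem continuous_mildSolution (hg : IsMonotoneReaction Λ L g) (hU : Measurable U)
    (hU1 : ∀ y, ‖U y‖ ≤ 1) {t : ℝ} (ht : 0 < t) : Continuous (mildSolution Λ g U t) :=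
  (continuousOn_mildSolution_uncurry hg hU hU1).comp_continuous (f := fun x => (t, x))
    (by fun_prop) fun _ => ⟨ht, mem_univ _⟩

/-- The clamping of `τ` to `[0, T]`, shifted by `t`. -/
noncomputable def clampedTime (t T τ : ℝ) : ℝ := t + max 0 (min τ T)

theorem continuous_clampedTime (t T : ℝ) : Continuous (clampedTime t T) := by
  unfold clampedTime; fun_prop

theorem clampedTime_mem {t T : ℝ} (hT : 0 ≤ T) (τ : ℝ) : clampedTime t T τ ∈ Icc t (t + T) :=
  ⟨le_add_of_nonneg_right (le_max_left _ _),
    add_le_add_right (max_le hT (min_le_right _ _)) _⟩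

theorem clampedTime_eq {t T τ : ℝ} (hτ : τ ∈ Icc 0 T) : clampedTime t T τ = t + τ := by
  rw [clampedTime, min_eq_left hτ.2, max_eq_right hτ.1]

theorem continuous_clampedTime_comp {H : Type*} [TopologicalSpace H] {w : ℝ → E → H}
    (hw : ContinuousOn (fun q : ℝ × E => w q.1 q.2) (Ioi 0 ×ˢ univ)) {t T : ℝ} (ht : 0 < t)
    (hT : 0 ≤ T) : Continuous fun q : ℝ × E => w (clampedTime t T q.1) q.2 := by
  have := continuous_clampedTime t T
  exact hw.comp_continuous (f := fun q : ℝ × E => (clampedTime t T q.1, q.2)) (by fun_prop)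
    fun q => ⟨ht.trans_le (clampedTime_mem hT q.1).1, mem_univ _⟩

/-- Two harmless replacements: `g` becomes the C¹ function `f`, since the solution stays in [-1,1],
and the source time is clamped, since only τ ∈ [0, h] matters. The source is then continuous for all
real τ, as the smoothing lemmas require. -/
theorem mildSolution_restart_clamped (hg : IsMonotoneReaction Λ L g)
    (hf : IsReactionExtension g f f') (hU : Measurable U) (hU1 : ∀ y, ‖U y‖ ≤ 1) {t T h : ℝ}
    (ht : 0 < t) (hh : h ∈ Icc 0 T) (x : E) :
    mildSolution Λ g U (t + h) x =
      Real.exp (-(Λ * h)) * gaussianAverage √(2 * h) (mildSolution Λ g U t) x +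
        h * duhamelPotential Λ (fun τ y => f (mildSolution Λ g U (clampedTime t T τ) y)) h x := by
  rw [mildSolution_restart hg hU hU1 ht.le hh.1]
  congr 2
  refine duhamelPotential_congr hh.1 (fun τ hτ => ?_) x
  ext y
  rw [clampedTime_eq ⟨hτ.1, hτ.2.trans hh.2⟩, hf.eq _ (norm_mildSolution_le hg hU hU1 _ _)]

theorem IsReactionExtension.norm_le (hg : IsMonotoneReaction Λ L g)
    (hf : IsReactionExtension g f f') (hU : Measurable U) (hU1 : ∀ y, ‖U y‖ ≤ 1) (t : ℝ) (x : E) :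
    ‖f (mildSolution Λ g U t x)‖ ≤ Λ := by
  rw [← hf.eq _ (norm_mildSolution_le hg hU hU1 _ _)]
  exact hg.bound _

theorem IsReactionExtension.continuous_source (hf : IsReactionExtension g f f') : Continuous f :=
  continuous_iff_continuousAt.2 fun a => (hf.hasDerivAt a).continuousAt

theorem hasDuhamelForm_mildSolution (hg : IsMonotoneReaction Λ L g)
    (hf : IsReactionExtension g f f') (hU : Measurable U) (hU1 : ∀ y, ‖U y‖ ≤ 1) :
    HasDuhamelForm Λ (mildSolution Λ g U) := by
  intro t T ht hT
  refine ⟨_, _, max 1 Λ, continuous_mildSolution hg hU hU1 ht, ?_, fun y => ?_, fun τ y => ?_,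
    fun h hh x => mildSolution_restart_clamped hg hf hU hU1 ht hh x⟩
  · exact hf.continuous_source.comp (continuous_clampedTime_comp
      (continuousOn_mildSolution_uncurry hg hU hU1) ht hT.le)
  · exact (norm_mildSolution_le hg hU hU1 _ _).trans (le_max_left _ _)
  · exact (hf.norm_le hg hU hU1 _ _).trans (le_max_right _ _)

/-- Differentiating the restarted formula on its data gives the linearised equation, with source
f'(u)∂ᵥu. Its data are bounded and continuous by the first round of smoothing, so a second round
applies. -/
theorem hasDuhamelForm_fderiv_mildSolution (hg : IsMonotoneReaction Λ L g)
    (hf : IsReactionExtension g f f') (hU : Measurable U) (hU1 : ∀ y, ‖U y‖ ≤ 1) (v : E) :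
    HasDuhamelForm Λ fun t x => fderiv ℝ (mildSolution Λ g U t) x v := by
  obtain ⟨hd, hc, hb⟩ := (hasDuhamelForm_mildSolution hg hf hU hU1).regularity hg.nonneg
  intro t T ht hT
  obtain ⟨K, hK⟩ := hb t (t + T) ht
  obtain ⟨K', hK'⟩ := isCompact_Icc.exists_bound_of_continuousOn (s := Icc (-1 : ℝ) 1)
    hf.continuous.continuousOn
  have hf'b : ∀ s (y : E), ‖f' (mildSolution Λ g U s y)‖ ≤ K' := fun s y =>
    hK' _ (abs_le.1 (norm_mildSolution_le hg hU hU1 s y))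
  have hK'0 : 0 ≤ K' := (norm_nonneg _).trans (hf'b 0 0)
  have hft : Continuous (fderiv ℝ (mildSolution Λ g U t)) :=
    hc.comp_continuous (f := fun x => (t, x)) (by fun_prop) fun _ => ⟨ht, mem_univ _⟩
  have hsol : Continuous fun q : ℝ × E => mildSolution Λ g U (clampedTime t T q.1) q.2 :=
    continuous_clampedTime_comp (continuousOn_mildSolution_uncurry hg hU hU1) ht hT.le
  set G' : ℝ → E → E →L[ℝ] ℝ := fun τ y => f' (mildSolution Λ g U (clampedTime t T τ) y) •
    fderiv ℝ (mildSolution Λ g U (clampedTime t T τ)) y with hG'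
  have hG'c : Continuous (Function.uncurry G') :=
    (hf.continuous.comp hsol).smul (continuous_clampedTime_comp
      (w := fun s => fderiv ℝ (mildSolution Λ g U s)) hc ht hT.le)
  have hG'b : ∀ τ y, ‖G' τ y‖ ≤ K' * K := by
    intro τ y
    rw [hG', norm_smul]
    exact mul_le_mul (hf'b _ _) (hK _ (clampedTime_mem hT.le τ) y) (norm_nonneg _) hK'0
  have hgrad : ∀ h ∈ Icc 0 T, ∀ x, HasFDerivAt (mildSolution Λ g U (t + h))
      (Real.exp (-(Λ * h)) • gaussianAverage √(2 * h) (fderiv ℝ (mildSolution Λ g U t)) x +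
        h • duhamelPotential Λ G' h x) x := by
    intro h hh x
    have heq : mildSolution Λ g U (t + h) = fun x =>
      Real.exp (-(Λ * h)) * gaussianAverage √(2 * h) (mildSolution Λ g U t) x +
        h * duhamelPotential Λ (fun τ y => f (mildSolution Λ g U (clampedTime t T τ) y)) h x :=
      funext fun y => mildSolution_restart_clamped hg hf hU hU1 ht hh y
    rw [heq]
    refine HasFDerivAt.fun_add (HasFDerivAt.const_mul ?_ _) (HasFDerivAt.const_mul ?_ _)
    · exact hasFDerivAt_gaussianAverage_of_hasFDerivAt (fun y => (hd t ht y).hasFDerivAt) hft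
        (norm_mildSolution_le hg hU hU1 t) (hK t ⟨le_rfl, by linarith⟩) _ x
    · refine hasFDerivAt_duhamelPotential_of_hasFDerivAt hg.nonneg
        (G := fun τ y => f (mildSolution Λ g U (clampedTime t T τ) y))
        (hf.continuous_source.comp hsol) hG'c (fun _ _ => hf.norm_le hg hU hU1 _ _) hG'b
        (fun τ y => ?_) hh.1 x
      exact (hf.hasDerivAt _).comp_hasFDerivAt y
        (hd _ (ht.trans_le (clampedTime_mem hT.le τ).1) y).hasFDerivAt
  refine ⟨fun y => fderiv ℝ (mildSolution Λ g U t) y v, fun τ y => G' τ y v,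
    max (K * ‖v‖) (K' * K * ‖v‖), by fun_prop, hG'c.clm_apply continuous_const, fun y => ?_,
    fun τ y => ?_, fun h hh x => ?_⟩
  · exact ((fderiv ℝ (mildSolution Λ g U t) y).le_of_opNorm_le
      (hK t ⟨le_rfl, by linarith⟩ y) v).trans (le_max_left _ _)
  · exact ((G' τ y).le_of_opNorm_le (hG'b τ y) v).trans (le_max_right _ _)
  · simp only
    rw [(hgrad h hh x).fderiv, add_apply, smul_apply, smul_apply, smul_eq_mul, smul_eq_mul,
      gaussianAverage, duhamelPotential, ContinuousLinearMap.integral_apply,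
      ContinuousLinearMap.integral_apply]
    · simp only [gaussianAverage, duhamelPotential, smul_apply]
    · refine Integrable.of_bound (C := K' * K) ?_ ?_
      · refine Continuous.aestronglyMeasurable (Continuous.fun_smul
          (f := fun p : ℝ × E => Real.exp (-(Λ * h * p.1))) (by fun_prop) ?_)
        exact hG'c.comp (f := fun p : ℝ × E => (h * (1 - p.1), x + √(2 * (h * p.1)) • p.2))
          (by fun_prop)
      · filter_upwards [ae_duhamelMeasure] with p hp
        rw [norm_smul, Real.norm_of_nonneg (Real.exp_pos _).le]
        exact (mul_le_of_le_one_left (norm_nonneg _)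
          (exp_neg_mul_le_one hg.nonneg hh.1 hp.1.le)).trans (hG'b _ _)
    · exact Integrable.of_bound (C := K) (by fun_prop : Continuous _).aestronglyMeasurable
        (Eventually.of_forall fun z => hK t ⟨le_rfl, by linarith⟩ _)

theorem laplacian_eq_sum_fderiv {ι : Type*} [Fintype ι] (b : OrthonormalBasis ι ℝ E) {F : E → ℝ}
    (hF : ContDiff ℝ 2 F) (x : E) :
    Δ F x = ∑ i, fderiv ℝ (fun y => fderiv ℝ F y (b i)) x (b i) := by
  rw [InnerProductSpace.laplacian_eq_iteratedFDeriv_orthonormalBasis F b]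
  refine Finset.sum_congr rfl fun i _ => ?_
  have h1 : DifferentiableAt ℝ (fderiv ℝ F) x :=
    ((hF.fderiv_right (m := 1) (by norm_num)).differentiable (by norm_num)) x
  rw [iteratedFDeriv_two_apply, fderiv_clm_apply h1 (differentiableAt_const _)]
  simp

theorem contDiff_mildSolution (hg : IsMonotoneReaction Λ L g)
    (hf : IsReactionExtension g f f') (hU : Measurable U) (hU1 : ∀ y, ‖U y‖ ≤ 1) {t : ℝ}
    (ht : 0 < t) : ContDiff ℝ 2 (mildSolution Λ g U t) := by
  have h1 := (hasDuhamelForm_mildSolution hg hf hU hU1).regularity hg.nonneg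
  rw [show (2 : WithTop ℕ∞) = 1 + 1 by norm_num, contDiff_succ_iff_fderiv_apply]
  refine ⟨h1.1 t ht, by simp, fun v => ?_⟩
  have h2 := (hasDuhamelForm_fderiv_mildSolution hg hf hU hU1 v).regularity hg.nonneg
  rw [contDiff_one_iff_fderiv]
  exact ⟨h2.1 t ht, h2.2.1.comp_continuous (f := fun x => (t, x)) (by fun_prop)
    fun _ => ⟨ht, mem_univ _⟩⟩

theorem continuousOn_laplacian_mildSolution (hg : IsMonotoneReaction Λ L g)
    (hf : IsReactionExtension g f f') (hU : Measurable U) (hU1 : ∀ y, ‖U y‖ ≤ 1) :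
    ContinuousOn (fun q : ℝ × E => Δ (mildSolution Λ g U q.1) q.2) (Ioi 0 ×ˢ univ) := by
  have h1 : ContinuousOn (fun q : ℝ × E => ∑ i, fderiv ℝ (fun y =>
      fderiv ℝ (mildSolution Λ g U q.1) y (stdOrthonormalBasis ℝ E i)) q.2
        (stdOrthonormalBasis ℝ E i)) (Ioi 0 ×ˢ univ) := by
    refine continuousOn_finsetSum _ fun i _ => ?_
    exact ((hasDuhamelForm_fderiv_mildSolution hg hf hU hU1
      (stdOrthonormalBasis ℝ E i)).regularity hg.nonneg).2.1.clm_apply continuousOn_const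
  exact h1.congr fun q hq =>
    laplacian_eq_sum_fderiv _ (contDiff_mildSolution hg hf hU hU1 hq.1) q.2

theorem hasDerivAt_id_mul_zero {k : ℝ → ℝ} (hk : ContinuousAt k 0) :
    HasDerivAt (fun h => h * k h) (k 0) 0 := by
  rw [hasDerivAt_iff_tendsto_slope]
  refine (hk.tendsto.mono_left nhdsWithin_le_nhds).congr' ?_
  filter_upwards [self_mem_nhdsWithin] with h hh
  rw [slope_def_field]
  have : h ≠ 0 := hh
  field_simp
  simp

/-- Differentiate the restarted formula at h = 0. It describes the solution for h ≥ 0 only, so just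
a right derivative results; continuity of the right-hand side later makes it two-sided. -/
theorem hasDerivWithinAt_mildSolution (hg : IsMonotoneReaction Λ L g)
    (hf : IsReactionExtension g f f') (hU : Measurable U) (hU1 : ∀ y, ‖U y‖ ≤ 1) {t : ℝ}
    (ht : 0 < t) (x : E) :
    HasDerivWithinAt (fun τ => mildSolution Λ g U τ x)
      (Δ (mildSolution Λ g U t) x - Λ * mildSolution Λ g U t x + f (mildSolution Λ g U t x))
      (Ici t) t := by
  set b := stdOrthonormalBasis ℝ E
  obtain ⟨hd, hc, hb⟩ := (hasDuhamelForm_mildSolution hg hf hU hU1).regularity hg.nonneg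
  have h2 := fun v => (hasDuhamelForm_fderiv_mildSolution hg hf hU hU1 v).regularity hg.nonneg
  obtain ⟨K, hK⟩ := hb t t ht
  choose K2 hK2 using fun i => (h2 (b i)).2.2 t t ht
  set F := mildSolution Λ g U t with hF
  set LF : E → ℝ := fun y => ∑ i, fderiv ℝ (fun y => fderiv ℝ F y (b i)) y (b i) with hLF
  have hc1 : Continuous (fderiv ℝ F) :=
    hc.comp_continuous (f := fun x => (t, x)) (by fun_prop) fun _ => ⟨ht, mem_univ _⟩
  have hc2 : ∀ i, Continuous (fderiv ℝ (fun y => fderiv ℝ F y (b i))) := fun i =>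
    (h2 (b i)).2.1.comp_continuous (f := fun x => (t, x)) (by fun_prop) fun _ => ⟨ht, mem_univ _⟩
  have hLc : Continuous LF := by
    refine continuous_finsetSum _ fun i _ => (hc2 i).clm_apply continuous_const
  have hL : ∀ y, ‖LF y‖ ≤ ∑ i, K2 i := fun y =>
    (norm_sum_le _ _).trans (Finset.sum_le_sum fun i _ => by
      simpa using (fderiv ℝ (fun y => fderiv ℝ F y (b i)) y).le_of_opNorm_le
        (hK2 i t ⟨le_rfl, le_rfl⟩ y) (b i))
  set G : ℝ → E → ℝ := fun τ y => f (mildSolution Λ g U (clampedTime t 1 τ) y) with hG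
  have hGc : Continuous (Function.uncurry G) := hf.continuous_source.comp
    (continuous_clampedTime_comp (continuousOn_mildSolution_uncurry hg hU hU1) ht zero_le_one)
  have hV : Continuous fun h : ℝ => duhamelPotential Λ G h x :=
    (continuous_duhamelPotential (Λ := Λ) hGc (fun _ _ => hf.norm_le hg hU hU1 _ _)).comp
      (by fun_prop : Continuous fun h : ℝ => (h, x))
  have hA : Continuous fun r : ℝ => gaussianAverage √(2 * r) LF x :=
    (continuous_gaussianAverage hLc hL).comp (by fun_prop : Continuous fun r : ℝ => (√(2 * r), x))
  have hG0 : duhamelPotential Λ G 0 x = f (F x) := by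
    simp [duhamelPotential, hG, clampedTime, hF]
  have hexp : HasDerivAt (fun h : ℝ => Real.exp (-(Λ * h))) (-Λ) 0 := by
    have : HasDerivAt (fun h : ℝ => -(Λ * h)) (-Λ) 0 := by
      simpa using ((hasDerivAt_id (0 : ℝ)).const_mul Λ).fun_neg
    simpa using this.exp
  -- The heat flow of `F` is written as `F` plus the time integral of the flow of its Laplacian,
  -- which is differentiable at h = 0 although √(2h) is not.
  have key : HasDerivAt (fun h : ℝ => Real.exp (-(Λ * h)) *
      (F x + ∫ r in 0..h, gaussianAverage √(2 * r) LF x) + h * duhamelPotential Λ G h x)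
      (LF x - Λ * F x + f (F x)) 0 := by
    have h3 := (hexp.fun_mul ((hA.integral_hasStrictDerivAt 0 0).hasDerivAt.const_add (F x))).fun_add
      (hasDerivAt_id_mul_zero hV.continuousAt)
    refine h3.congr_deriv ?_
    simp [hG0, gaussianAverage_zero]
    ring
  have h4 : HasDerivAt (fun τ : ℝ => τ - t) 1 t := (hasDerivAt_id t).sub_const t
  have h5 := (HasDerivAt.comp_of_eq (h := fun τ : ℝ => τ - t) t key h4 (sub_self t).symm).hasDerivWithinAt
    (s := Ici t)
  rw [mul_one] at h5
  rw [laplacian_eq_sum_fderiv b (contDiff_mildSolution hg hf hU hU1 ht) x]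
  refine h5.congr_of_eventuallyEq_of_mem ?_ self_mem_Ici
  have h6 : Iio (t + 1) ∈ 𝓝[Ici t] t := mem_nhdsWithin_of_mem_nhds (Iio_mem_nhds (lt_add_one t))
  filter_upwards [h6, self_mem_nhdsWithin] with τ hτ hτ'
  have h7 : τ - t ∈ Icc (0 : ℝ) 1 := ⟨sub_nonneg.2 hτ', by linarith [mem_Iio.1 hτ]⟩
  have h8 := mildSolution_restart_clamped hg hf hU hU1 ht h7 x
  rw [add_sub_cancel] at h8
  rw [Function.comp_apply, h8]
  have h9 := gaussianAverage_sub_eq_integral b (F := F) (fun y => (hd t ht y).hasFDerivAt)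
    (F'' := fun i y => fderiv ℝ (fun y => fderiv ℝ F y (b i)) y)
    (fun i y => ((h2 (b i)).1 t ht y).hasFDerivAt) hc1 hc2
    (norm_mildSolution_le hg hU hU1 t) (hK t ⟨le_rfl, le_rfl⟩) (C'' := ∑ i, |K2 i|)
    (fun i y => (hK2 i t ⟨le_rfl, le_rfl⟩ y).trans ((le_abs_self _).trans
      (Finset.single_le_sum (f := fun i => |K2 i|) (fun i _ => abs_nonneg _)
        (Finset.mem_univ i)))) h7.1 x
  rw [← h9, add_sub_cancel]

/-- A continuous function with a continuous right derivative is differentiable. -/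
theorem hasDerivAt_of_hasDerivWithinAt_Ici {w r : ℝ → ℝ} {a t : ℝ} (hat : a < t)
    (hw : ∀ s, a ≤ s → HasDerivWithinAt w (r s) (Ici s) s) (hc : ContinuousOn w (Ici a))
    (hr : ContinuousOn r (Ici a)) : HasDerivAt w (r t) t := by
  have h1 : ∀ s, a ≤ s → w s = w a + ∫ τ in a..s, r τ := by
    intro s hs
    rw [intervalIntegral.integral_eq_sub_of_hasDeriv_right_of_le hs (hc.mono Icc_subset_Ici_self)
      (fun q hq => (hw q hq.1.le).mono Ioi_subset_Ici_self)
      ((hr.mono (by rw [uIcc_of_le hs]; exact Icc_subset_Ici_self)).intervalIntegrable)]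
    ring
  have h2 : HasDerivAt (fun s => w a + ∫ τ in a..s, r τ) (r t) t := by
    refine (intervalIntegral.integral_hasDerivAt_right ?_ ?_ ?_).const_add _
    · exact (hr.mono (by rw [uIcc_of_le hat.le]; exact Icc_subset_Ici_self)).intervalIntegrable
    · exact (hr.mono Ioi_subset_Ici_self).stronglyMeasurableAtFilter isOpen_Ioi t hat
    · exact hr.continuousAt (Ici_mem_nhds hat)
  exact h2.congr_of_eventuallyEq (by
    filter_upwards [Ici_mem_nhds hat] with s hs using h1 s hs)

theorem hasDerivAt_mildSolution (hg : IsMonotoneReaction Λ L g)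
    (hf : IsReactionExtension g f f') (hU : Measurable U) (hU1 : ∀ y, ‖U y‖ ≤ 1) {t : ℝ}
    (ht : 0 < t) (x : E) :
    HasDerivAt (fun τ => mildSolution Λ g U τ x)
      (Δ (mildSolution Λ g U t) x - Λ * mildSolution Λ g U t x + f (mildSolution Λ g U t x)) t := by
  have h1 : ContinuousOn (fun τ => mildSolution Λ g U τ x) (Ici (t / 2)) :=
    (continuousOn_mildSolution_uncurry hg hU hU1).comp (f := fun τ => (τ, x)) (by fun_prop)
      fun τ hτ => ⟨(half_pos ht).trans_le hτ, mem_univ _⟩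
  have h2 : ContinuousOn (fun τ => Δ (mildSolution Λ g U τ) x) (Ici (t / 2)) :=
    (continuousOn_laplacian_mildSolution hg hf hU hU1).comp (f := fun τ => (τ, x)) (by fun_prop)
      fun τ hτ => ⟨(half_pos ht).trans_le hτ, mem_univ _⟩
  refine hasDerivAt_of_hasDerivWithinAt_Ici (r := fun τ => Δ (mildSolution Λ g U τ) x -
    Λ * mildSolution Λ g U τ x + f (mildSolution Λ g U τ x)) (half_lt_self ht)
    (fun s hs => hasDerivWithinAt_mildSolution hg hf hU hU1 ((half_pos ht).trans_le hs) x) h1 ?_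
  exact (h2.sub (continuousOn_const.mul h1)).add (hf.continuous_source.comp_continuousOn h1)

end Regularity

/-! ### From the classical to the distributional equation -/

section WeakForm

open Filter Topology Module

variable {E : Type*} [NormedAddCommGroup E] [InnerProductSpace ℝ E] [FiniteDimensional ℝ E]
  [MeasurableSpace E] [BorelSpace E]

theorem ContDiff.continuous_fderiv_fderiv_apply {X : Type*} [NormedAddCommGroup X] [NormedSpace ℝ X]
    {F : X → ℝ} (hF : ContDiff ℝ 2 F) (v w : X) :
    Continuous fun x => fderiv ℝ (fun y => fderiv ℝ F y v) x w := by
  have h1 : ContDiff ℝ 1 (fun y => fderiv ℝ F y v) :=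
    (hF.fderiv_right (m := 1) (by norm_num)).clm_apply contDiff_const
  exact (h1.continuous_fderiv (by norm_num)).clm_apply continuous_const

theorem ContDiff.differentiable_fderiv_apply {X : Type*} [NormedAddCommGroup X] [NormedSpace ℝ X]
    {F : X → ℝ} (hF : ContDiff ℝ 2 F) (v : X) : Differentiable ℝ fun y => fderiv ℝ F y v :=
  ((hF.fderiv_right (m := 1) (by norm_num)).clm_apply contDiff_const).differentiable (by norm_num)

/-- Green's second identity against a compactly supported function. -/
theorem integral_mul_laplacian_eq {F ψ : E → ℝ} (hF : ContDiff ℝ 2 F) (hψ : ContDiff ℝ 2 ψ)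
    (hc : HasCompactSupport ψ) : ∫ x, F x * Δ ψ x = ∫ x, Δ F x * ψ x := by
  set b := stdOrthonormalBasis ℝ E
  have hF1 : ∀ v, Continuous fun y => fderiv ℝ F y v := fun v =>
    (hF.continuous_fderiv (by norm_num)).clm_apply continuous_const
  have hψ1 : ∀ v, Continuous fun y => fderiv ℝ ψ y v := fun v =>
    (hψ.continuous_fderiv (by norm_num)).clm_apply continuous_const
  have hc1 : ∀ v, HasCompactSupport fun y => fderiv ℝ ψ y v := fun v => hc.fderiv_apply ℝ v
  have hc2 : ∀ v w, HasCompactSupport fun x => fderiv ℝ (fun y => fderiv ℝ ψ y v) x w := fun v w =>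
    (hc1 v).fderiv_apply ℝ w
  have hi1 : ∀ v w, Integrable fun x => F x * fderiv ℝ (fun y => fderiv ℝ ψ y v) x w := fun v w =>
    (hF.continuous.mul (hψ.continuous_fderiv_fderiv_apply v w)).integrable_of_hasCompactSupport
      (hc2 v w).mul_left
  have hi2 : ∀ v w, Integrable fun x => fderiv ℝ (fun y => fderiv ℝ F y v) x w * ψ x := fun v w =>
    ((hF.continuous_fderiv_fderiv_apply v w).mul hψ.continuous).integrable_of_hasCompactSupport
      hc.mul_left
  have hi3 : ∀ v, Integrable fun x => fderiv ℝ F x v * fderiv ℝ ψ x v := fun v =>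
    ((hF1 v).mul (hψ1 v)).integrable_of_hasCompactSupport (hc1 v).mul_left
  have hi4 : ∀ v, Integrable fun x => fderiv ℝ F x v * ψ x := fun v =>
    ((hF1 v).mul hψ.continuous).integrable_of_hasCompactSupport hc.mul_left
  have hi5 : ∀ v, Integrable fun x => F x * fderiv ℝ ψ x v := fun v =>
    (hF.continuous.mul (hψ1 v)).integrable_of_hasCompactSupport (hc1 v).mul_left
  simp only [laplacian_eq_sum_fderiv b hF, laplacian_eq_sum_fderiv b hψ, Finset.mul_sum,
    Finset.sum_mul]
  rw [integral_finsetSum _ fun i _ => hi1 _ _, integral_finsetSum _ fun i _ => hi2 _ _]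
  refine Finset.sum_congr rfl fun i _ => ?_
  rw [integral_mul_fderiv_eq_neg_fderiv_mul_of_integrable (hi3 _) (hi1 _ _) (hi5 _)
    (fun x _ => hF.differentiable (by norm_num) x) (fun x _ => hψ.differentiable_fderiv_apply _ x),
    integral_mul_fderiv_eq_neg_fderiv_mul_of_integrable (hi2 _ _) (hi3 _) (hi4 _)
    (fun x _ => hF.differentiable_fderiv_apply _ x) (fun x _ => hψ.differentiable (by norm_num) x),
    neg_neg]

/-- Meant for products with a test function: the solution is continuous only for positive times, but
the support of the test function lies there. -/
theorem continuous_of_continuousOn_of_eq_zero {X : Type*} [TopologicalSpace X] {V K : Set X}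
    (hV : IsOpen V) (hK : IsClosed K) (hKV : K ⊆ V) {F : X → ℝ} (hF : ContinuousOn F V)
    (h0 : ∀ x ∉ K, F x = 0) : Continuous F := by
  refine continuous_iff_continuousAt.2 fun x => ?_
  by_cases hx : x ∈ K
  · exact hF.continuousAt (hV.mem_nhds (hKV hx))
  · exact (continuousAt_const (y := (0 : ℝ))).congr (by
      filter_upwards [hK.isOpen_compl.mem_nhds hx] with y hy using (h0 y hy).symm)

theorem fderiv_slice {φ : ℝ × E → ℝ} (hφ : Differentiable ℝ φ) (t : ℝ) (x v : E) :
    fderiv ℝ (fun y => φ (t, y)) x v = fderiv ℝ φ (t, x) (0, v) := by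
  have h1 : HasFDerivAt (fun y : E => (t, y)) (ContinuousLinearMap.inr ℝ ℝ E) x :=
    hasFDerivAt_prodMk_right t x
  have h2 := (hφ (t, x)).hasFDerivAt.comp x h1
  have h3 : fderiv ℝ (fun y => φ (t, y)) x = _ := h2.fderiv
  rw [h3]
  simp

theorem hasDerivAt_slice {φ : ℝ × E → ℝ} (hφ : Differentiable ℝ φ) (t : ℝ) (x : E) :
    HasDerivAt (fun τ => φ (τ, x)) (fderiv ℝ φ (t, x) (1, 0)) t := by
  have h1 : HasFDerivAt (fun τ : ℝ => (τ, x)) (ContinuousLinearMap.inl ℝ ℝ E) t :=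
    hasFDerivAt_prodMk_left t x
  have h2 := ((hφ (t, x)).hasFDerivAt.comp t h1).hasDerivAt
  simpa [Function.comp_def] using h2

theorem laplacian_slice {φ : ℝ × E → ℝ} (hφ : ContDiff ℝ ∞ φ) (t : ℝ) (x : E) :
    Δ (fun y => φ (t, y)) x = ∑ i, fderiv ℝ (fun q => fderiv ℝ φ q (0, stdOrthonormalBasis ℝ E i))
      (t, x) (0, stdOrthonormalBasis ℝ E i) := by
  have h2 : ContDiff ℝ 2 φ := contDiff_infty.1 hφ 2
  rw [laplacian_eq_sum_fderiv (stdOrthonormalBasis ℝ E)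
    (F := fun y => φ (t, y)) (h2.comp (by fun_prop))]
  refine Finset.sum_congr rfl fun i _ => ?_
  simp only [fderiv_slice (h2.differentiable (by norm_num))]
  exact fderiv_slice (φ := fun q => fderiv ℝ φ q (0, stdOrthonormalBasis ℝ E i))
    (h2.differentiable_fderiv_apply _) t x _

/-- The integrand is the sum of ∂ₜ(wφ) and wΔφ - φΔw. The first integrates to zero along each time
line, the second in each time slice by Green's identity. -/
theorem integral_weak_form_eq_zero {w R : ℝ → E → ℝ} (hw : ∀ t, 0 < t → ContDiff ℝ 2 (w t))
    (hwc : ContinuousOn (fun q : ℝ × E => w q.1 q.2) (Ioi 0 ×ˢ univ))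
    (hΔ : ContinuousOn (fun q : ℝ × E => Δ (w q.1) q.2) (Ioi 0 ×ˢ univ))
    (hR : ContinuousOn (fun q : ℝ × E => R q.1 q.2) (Ioi 0 ×ˢ univ))
    (hd : ∀ t, 0 < t → ∀ x, HasDerivAt (fun τ => w τ x) (Δ (w t) x - R t x) t)
    {φ : ℝ × E → ℝ} (hφ : ContDiff ℝ ∞ φ) (hφc : HasCompactSupport φ)
    (hφs : tsupport φ ⊆ Ioi 0 ×ˢ univ) :
    ∫ p in Ioi (0 : ℝ) ×ˢ (univ : Set E),
      (w p.1 p.2 * (deriv (fun t => φ (t, p.2)) p.1 + Δ (fun x => φ (p.1, x)) p.2)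
        - R p.1 p.2 * φ p) = 0 := by
  have hV : IsOpen (Ioi (0 : ℝ) ×ˢ (univ : Set E)) := isOpen_Ioi.prod isOpen_univ
  have h2 : ContDiff ℝ 2 φ := contDiff_infty.1 hφ 2
  have hdiff : Differentiable ℝ φ := h2.differentiable (by norm_num)
  set b := stdOrthonormalBasis ℝ E
  set φt : ℝ × E → ℝ := fun p => fderiv ℝ φ p (1, 0) with hφt
  set φL : ℝ × E → ℝ := fun p => ∑ i, fderiv ℝ (fun q => fderiv ℝ φ q (0, b i)) p (0, b i) with hφL
  have hφtc : Continuous φt := (h2.continuous_fderiv (by norm_num)).clm_apply continuous_const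
  have hφLc : Continuous φL :=
    continuous_finsetSum _ fun i _ => h2.continuous_fderiv_fderiv_apply _ _
  have hφ0 : ∀ p ∉ tsupport φ, φ p = 0 := fun p hp => image_eq_zero_of_notMem_tsupport hp
  have hφ10 : ∀ v : ℝ × E, ∀ p ∉ tsupport φ, fderiv ℝ φ p v = 0 := fun v p hp =>
    image_eq_zero_of_notMem_tsupport (f := fun q => fderiv ℝ φ q v)
      fun h => hp (tsupport_fderiv_apply_subset ℝ v h)
  have hφt0 : ∀ p ∉ tsupport φ, φt p = 0 := fun p hp => hφ10 _ p hp
  have hφL0 : ∀ p ∉ tsupport φ, φL p = 0 := fun p hp =>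
    Finset.sum_eq_zero fun i _ => image_eq_zero_of_notMem_tsupport
      (f := fun p => fderiv ℝ (fun q => fderiv ℝ φ q (0, b i)) p (0, b i)) fun h =>
      hp (tsupport_fderiv_apply_subset ℝ _ (tsupport_fderiv_apply_subset ℝ _ h))
  set A : ℝ × E → ℝ := fun p => (Δ (w p.1) p.2 - R p.1 p.2) * φ p + w p.1 p.2 * φt p with hA
  set B : ℝ × E → ℝ := fun p => w p.1 p.2 * φL p - Δ (w p.1) p.2 * φ p with hB
  have hA0 : ∀ p ∉ tsupport φ, A p = 0 := fun p hp => by simp [hA, hφ0 p hp, hφt0 p hp]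
  have hB0 : ∀ p ∉ tsupport φ, B p = 0 := fun p hp => by simp [hB, hφ0 p hp, hφL0 p hp]
  have hAc : Continuous A := continuous_of_continuousOn_of_eq_zero hV (isClosed_tsupport φ) hφs
    (((hΔ.sub hR).mul hφ.continuous.continuousOn).add (hwc.mul hφtc.continuousOn)) hA0
  have hBc : Continuous B := continuous_of_continuousOn_of_eq_zero hV (isClosed_tsupport φ) hφs
    ((hwc.mul hφLc.continuousOn).sub (hΔ.mul hφ.continuous.continuousOn)) hB0
  have hAi : Integrable A := hAc.integrable_of_hasCompactSupport (HasCompactSupport.intro hφc hA0)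
  have hBi : Integrable B := hBc.integrable_of_hasCompactSupport (HasCompactSupport.intro hφc hB0)
  have hslice : ∀ {D : ℝ × E → ℝ} (x : E), (∀ p ∉ tsupport φ, D p = 0) →
      HasCompactSupport fun t => D (t, x) := fun x h =>
    HasCompactSupport.intro (hφc.image continuous_fst) fun t ht =>
      h _ fun hm => ht ⟨_, hm, rfl⟩
  have hslice' : ∀ {D : ℝ × E → ℝ} (t : ℝ), (∀ p ∉ tsupport φ, D p = 0) →
      HasCompactSupport fun x => D (t, x) := fun t h =>
    HasCompactSupport.intro (hφc.image continuous_snd) fun x hx =>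
      h _ fun hm => hx ⟨_, hm, rfl⟩
  have hIA : ∫ p, A p = 0 := by
    rw [Measure.volume_eq_prod] at hAi ⊢
    rw [integral_prod_symm _ hAi]
    refine integral_eq_zero_of_ae (Eventually.of_forall fun x => ?_)
    have hP0 : ∀ p ∉ tsupport φ, w p.1 p.2 * φ p = 0 := fun p hp => by simp [hφ0 p hp]
    have hPc : Continuous fun p : ℝ × E => w p.1 p.2 * φ p :=
      continuous_of_continuousOn_of_eq_zero hV (isClosed_tsupport φ) hφs
        (hwc.mul hφ.continuous.continuousOn) hP0
    refine integral_eq_zero_of_hasDerivAt_of_integrable (f := fun t => w t x * φ (t, x))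
      (fun t => ?_) ?_ ?_
    · by_cases hp : (t, x) ∈ tsupport φ
      · exact (hd t (hφs hp).1 x).fun_mul (hasDerivAt_slice hdiff t x)
      · rw [hA0 _ hp]
        have h3 : (tsupport φ)ᶜ ∈ 𝓝 (t, x) := (isClosed_tsupport φ).isOpen_compl.mem_nhds hp
        have h4 : Tendsto (fun τ : ℝ => (τ, x)) (𝓝 t) (𝓝 (t, x)) :=
          (by fun_prop : Continuous fun τ : ℝ => (τ, x)).tendsto t
        refine (hasDerivAt_const t (0 : ℝ)).congr_of_eventuallyEq ?_
        filter_upwards [h4 h3] with τ hτ using hP0 (τ, x) hτ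
    · exact (hAc.comp (by fun_prop : Continuous fun t : ℝ => (t, x))).integrable_of_hasCompactSupport
        (hslice x hA0)
    · exact (hPc.comp (by fun_prop : Continuous fun t : ℝ => (t, x))).integrable_of_hasCompactSupport
        (hslice x hP0)
  have hIB : ∫ p, B p = 0 := by
    rw [Measure.volume_eq_prod] at hBi ⊢
    rw [integral_prod _ hBi]
    refine integral_eq_zero_of_ae (Eventually.of_forall fun t => ?_)
    rcases le_or_gt t 0 with ht | ht
    · refine integral_eq_zero_of_ae (Eventually.of_forall fun x => hB0 _ fun h => ?_)
      exact absurd (hφs h).1 (not_lt.2 ht)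
    · have hψ : ContDiff ℝ 2 fun x => φ (t, x) := h2.comp (by fun_prop)
      have hg := integral_mul_laplacian_eq (hw t ht) hψ (hslice' t hφ0)
      simp only [laplacian_slice hφ] at hg
      have hi1 : Integrable fun x => w t x * φL (t, x) :=
        ((hw t ht).continuous.mul (hφLc.comp (by fun_prop))).integrable_of_hasCompactSupport
          (hslice' t (D := fun p => w p.1 p.2 * φL p) fun p hp => by simp [hφL0 p hp])
      have hi2 : Integrable fun x => Δ (w t) x * φ (t, x) := by
        refine Continuous.integrable_of_hasCompactSupport (Continuous.mul ?_ hψ.continuous)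
          (hslice' t (D := fun p => Δ (w p.1) p.2 * φ p) fun p hp => by simp [hφ0 p hp])
        exact hΔ.comp_continuous (f := fun x => (t, x)) (by fun_prop) fun _ => ⟨ht, mem_univ _⟩
      simp only [hB]
      rw [integral_sub hi1 hi2]
      exact sub_eq_zero.2 hg
  have heq : ∀ p : ℝ × E, w p.1 p.2 * (deriv (fun t => φ (t, p.2)) p.1 +
      Δ (fun x => φ (p.1, x)) p.2) - R p.1 p.2 * φ p = A p + B p := by
    intro p
    rw [laplacian_slice hφ, (hasDerivAt_slice hdiff p.1 p.2).deriv]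
    simp only [hA, hB, hφt, hφL, Prod.mk.eta]
    ring
  simp only [heq]
  rw [setIntegral_eq_integral_of_forall_compl_eq_zero fun p hp => by
    rw [hA0 p fun h => hp (hφs h), hB0 p fun h => hp (hφs h), add_zero],
    integral_add hAi hBi, hIA, hIB, add_zero]

end WeakForm

/-! ### Maximum principle for mollified weak solutions -/

section Uniqueness

open Filter Topology Module

variable {E : Type*} [NormedAddCommGroup E] [InnerProductSpace ℝ E] [FiniteDimensional ℝ E]
  [MeasurableSpace E] [BorelSpace E]

/-- Testing against normalised bumps, which have L¹ norm 1, bounds the mollifications of `w` by C,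
and these converge to `w` almost everywhere. -/
theorem ae_norm_le_of_integral_mul_le {w : E → ℝ} (hw : LocallyIntegrable w) {C : ℝ}
    (h : ∀ ψ : E → ℝ, ContDiff ℝ ∞ ψ → HasCompactSupport ψ → ‖∫ x, w x * ψ x‖ ≤ C * ∫ x, ‖ψ x‖) :
    ∀ᵐ x, ‖w x‖ ≤ C := by
  set B : ℕ → ContDiffBump (0 : E) := fun k =>
    ⟨1 / (k + 1), 2 * (1 / (k + 1)), by positivity, by
      have : (0 : ℝ) < 1 / (k + 1) := by positivity
      linarith⟩
  have hB : Tendsto (fun k => (B k).rOut) atTop (𝓝 0) := by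
    have h1 := (tendsto_one_div_add_atTop_nhds_zero_nat (𝕜 := ℝ)).const_mul 2
    rwa [mul_zero] at h1
  filter_upwards [ContDiffBump.ae_convolution_tendsto_right_of_locallyIntegrable (μ := volume)
    (K := 2) hB (Eventually.of_forall fun k => le_rfl) hw] with x hx
  refine le_of_tendsto hx.norm (Eventually.of_forall fun k => ?_)
  rw [convolution_eq_swap]
  have h1 := h (fun y => (B k).normed volume (x - y))
    ((B k).contDiff_normed.comp (by fun_prop))
    ((B k).hasCompactSupport_normed.comp_homeomorph (Homeomorph.subLeft x))
  have h2 : ∫ y, ‖(B k).normed volume (x - y)‖ = 1 := by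
    rw [integral_sub_left_eq_self (fun y => ‖(B k).normed volume y‖)]
    simp only [Real.norm_of_nonneg ((B k).nonneg_normed _)]
    exact (B k).integral_normed
  rw [h2, mul_one] at h1
  simpa [mul_comm] using h1

theorem exists_hasFDerivAt_integral_mul_comp_sub {w g : E → ℝ} (hw : LocallyIntegrable w)
    (hg : ContDiff ℝ 1 g) (hc : HasCompactSupport g) :
    ∃ F' : E → E →L[ℝ] ℝ, Continuous F' ∧
      (∀ x, HasFDerivAt (fun x => ∫ y, w y * g (x - y)) (F' x) x) ∧
      ∀ x v, F' x v = ∫ y, w y * fderiv ℝ g (x - y) v := by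
  set Lm := ContinuousLinearMap.mul ℝ ℝ
  refine ⟨convolution w (fderiv ℝ g) (Lm.precompR E) volume, ?_, fun x => ?_, fun x v => ?_⟩
  · exact (hc.fderiv ℝ).continuous_convolution_right _ hw (hg.continuous_fderiv (by norm_num))
  · exact hc.hasFDerivAt_convolution_right Lm hw hg x
  · exact convolution_precompR_apply Lm hw (hc.fderiv ℝ) (hg.continuous_fderiv (by norm_num)) x v

theorem norm_integral_mul_comp_sub_le {w g : E → ℝ} {C : ℝ} (hw : ∀ᵐ y, ‖w y‖ ≤ C)
    (hg : Continuous g) (hc : HasCompactSupport g) (x : E) :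
    ‖∫ y, w y * g (x - y)‖ ≤ C * ∫ y, ‖g y‖ := by
  have hi : Integrable (fun y => ‖g (x - y)‖) :=
    (hg.integrable_of_hasCompactSupport hc).norm.comp_sub_left x
  rw [← integral_sub_left_eq_self (fun y => ‖g y‖) volume x, ← integral_const_mul]
  refine norm_integral_le_of_norm_le (hi.const_mul C) ?_
  filter_upwards [hw] with y hy
  rw [norm_mul]
  exact mul_le_mul_of_nonneg_right hy (norm_nonneg _)

theorem contDiff_fderiv_apply_const {g : E → ℝ} (hg : ContDiff ℝ ∞ g) (v : E) :
    ContDiff ℝ ∞ fun y => fderiv ℝ g y v :=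
  (hg.fderiv_right (m := ∞) (by simp)).clm_apply contDiff_const

theorem contDiff_laplacian {g : E → ℝ} (hg : ContDiff ℝ ∞ g) : ContDiff ℝ ∞ (Δ g) := by
  rw [show Δ g = _ from funext fun x =>
    laplacian_eq_sum_fderiv (stdOrthonormalBasis ℝ E) (contDiff_infty.1 hg 2) x]
  exact ContDiff.sum fun i _ => contDiff_fderiv_apply_const (contDiff_fderiv_apply_const hg _) _

theorem HasCompactSupport.laplacian {g : E → ℝ} (hg : ContDiff ℝ ∞ g) (hc : HasCompactSupport g) :
    HasCompactSupport (Δ g) := by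
  refine HasCompactSupport.intro hc fun x hx => ?_
  rw [laplacian_eq_sum_fderiv (stdOrthonormalBasis ℝ E) (contDiff_infty.1 hg 2) x]
  exact Finset.sum_eq_zero fun i _ => image_eq_zero_of_notMem_tsupport
    (f := fun x => fderiv ℝ (fun y => fderiv ℝ g y (stdOrthonormalBasis ℝ E i)) x
      (stdOrthonormalBasis ℝ E i)) fun h =>
    hx (tsupport_fderiv_apply_subset ℝ _ (tsupport_fderiv_apply_subset ℝ _ h))

theorem laplacian_comp_const_sub {g : E → ℝ} (hg : ContDiff ℝ ∞ g) (x y : E) :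
    Δ (fun y => g (x - y)) y = Δ g (x - y) := by
  have h1 : ∀ {G : E → ℝ}, Differentiable ℝ G → ∀ y v,
      fderiv ℝ (fun y => G (x - y)) y v = -fderiv ℝ G (x - y) v := by
    intro G hG y v
    have h2 : HasFDerivAt (fun y : E => x - y) (-ContinuousLinearMap.id ℝ E) y := by
      simpa using (hasFDerivAt_id y).const_sub x
    have h3 : fderiv ℝ (fun y => G (x - y)) y = _ := ((hG (x - y)).hasFDerivAt.comp y h2).fderiv
    rw [h3]
    simp
  have h2 := contDiff_infty.1 hg 2
  rw [laplacian_eq_sum_fderiv (stdOrthonormalBasis ℝ E) (F := fun y => g (x - y))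
    (h2.comp (by fun_prop)), laplacian_eq_sum_fderiv (stdOrthonormalBasis ℝ E) h2]
  refine Finset.sum_congr rfl fun i _ => ?_
  simp only [h1 (h2.differentiable (by norm_num)), fderiv_fun_neg]
  rw [neg_apply, h1 (h2.differentiable_fderiv_apply _), neg_neg]

/-- All derivatives of the convolution fall on `g`, so the heat-flow expansion applies to a merely
bounded `w`, with an error depending only on its bound C and on `g`. -/
theorem gaussianAverage_convolution {w g : E → ℝ} (hwl : LocallyIntegrable w) {C : ℝ}
    (hw : ∀ᵐ y, ‖w y‖ ≤ C) (hg : ContDiff ℝ ∞ g) (hc : HasCompactSupport g) {h : ℝ} (hh : 0 ≤ h)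
    (x : E) :
    (gaussianAverage √(2 * h) (fun x => ∫ y, w y * g (x - y)) x - ∫ y, w y * g (x - y) =
      ∫ r in 0..h, gaussianAverage √(2 * r) (fun x => ∫ y, w y * Δ g (x - y)) x) ∧
    ‖gaussianAverage √(2 * h) (fun x => ∫ y, w y * g (x - y)) x - ∫ y, w y * g (x - y)‖ ≤
      (C * ∫ y, ‖Δ g y‖) * h := by
  set b := stdOrthonormalBasis ℝ E
  have hC0 : 0 ≤ C := by
    obtain ⟨y, hy⟩ := hw.exists
    exact (norm_nonneg _).trans hy
  have hgi : ∀ i, ContDiff ℝ ∞ fun y => fderiv ℝ g y (b i) := fun i =>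
    contDiff_fderiv_apply_const hg _
  have hci : ∀ i, HasCompactSupport fun y => fderiv ℝ g y (b i) := fun i => hc.fderiv_apply ℝ _
  have key : ∀ {G : E → ℝ}, ContDiff ℝ ∞ G → HasCompactSupport G → ∀ F' : E → E →L[ℝ] ℝ,
      (∀ x v, F' x v = ∫ y, w y * fderiv ℝ G (x - y) v) →
      ∀ x, ‖F' x‖ ≤ C * ∫ y, ‖fderiv ℝ G y‖ := by
    intro G hG hGc F' hF' x
    have hi : Integrable fun y => ‖fderiv ℝ G y‖ :=
      ((hG.continuous_fderiv (by simp)).integrable_of_hasCompactSupport (hGc.fderiv ℝ)).norm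
    refine ContinuousLinearMap.opNorm_le_bound _
      (mul_nonneg hC0 (integral_nonneg fun _ => norm_nonneg _)) fun v => ?_
    rw [hF']
    refine (norm_integral_mul_comp_sub_le hw ((hG.continuous_fderiv (by simp)).clm_apply
      continuous_const) (hGc.fderiv_apply ℝ v) x).trans ?_
    rw [mul_assoc, ← integral_mul_const]
    refine mul_le_mul_of_nonneg_left (integral_mono_of_nonneg (Eventually.of_forall fun _ =>
      norm_nonneg _) (hi.mul_const _) (Eventually.of_forall fun y => ?_)) hC0
    exact (fderiv ℝ G y).le_opNorm v
  obtain ⟨F', hF'c, hF', hF'v⟩ := exists_hasFDerivAt_integral_mul_comp_sub hwl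
    (contDiff_infty.1 hg 1) hc
  choose F'' hF''c hF'' hF''v using fun i => exists_hasFDerivAt_integral_mul_comp_sub hwl
    (contDiff_infty.1 (hgi i) 1) (hci i)
  have hFb := norm_integral_mul_comp_sub_le hw hg.continuous hc
  have hF'b := key hg hc F' hF'v
  have hF''b : ∀ i x, ‖F'' i x‖ ≤ ∑ j, |C * ∫ y, ‖fderiv ℝ (fun y => fderiv ℝ g y (b j)) y‖| :=
    fun i x => (key (hgi i) (hci i) (F'' i) (hF''v i) x).trans ((le_abs_self _).trans
      (Finset.single_le_sum (f := fun j => |C * ∫ y, ‖fderiv ℝ (fun y => fderiv ℝ g y (b j)) y‖|)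
        (fun j _ => abs_nonneg _) (Finset.mem_univ i)))
  have hF2 : ∀ i x, HasFDerivAt (fun y => F' y (b i)) (F'' i x) x := by
    intro i x
    simp only [hF'v]
    exact hF'' i x
  have hsum : ∀ x, ∑ i, F'' i x (b i) = ∫ y, w y * Δ g (x - y) := by
    intro x
    simp only [hF''v, laplacian_eq_sum_fderiv b (contDiff_infty.1 hg 2), Finset.mul_sum]
    rw [integral_finsetSum]
    intro i _
    have h1 : Continuous fun y => fderiv ℝ (fun y => fderiv ℝ g y (b i)) y (b i) :=
      (contDiff_fderiv_apply_const (hgi i) _).continuous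
    have h2 : Integrable fun y => fderiv ℝ (fun y => fderiv ℝ g y (b i)) (x - y) (b i) :=
      (h1.integrable_of_hasCompactSupport ((hci i).fderiv_apply ℝ _)).comp_sub_left x
    exact h2.bdd_mul hwl.aestronglyMeasurable hw
  have hK : ∀ x, ‖∑ i, F'' i x (b i)‖ ≤ C * ∫ y, ‖Δ g y‖ := fun x => by
    rw [hsum]
    exact norm_integral_mul_comp_sub_le hw (contDiff_laplacian hg).continuous
      (HasCompactSupport.laplacian hg hc) x
  have h1 := gaussianAverage_sub_eq_integral b hF' hF2 hF'c hF''c hFb hF'b hF''b hh x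
  have h2 := norm_gaussianAverage_sub_le b hF' hF2 hF'c hF''c hFb hF'b hF''b hK hh x
  simp only [hsum] at h1
  exact ⟨h1, h2⟩

/-- The form of `∂ₜ w = Δ w + k` on `[0, T]` obtained by testing in the space variable only. -/
structure IsSlicedSolution (T : ℝ) (w k : ℝ → E → ℝ) : Prop where
  locallyIntegrable : ∀ t ∈ Icc 0 T, LocallyIntegrable (w t)
  source : ∀ t ∈ Icc 0 T, LocallyIntegrable (k t)
  intervalIntegrable : ∀ ψ : E → ℝ, ContDiff ℝ ∞ ψ → HasCompactSupport ψ →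
    IntervalIntegrable (fun t => ∫ x, (w t x * Δ ψ x + k t x * ψ x)) volume 0 T
  eq : ∀ ψ : E → ℝ, ContDiff ℝ ∞ ψ → HasCompactSupport ψ → ∀ s ∈ Icc 0 T, ∀ t ∈ Icc s T,
    (∫ x, w t x * ψ x) - ∫ x, w s x * ψ x = ∫ r in s..t, ∫ x, (w r x * Δ ψ x + k r x * ψ x)

/-- Testing with y ↦ g(x - y) shows that the mollified solution satisfies the mollified equation at
every point x. -/
theorem IsSlicedSolution.convolution_sub_eq {T : ℝ} {w k : ℝ → E → ℝ} (h : IsSlicedSolution T w k)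
    {C : ℝ} (hw : ∀ t ∈ Icc 0 T, ∀ᵐ y, ‖w t y‖ ≤ C) {K : ℝ}
    (hk : ∀ t ∈ Icc 0 T, ∀ᵐ y, ‖k t y‖ ≤ K) {g : E → ℝ} (hg : ContDiff ℝ ∞ g)
    (hc : HasCompactSupport g) {s t : ℝ} (hs : s ∈ Icc 0 T) (ht : t ∈ Icc s T) (x : E) :
    IntervalIntegrable (fun r => (∫ y, w r y * Δ g (x - y)) + ∫ y, k r y * g (x - y)) volume s t ∧
    (∫ y, w t y * g (x - y)) - ∫ y, w s y * g (x - y) =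
      ∫ r in s..t, ((∫ y, w r y * Δ g (x - y)) + ∫ y, k r y * g (x - y)) := by
  have hψ : ContDiff ℝ ∞ fun y => g (x - y) := hg.comp (by fun_prop)
  have hψc : HasCompactSupport fun y => g (x - y) := hc.comp_homeomorph (Homeomorph.subLeft x)
  have hsplit : ∀ r ∈ Icc 0 T, ∫ y, (w r y * Δ (fun y => g (x - y)) y + k r y * g (x - y)) =
      (∫ y, w r y * Δ g (x - y)) + ∫ y, k r y * g (x - y) := by
    intro r hr
    simp only [laplacian_comp_const_sub hg]
    have h1 : Integrable fun y => Δ g (x - y) := ((contDiff_laplacian hg).continuous.integrable_of_hasCompactSupport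
      (HasCompactSupport.laplacian hg hc)).comp_sub_left x
    have h2 : Integrable fun y => g (x - y) :=
      (hg.continuous.integrable_of_hasCompactSupport hc).comp_sub_left x
    exact integral_add (h1.bdd_mul (h.locallyIntegrable r hr).aestronglyMeasurable (hw r hr))
      (h2.bdd_mul (h.source r hr).aestronglyMeasurable (hk r hr))
  have hsub : uIcc s t ⊆ Icc 0 T := by
    rw [uIcc_of_le ht.1]
    exact Icc_subset_Icc hs.1 ht.2
  have hi : IntervalIntegrable (fun r => ∫ y, (w r y * Δ (fun y => g (x - y)) y +
      k r y * g (x - y))) volume s t := (h.intervalIntegrable _ hψ hψc).mono_set (by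
    rw [uIcc_of_le (hs.1.trans hs.2)]
    exact hsub)
  refine ⟨hi.congr fun r hr => hsplit r (hsub (uIoc_subset_uIcc hr)), ?_⟩
  rw [h.eq _ hψ hψc s hs t ht]
  exact intervalIntegral.integral_congr fun r hr => hsplit r (hsub hr)

theorem IsSlicedSolution.norm_convolution_sub_le {T : ℝ} {w k : ℝ → E → ℝ}
    (h : IsSlicedSolution T w k)
    {C : ℝ} (hw : ∀ t ∈ Icc 0 T, ∀ᵐ y, ‖w t y‖ ≤ C) {K : ℝ}
    (hk : ∀ t ∈ Icc 0 T, ∀ᵐ y, ‖k t y‖ ≤ K) {g : E → ℝ} (hg : ContDiff ℝ ∞ g)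
    (hc : HasCompactSupport g) {s t : ℝ} (hs : s ∈ Icc 0 T) (ht : t ∈ Icc s T) (x : E) :
    ‖(∫ y, w t y * g (x - y)) - ∫ y, w s y * g (x - y)‖ ≤
      (C * (∫ y, ‖Δ g y‖) + K * ∫ y, ‖g y‖) * (t - s) := by
  rw [(h.convolution_sub_eq hw hk hg hc hs ht x).2]
  have := intervalIntegral.norm_integral_le_of_norm_le_const (a := s) (b := t)
    (f := fun r => (∫ y, w r y * Δ g (x - y)) + ∫ y, k r y * g (x - y))
    (C := C * (∫ y, ‖Δ g y‖) + K * ∫ y, ‖g y‖) fun r hr => ?_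
  · rwa [abs_of_nonneg (sub_nonneg.2 ht.1)] at this
  · rw [uIoc_of_le ht.1] at hr
    have hr' : r ∈ Icc 0 T := ⟨hs.1.trans hr.1.le, hr.2.trans ht.2⟩
    exact (norm_add_le _ _).trans (add_le_add
      (norm_integral_mul_comp_sub_le (hw r hr') (contDiff_laplacian hg).continuous
        (HasCompactSupport.laplacian hg hc) x)
      (norm_integral_mul_comp_sub_le (hk r hr') hg.continuous hc x))

/-- One time step of the maximum principle for mollified solutions. -/
theorem IsSlicedSolution.exists_step {T : ℝ} {w k : ℝ → E → ℝ} (h : IsSlicedSolution T w k)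
    {C : ℝ} (hw : ∀ t ∈ Icc 0 T, ∀ᵐ y, ‖w t y‖ ≤ C) {K : ℝ}
    (hk : ∀ t ∈ Icc 0 T, ∀ᵐ y, ‖k t y‖ ≤ K) {β : ℝ → ℝ} (hβ : Continuous β)
    (hkβ : ∀ t ∈ Icc 0 T, ∀ᵐ y, ‖k t y‖ ≤ β t) {g : E → ℝ} (hg : ContDiff ℝ ∞ g)
    (hc : HasCompactSupport g) :
    ∃ M, ∀ s ∈ Icc 0 T, ∀ t ∈ Icc s T, ∀ B, (∀ x, ‖∫ y, w s y * g (x - y)‖ ≤ B) →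
      ∀ x, ‖∫ y, w t y * g (x - y)‖ ≤ B + (∫ y, ‖g y‖) * (∫ r in s..t, β r) + M * (t - s) ^ 2 := by
  set N := ∫ y, ‖g y‖
  -- `M₁` is the Lipschitz constant in time of the convolution of `w` with Δg; `M₂` bounds the rate
  -- at which the heat flow moves that convolution away from its value at time s.
  set M₁ := C * (∫ y, ‖Δ (Δ g) y‖) + K * ∫ y, ‖Δ g y‖
  set M₂ := C * ∫ y, ‖Δ (Δ g) y‖
  have hΔ := contDiff_laplacian hg
  have hΔc := HasCompactSupport.laplacian hg hc
  refine ⟨M₁ + M₂, fun s hs t ht B hB x => ?_⟩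
  have hst : 0 ≤ t - s := sub_nonneg.2 ht.1
  obtain ⟨hi, heq⟩ := h.convolution_sub_eq hw hk hg hc hs ht x
  set D : ℝ → E → ℝ := fun r x => ∫ y, w r y * Δ g (x - y) with hD
  have h1 : ‖(∫ r in s..t, (D r x + ∫ y, k r y * g (x - y))) - ∫ _r in s..t, D s x‖ ≤
      ∫ r in s..t, (M₁ * (t - s) + N * β r) := by
    rw [← intervalIntegral.integral_sub hi intervalIntegrable_const]
    refine intervalIntegral.norm_integral_le_of_norm_le ht.1 ?_
      ((by fun_prop : Continuous fun r => M₁ * (t - s) + N * β r).intervalIntegrable _ _)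
    refine Eventually.of_forall fun r hr => ?_
    have hr' : r ∈ Icc 0 T := ⟨hs.1.trans hr.1.le, hr.2.trans ht.2⟩
    have h2 := h.norm_convolution_sub_le hw hk hΔ hΔc hs ⟨hr.1.le, hr'.2⟩ x
    have h3 := norm_integral_mul_comp_sub_le (hkβ r hr') hg.continuous hc x
    have hM₁ : 0 ≤ M₁ := by
      have h4 := fun r hr => (hw r hr).exists
      have h5 := fun r hr => (hk r hr).exists
      obtain ⟨y, hy⟩ := h4 r hr'
      obtain ⟨y', hy'⟩ := h5 r hr'
      exact add_nonneg (mul_nonneg ((norm_nonneg _).trans hy) (integral_nonneg fun _ => norm_nonneg _))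
        (mul_nonneg ((norm_nonneg _).trans hy') (integral_nonneg fun _ => norm_nonneg _))
    calc ‖(D r x + ∫ y, k r y * g (x - y)) - D s x‖
        = ‖(D r x - D s x) + ∫ y, k r y * g (x - y)‖ := by congr 1; ring
      _ ≤ M₁ * (r - s) + β r * N := (norm_add_le _ _).trans (add_le_add h2 h3)
      _ ≤ M₁ * (t - s) + N * β r := by
        rw [mul_comm (β r)]
        have := mul_le_mul_of_nonneg_left (sub_le_sub_right hr.2 s) hM₁
        linarith
  obtain ⟨h2, -⟩ := gaussianAverage_convolution (h.locallyIntegrable s hs) (hw s hs) hg hc hst x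
  have hDc : Continuous (D s) := by
    refine continuous_iff_continuousAt.2 fun x => ?_
    obtain ⟨F', -, hF', -⟩ := exists_hasFDerivAt_integral_mul_comp_sub (h.locallyIntegrable s hs)
      (contDiff_infty.1 hΔ 1) hΔc
    exact (hF' x).continuousAt
  have hDb := norm_integral_mul_comp_sub_le (hw s hs) hΔ.continuous hΔc
  have hAi : IntervalIntegrable (fun r => gaussianAverage √(2 * r) (D s) x) volume 0 (t - s) :=
    ((continuous_gaussianAverage hDc hDb).comp (by fun_prop :
      Continuous fun r : ℝ => (√(2 * r), x))).intervalIntegrable _ _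
  have h3 : ‖(∫ r in 0..(t - s), gaussianAverage √(2 * r) (D s) x) - ∫ _r in 0..(t - s), D s x‖ ≤
      M₂ * (t - s) * (t - s) := by
    rw [← intervalIntegral.integral_sub hAi intervalIntegrable_const]
    have := intervalIntegral.norm_integral_le_of_norm_le_const (a := 0) (b := t - s)
      (f := fun r => gaussianAverage √(2 * r) (D s) x - D s x) (C := M₂ * (t - s)) fun r hr => ?_
    · rwa [sub_zero, abs_of_nonneg hst] at this
    · rw [uIoc_of_le hst] at hr
      have h4 := (gaussianAverage_convolution (h.locallyIntegrable s hs) (hw s hs) hΔ hΔc hr.1.le x).2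
      refine h4.trans (mul_le_mul_of_nonneg_left hr.2 ?_)
      obtain ⟨y, hy⟩ := (hw s hs).exists
      exact mul_nonneg ((norm_nonneg _).trans hy) (integral_nonneg fun _ => norm_nonneg _)
  have h4 : ‖gaussianAverage √(2 * (t - s)) (fun x => ∫ y, w s y * g (x - y)) x‖ ≤ B :=
    norm_gaussianAverage_le hB _ x
  have h5 : ∫ r in s..t, (M₁ * (t - s) + N * β r) = M₁ * (t - s) ^ 2 + N * ∫ r in s..t, β r := by
    rw [intervalIntegral.integral_add intervalIntegrable_const
      ((hβ.intervalIntegrable _ _).const_mul N), intervalIntegral.integral_const,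
      intervalIntegral.integral_const_mul, smul_eq_mul]
    ring
  rw [h5] at h1
  rw [intervalIntegral.integral_const, smul_eq_mul] at h1 h3
  rw [sub_zero] at h3
  -- The mollified solution at time t is compared with the heat flow, for time t - s, of its value
  -- at time s. Their Laplacian terms both equal (t - s) D s x up to O((t - s)²), and the heat flow
  -- does not increase the supremum.
  calc ‖∫ y, w t y * g (x - y)‖
      = ‖gaussianAverage √(2 * (t - s)) (fun x => ∫ y, w s y * g (x - y)) x +
          ((∫ r in s..t, (D r x + ∫ y, k r y * g (x - y))) - (t - s) * D s x) -
          ((∫ r in 0..(t - s), gaussianAverage √(2 * r) (D s) x) - (t - s) * D s x)‖ := by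
        rw [← heq, ← h2]
        congr 1
        ring
    _ ≤ B + (M₁ * (t - s) ^ 2 + N * ∫ r in s..t, β r) + M₂ * (t - s) * (t - s) :=
        (norm_sub_le _ _).trans (add_le_add ((norm_add_le _ _).trans (add_le_add h4 h1)) h3)
    _ = _ := by ring

/-- Cut [0, t] into n + 1 equal steps: the source bounds add up to the integral of β, while the
quadratic errors add up to M t²/(n + 1) and vanish as n → ∞. The constant M depends on the mollifier
but disappears before the mollification is removed. -/
theorem IsSlicedSolution.ae_norm_le_integral {T : ℝ} {w k : ℝ → E → ℝ} (h : IsSlicedSolution T w k)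
    (h0 : w 0 =ᵐ[volume] 0) {C : ℝ} (hw : ∀ t ∈ Icc 0 T, ∀ᵐ y, ‖w t y‖ ≤ C) {K : ℝ}
    (hk : ∀ t ∈ Icc 0 T, ∀ᵐ y, ‖k t y‖ ≤ K) {β : ℝ → ℝ} (hβ : Continuous β)
    (hkβ : ∀ t ∈ Icc 0 T, ∀ᵐ y, ‖k t y‖ ≤ β t) {t : ℝ} (ht : t ∈ Icc 0 T) :
    ∀ᵐ y, ‖w t y‖ ≤ ∫ r in 0..t, β r := by
  have hconv : ∀ g : E → ℝ, ContDiff ℝ ∞ g → HasCompactSupport g → ∀ x,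
      ‖∫ y, w t y * g (x - y)‖ ≤ (∫ y, ‖g y‖) * ∫ r in 0..t, β r := by
    intro g hg hc x
    obtain ⟨M, hM⟩ := h.exists_step hw hk hβ hkβ hg hc
    set N := ∫ y, ‖g y‖
    have hn : ∀ n : ℕ, ‖∫ y, w t y * g (x - y)‖ ≤
        N * (∫ r in 0..t, β r) + M * t ^ 2 * (1 / ((n : ℝ) + 1)) := by
      intro n
      set δ := t / ((n : ℝ) + 1) with hδ
      have hn0 : (0 : ℝ) < (n : ℝ) + 1 := by positivity
      have hδ0 : 0 ≤ δ := div_nonneg ht.1 hn0.le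
      have hδt : ((n : ℝ) + 1) * δ = t := by
        rw [hδ]; field_simp
      have key : ∀ j : ℕ, j ≤ n + 1 → ∀ x, ‖∫ y, w (j * δ) y * g (x - y)‖ ≤
          N * (∫ r in 0..(j * δ), β r) + j * (M * δ ^ 2) := by
        intro j
        induction j with
        | zero =>
          intro _ x
          have h1 : ∫ y, w 0 y * g (x - y) = 0 := by
            refine integral_eq_zero_of_ae ?_
            filter_upwards [h0] with y hy
            simp [hy]
          simp [h1]
        | succ j ih =>
          intro hj x
          have hj' : ((j : ℝ) + 1) ≤ (n : ℝ) + 1 := by exact_mod_cast hj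
          have hle : ((j : ℝ) + 1) * δ ≤ T :=
            (mul_le_mul_of_nonneg_right hj' hδ0).trans (hδt.le.trans ht.2)
          have h1 := hM (j * δ) ⟨by positivity, by nlinarith⟩ (((j + 1 : ℕ) : ℝ) * δ)
            ⟨by push_cast; nlinarith, by push_cast; exact hle⟩ _ (ih (by omega)) x
          refine h1.trans_eq ?_
          rw [← intervalIntegral.integral_add_adjacent_intervals (hβ.intervalIntegrable 0 (j * δ))
            (hβ.intervalIntegrable (j * δ) (((j + 1 : ℕ) : ℝ) * δ))]
          push_cast
          ring
      have h1 := key (n + 1) le_rfl x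
      push_cast at h1
      rw [hδt] at h1
      refine h1.trans_eq ?_
      rw [hδ]
      field_simp
    have hlim : Tendsto (fun n : ℕ => N * (∫ r in 0..t, β r) + M * t ^ 2 * (1 / ((n : ℝ) + 1))) atTop
        (𝓝 (N * ∫ r in 0..t, β r)) := by
      simpa using (tendsto_one_div_add_atTop_nhds_zero_nat (𝕜 := ℝ)).const_mul (M * t ^ 2)
        |>.const_add (N * ∫ r in 0..t, β r)
    exact ge_of_tendsto' hlim hn
  refine ae_norm_le_of_integral_mul_le (h.locallyIntegrable t ht) fun ψ hψ hψc => ?_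
  -- The reflected test function, evaluated at x = 0, turns the convolution back into the pairing
  -- with `ψ`.
  have h1 := hconv (fun y => ψ (0 - y)) (hψ.comp (by fun_prop))
    (hψc.comp_homeomorph (Homeomorph.subLeft 0)) 0
  rw [integral_sub_left_eq_self (fun y => ‖ψ y‖)] at h1
  simpa [mul_comm] using h1

/-- A bounded solution with zero initial value and a source dominated by the solution vanishes. -/
theorem IsSlicedSolution.ae_eq_zero {T : ℝ} {w k : ℝ → E → ℝ} (h : IsSlicedSolution T w k)
    (h0 : w 0 =ᵐ[volume] 0) {C : ℝ} (hw : ∀ t ∈ Icc 0 T, ∀ᵐ y, ‖w t y‖ ≤ C) {L : ℝ} (hL : 0 ≤ L)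
    (hk : ∀ t ∈ Icc 0 T, ∀ᵐ y, ‖k t y‖ ≤ L * ‖w t y‖) {t : ℝ} (ht : t ∈ Icc 0 T) :
    w t =ᵐ[volume] 0 := by
  -- Picard-style Gronwall: a bound on `w` bounds the source, whose time integral bounds `w` again
  -- with one more power of L t.
  have key : ∀ j : ℕ, ∀ t ∈ Icc 0 T, ∀ᵐ y, ‖w t y‖ ≤ C * ((L * t) ^ j / j.factorial) := by
    intro j
    induction j with
    | zero => simpa using hw
    | succ j ih =>
      intro t ht
      have hb : ∀ t ∈ Icc 0 T, ∀ᵐ y, ‖k t y‖ ≤ L * (C * ((L * t) ^ j / j.factorial)) := by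
        intro t ht
        filter_upwards [hk t ht, ih t ht] with y h1 h2
        exact h1.trans (mul_le_mul_of_nonneg_left h2 hL)
      have hb' : ∀ t ∈ Icc 0 T, ∀ᵐ y, ‖k t y‖ ≤ L * C := by
        intro t ht
        filter_upwards [hk t ht, hw t ht] with y h1 h2
        exact h1.trans (mul_le_mul_of_nonneg_left h2 hL)
      have h1 := h.ae_norm_le_integral h0 hw hb' (β := fun t => L * (C * ((L * t) ^ j / j.factorial)))
        (by fun_prop) hb ht
      have h2 : ∫ r in 0..t, L * (C * ((L * r) ^ j / j.factorial)) =
          C * ((L * t) ^ (j + 1) / (j + 1).factorial) := by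
        have h3 : ∀ r : ℝ, L * (C * ((L * r) ^ j / j.factorial)) =
            (L ^ (j + 1) * C / j.factorial) * r ^ j := fun r => by ring
        simp only [h3]
        rw [intervalIntegral.integral_const_mul, integral_pow, Nat.factorial_succ]
        push_cast
        field_simp
        ring
      rwa [h2] at h1
  have hall : ∀ᵐ y, ∀ j : ℕ, ‖w t y‖ ≤ C * ((L * t) ^ j / j.factorial) :=
    ae_all_iff.2 fun j => key j t ht
  filter_upwards [hall] with y hy
  have hlim : Tendsto (fun j : ℕ => C * ((L * t) ^ j / j.factorial)) atTop (𝓝 0) := by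
    simpa using (FloorSemiring.tendsto_pow_div_factorial_atTop (L * t)).const_mul C
  have := ge_of_tendsto' hlim hy
  simpa using this

end Uniqueness

/-! ### Continuous functions with a weak derivative in time -/

section TimeTest

open Filter Topology

/-- The antiderivative of a mollifier, with a step at `s` of width `δ`. -/
noncomputable def smoothStep (s δ r : ℝ) : ℝ := Real.smoothTransition ((r - s) / δ)

theorem contDiff_smoothStep (s δ : ℝ) : ContDiff ℝ ∞ (smoothStep s δ) :=
  Real.smoothTransition.contDiff.comp (by fun_prop)

theorem smoothStep_of_le {s δ r : ℝ} (hδ : 0 < δ) (h : r ≤ s) : smoothStep s δ r = 0 :=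
  Real.smoothTransition.zero_of_nonpos (div_nonpos_of_nonpos_of_nonneg (sub_nonpos.2 h) hδ.le)

theorem smoothStep_of_ge {s δ r : ℝ} (hδ : 0 < δ) (h : s + δ ≤ r) : smoothStep s δ r = 1 :=
  Real.smoothTransition.one_of_one_le ((one_le_div hδ).2 (by linarith))

theorem norm_smoothStep_le (s δ r : ℝ) : ‖smoothStep s δ r‖ ≤ 1 := by
  rw [smoothStep, Real.norm_of_nonneg (Real.smoothTransition.nonneg _)]
  exact Real.smoothTransition.le_one _

theorem deriv_smoothStep (s δ r : ℝ) :
    deriv (smoothStep s δ) r = δ⁻¹ * deriv Real.smoothTransition ((r - s) / δ) := by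
  have h1 : HasDerivAt (fun r => (r - s) / δ) (1 / δ) r := ((hasDerivAt_id r).sub_const s).div_const δ
  have h2 : Differentiable ℝ Real.smoothTransition :=
    (Real.smoothTransition.contDiff (n := 1)).differentiable (by norm_num)
  have h3 : deriv (smoothStep s δ) r = _ := ((h2 ((r - s) / δ)).hasDerivAt.comp r h1).deriv
  rw [h3, one_div, mul_comm]

theorem deriv_smoothStep_of_notMem {s δ r : ℝ} (hδ : 0 < δ) (h : r ∉ Icc s (s + δ)) :
    deriv (smoothStep s δ) r = 0 := by
  rcases lt_or_ge r s with h1 | h1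
  · have : smoothStep s δ =ᶠ[𝓝 r] fun _ => 0 := by
      filter_upwards [Iio_mem_nhds h1] with y hy using smoothStep_of_le hδ (le_of_lt hy)
    rw [this.deriv_eq, deriv_const]
  · have h2 : s + δ < r := by
      by_contra h3
      exact h ⟨h1, not_lt.1 h3⟩
    have : smoothStep s δ =ᶠ[𝓝 r] fun _ => 1 := by
      filter_upwards [Ioi_mem_nhds h2] with y hy using smoothStep_of_ge hδ (le_of_lt hy)
    rw [this.deriv_eq, deriv_const]

/-- The derivative of the step is an approximate identity: it lives on [s, s + δ] and has integral
1. The substitution r = s + δq makes the limit δ → 0 continuous dependence on a parameter. -/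
theorem tendsto_integral_deriv_smoothStep_mul {a : ℝ → ℝ} (ha : Continuous a) {s T : ℝ}
    (hs : 0 ≤ s) (hsT : s < T) :
    Tendsto (fun δ => ∫ r in 0..T, deriv (smoothStep s δ) r * a r) (𝓝[>] 0) (𝓝 (a s)) := by
  have hσ : Continuous (deriv Real.smoothTransition) :=
    (Real.smoothTransition.contDiff (n := 1)).continuous_deriv (by norm_num)
  have h1 : Continuous fun δ : ℝ => ∫ q in (0 : ℝ)..1, deriv Real.smoothTransition q * a (s + δ * q) :=
    intervalIntegral.continuous_parametric_intervalIntegral_of_continuous' (by fun_prop) _ _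
  have h2 : ∫ q in (0 : ℝ)..1, deriv Real.smoothTransition q * a (s + 0 * q) = a s := by
    simp only [zero_mul, add_zero]
    rw [intervalIntegral.integral_mul_const, intervalIntegral.integral_deriv_eq_sub
      (fun x _ => ((Real.smoothTransition.contDiff (n := 1)).differentiable (by norm_num)) x)
      (hσ.intervalIntegrable _ _)]
    simp
  have h3 := (h1.tendsto 0).mono_left (nhdsWithin_le_nhds (s := Ioi 0))
  rw [h2] at h3
  refine h3.congr' ?_
  filter_upwards [Ioo_mem_nhdsGT (sub_pos.2 hsT)] with δ hδ
  have hδ0 : δ ≠ 0 := hδ.1.ne'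
  have h4 : ∫ r in 0..T, deriv (smoothStep s δ) r * a r =
      ∫ r in s..(s + δ), deriv (smoothStep s δ) r * a r := by
    have hT : s + δ < T := by linarith [hδ.2]
    rw [intervalIntegral.integral_of_le (hs.trans hsT.le),
      intervalIntegral.integral_of_le (by linarith [hδ.1]), ← integral_Icc_eq_integral_Ioc,
      ← integral_Icc_eq_integral_Ioc]
    refine setIntegral_eq_of_subset_of_forall_sdiff_eq_zero measurableSet_Icc
      (Icc_subset_Icc hs hT.le) fun r hr => ?_
    rw [deriv_smoothStep_of_notMem hδ.1 hr.2, zero_mul]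
  rw [h4]
  have h5 := intervalIntegral.integral_comp_mul_add (a := 0) (b := 1)
    (fun r => deriv (smoothStep s δ) r * a r) hδ0 s
  rw [mul_zero, zero_add, mul_one, smul_eq_mul, add_comm δ s] at h5
  have h6 : ∫ r in s..(s + δ), deriv (smoothStep s δ) r * a r =
      δ * ∫ q in (0 : ℝ)..1, deriv (smoothStep s δ) (δ * q + s) * a (δ * q + s) := by
    rw [h5, mul_inv_cancel_left₀ hδ0]
  rw [h6, ← intervalIntegral.integral_const_mul]
  refine intervalIntegral.integral_congr fun q _ => ?_
  simp only [deriv_smoothStep, add_sub_cancel_right, mul_div_cancel_left₀ q hδ0]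
  rw [add_comm s]
  field_simp

theorem tendsto_integral_smoothStep_mul {β : ℝ → ℝ} {s T : ℝ} (hs : 0 ≤ s) (hsT : s < T)
    (hβ : IntervalIntegrable β volume 0 T) :
    Tendsto (fun δ => ∫ r in 0..T, smoothStep s δ r * β r) (𝓝[>] 0) (𝓝 (∫ r in s..T, β r)) := by
  have h0T := hs.trans hsT.le
  have h1 : ∫ r in s..T, β r = ∫ r in 0..T, (Ioc s T).indicator β r := by
    rw [intervalIntegral.integral_of_le h0T, intervalIntegral.integral_of_le hsT.le,
      setIntegral_indicator measurableSet_Ioc,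
      inter_eq_self_of_subset_right (Ioc_subset_Ioc_left hs)]
  rw [h1]
  refine intervalIntegral.tendsto_integral_filter_of_dominated_convergence (fun r => ‖β r‖)
    (Eventually.of_forall fun δ => ?_) (Eventually.of_forall fun δ => ?_) hβ.norm ?_
  · rw [uIoc_of_le h0T]
    exact (contDiff_smoothStep s δ).continuous.aestronglyMeasurable.mul hβ.1.aestronglyMeasurable
  · refine Eventually.of_forall fun r _ => ?_
    rw [norm_mul]
    exact mul_le_of_le_one_left (norm_nonneg _) (norm_smoothStep_le s δ r)
  · refine Eventually.of_forall fun r hr => ?_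
    rw [uIoc_of_le h0T] at hr
    refine tendsto_const_nhds.congr' ?_
    rcases le_or_gt r s with h | h
    · filter_upwards [self_mem_nhdsWithin] with δ hδ
      rw [smoothStep_of_le hδ h, indicator_of_notMem fun h' => absurd h'.1 (not_lt.2 h), zero_mul]
    · filter_upwards [Ioo_mem_nhdsGT (sub_pos.2 h)] with δ hδ
      rw [smoothStep_of_ge hδ.1 (by linarith [hδ.2]), indicator_of_mem (show r ∈ Ioc s T from ⟨h, hr.2⟩), one_mul]

/-- A continuous function with an integrable distributional derivative is its primitive. -/
theorem sub_eq_integral_of_weak_deriv {a β : ℝ → ℝ} {T : ℝ} (hT : 0 < T)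
    (ha : ContinuousOn a (Icc 0 T)) (hβ : IntervalIntegrable β volume 0 T)
    (h : ∀ χ : ℝ → ℝ, ContDiff ℝ ∞ χ → HasCompactSupport χ → tsupport χ ⊆ Ioo 0 T →
      ∫ t in 0..T, (deriv χ t * a t + χ t * β t) = 0)
    {s t : ℝ} (hs : s ∈ Icc 0 T) (ht : t ∈ Icc 0 T) : a t - a s = ∫ r in s..t, β r := by
  set A : ℝ → ℝ := IccExtend hT.le ((Icc 0 T).domRestrict a) with hA
  have hAc : Continuous A := continuous_IccExtend_iff.2 (continuousOn_iff_continuous_domRestrict.1 ha)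
  have hAa : ∀ r ∈ Icc 0 T, A r = a r := fun r hr => IccExtend_of_mem hT.le _ hr
  have hterm : ∀ s ∈ Ioo 0 T, ∀ δ, IntervalIntegrable
      (fun r => deriv (smoothStep s δ) r * A r) volume 0 T ∧ IntervalIntegrable
      (fun r => smoothStep s δ r * β r) volume 0 T := fun s hs δ =>
    ⟨((((contDiff_smoothStep s δ).continuous_deriv (by simp)).mul hAc).intervalIntegrable _ _),
      hβ.continuousOn_mul (contDiff_smoothStep s δ).continuous.continuousOn⟩
  have hlim : ∀ s ∈ Ioo 0 T, Tendsto (fun δ => (∫ r in 0..T, deriv (smoothStep s δ) r * A r) +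
      ∫ r in 0..T, smoothStep s δ r * β r) (𝓝[>] 0) (𝓝 (A s + ∫ r in s..T, β r)) := fun s hs =>
    (tendsto_integral_deriv_smoothStep_mul hAc hs.1.le hs.2).add
      (tendsto_integral_smoothStep_mul hs.1.le hs.2 hβ)
  have key : ∀ s ∈ Ioo 0 T, ∀ t ∈ Ioo 0 T, s ≤ t →
      A s + ∫ r in s..T, β r = A t + ∫ r in t..T, β r := by
    intro s hs t ht hst
    refine tendsto_nhds_unique (hlim s hs) ((hlim t ht).congr' ?_)
    filter_upwards [Ioo_mem_nhdsGT (sub_pos.2 ht.2)] with δ hδ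
    have hsupp : Function.support (fun r => smoothStep s δ r - smoothStep t δ r) ⊆ Icc s (t + δ) := by
      intro r hr
      by_contra h1
      refine hr ?_
      rcases lt_or_ge r s with h2 | h2
      · simp [smoothStep_of_le hδ.1 h2.le, smoothStep_of_le hδ.1 (h2.le.trans hst)]
      · have h3 : t + δ < r := by
          by_contra h3
          exact h1 ⟨h2, not_lt.1 h3⟩
        simp [smoothStep_of_ge hδ.1 h3.le, smoothStep_of_ge hδ.1 ((add_le_add_left hst δ).trans h3.le)]
    have hts : tsupport (fun r => smoothStep s δ r - smoothStep t δ r) ⊆ Icc s (t + δ) :=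
      closure_minimal hsupp isClosed_Icc
    -- One step alone is not compactly supported in (0, T); the difference of two is. As δ → 0 it
    -- shows that A s + ∫ₛᵀ β takes equal values at s and t.
    have h1 := h (fun r => smoothStep s δ r - smoothStep t δ r)
      ((contDiff_smoothStep s δ).sub (contDiff_smoothStep t δ))
      (HasCompactSupport.of_support_subset_isCompact isCompact_Icc hsupp)
      (hts.trans (Icc_subset_Ioo hs.1 (by linarith [hδ.2])))
    have hd : ∀ s r, DifferentiableAt ℝ (smoothStep s δ) r := fun s r =>
      (contDiff_smoothStep s δ).differentiable (by simp) r
    have h2 : ∫ r in 0..T, (deriv (fun r => smoothStep s δ r - smoothStep t δ r) r * a r +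
        (smoothStep s δ r - smoothStep t δ r) * β r) =
        ∫ r in 0..T, ((deriv (smoothStep s δ) r * A r + smoothStep s δ r * β r) -
          (deriv (smoothStep t δ) r * A r + smoothStep t δ r * β r)) := by
      refine intervalIntegral.integral_congr fun r hr => ?_
      rw [uIcc_of_le hT.le] at hr
      simp only [hAa r hr]
      rw [deriv_fun_sub (hd s r) (hd t r)]
      ring
    rw [h2, intervalIntegral.integral_sub ((hterm s hs δ).1.add (hterm s hs δ).2)
      ((hterm t ht δ).1.add (hterm t ht δ).2), intervalIntegral.integral_add (hterm s hs δ).1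
      (hterm s hs δ).2, intervalIntegral.integral_add (hterm t ht δ).1 (hterm t ht δ).2] at h1
    linarith
  have hG : ContinuousOn (fun s => A s + ∫ r in s..T, β r) (Icc 0 T) := by
    have h1 : ContinuousOn (fun s => ∫ r in T..s, β r) (Icc 0 T) := by
      have := intervalIntegral.continuousOn_primitive_interval' (b₁ := 0) (b₂ := T) (a := T) hβ
        right_mem_uIcc
      rwa [uIcc_of_le hT.le] at this
    refine hAc.continuousOn.add (h1.neg.congr fun s _ => intervalIntegral.integral_symm _ _)
  have hconst : EqOn (fun s => A s + ∫ r in s..T, β r)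
      (fun _ => A (T / 2) + ∫ r in (T / 2)..T, β r) (Icc 0 T) := by
    have h2 : T / 2 ∈ Ioo 0 T := ⟨by linarith, by linarith⟩
    refine EqOn.of_subset_closure (s := Ioo 0 T) (fun s hs => ?_) hG continuousOn_const
      Ioo_subset_Icc_self (closure_Ioo hT.ne).ge
    rcases le_total s (T / 2) with h | h
    · exact key s hs _ h2 h
    · exact (key _ h2 s hs h).symm
  have h1 := (hconst hs).trans (hconst ht).symm
  simp only [hAa s hs, hAa t ht] at h1
  have hsub : ∀ s ∈ Icc 0 T, ∀ t ∈ Icc 0 T, IntervalIntegrable β volume s t := fun s hs t ht =>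
    hβ.mono_set (by
      rw [uIcc_of_le hT.le]
      exact uIcc_subset_Icc hs ht)
  rw [← intervalIntegral.integral_add_adjacent_intervals (hsub s hs t ht)
    (hsub t ht T (right_mem_Icc.2 hT.le))] at h1
  linarith

end TimeTest

/-! ### Uniqueness of bounded distributional solutions -/

section WeakUniqueness

open Filter Topology

theorem continuous_allenCahnReaction : Continuous allenCahnReaction := by
  unfold allenCahnReaction
  fun_prop

theorem norm_allenCahnReaction_sub_le {C a b : ℝ} (ha : ‖a‖ ≤ C) (hb : ‖b‖ ≤ C) :
    ‖allenCahnReaction a - allenCahnReaction b‖ ≤ (6 * C ^ 2 + 2) * ‖a - b‖ := by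
  rw [show allenCahnReaction a - allenCahnReaction b =
    (2 * (a ^ 2 + a * b + b ^ 2) - 2) * (a - b) by unfold allenCahnReaction; ring, norm_mul]
  refine mul_le_mul_of_nonneg_right ?_ (norm_nonneg _)
  have h1 : ‖a‖ * ‖b‖ ≤ C ^ 2 := by
    rw [sq]
    exact mul_le_mul ha hb (norm_nonneg _) ((norm_nonneg _).trans ha)
  have h2 : ‖a‖ ^ 2 ≤ C ^ 2 := pow_le_pow_left₀ (norm_nonneg _) ha 2
  have h3 : ‖b‖ ^ 2 ≤ C ^ 2 := pow_le_pow_left₀ (norm_nonneg _) hb 2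
  calc ‖2 * (a ^ 2 + a * b + b ^ 2) - 2‖ ≤ ‖2 * (a ^ 2 + a * b + b ^ 2)‖ + ‖(2 : ℝ)‖ :=
        norm_sub_le _ _
    _ ≤ 2 * (‖a‖ ^ 2 + ‖a‖ * ‖b‖ + ‖b‖ ^ 2) + 2 := by
        rw [norm_mul, Real.norm_of_nonneg (zero_le_two : (0 : ℝ) ≤ 2), ← norm_mul, ← norm_pow,
          ← norm_pow]
        gcongr
        exact norm_add₃_le
    _ ≤ _ := by linarith

theorem norm_allenCahnReaction_le {C a : ℝ} (ha : ‖a‖ ≤ C) :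
    ‖allenCahnReaction a‖ ≤ (6 * C ^ 2 + 2) * C := by
  have h1 := norm_allenCahnReaction_sub_le ha (b := 0) (by
    rw [norm_zero]; exact (norm_nonneg _).trans ha)
  have h2 : allenCahnReaction 0 = 0 := by simp [allenCahnReaction]
  rw [h2, sub_zero, sub_zero] at h1
  exact h1.trans (mul_le_mul_of_nonneg_left ha (by positivity))

theorem locallyIntegrable_of_ae_norm_le {E : Type*} [TopologicalSpace E] [MeasurableSpace E]
    [OpensMeasurableSpace E] {μ : Measure E} [IsLocallyFiniteMeasure μ] {w : E → ℝ} {C : ℝ}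
    (hw : AEStronglyMeasurable w μ) (hC : ∀ᵐ x ∂μ, ‖w x‖ ≤ C) : LocallyIntegrable w μ :=
  (memLp_top_of_bound hw C hC).locallyIntegrable le_top

variable {E : Type*} [NormedAddCommGroup E] [InnerProductSpace ℝ E] [FiniteDimensional ℝ E]
  [MeasurableSpace E] [BorelSpace E]

theorem IsSlicedSolution.sub {T : ℝ} (hT : 0 ≤ T) {w k w' k' : ℝ → E → ℝ} (h : IsSlicedSolution T w k)
    (h' : IsSlicedSolution T w' k') :
    IsSlicedSolution T (fun t x => w t x - w' t x) (fun t x => k t x - k' t x) := by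
  have hint : ∀ {f ψ : E → ℝ}, LocallyIntegrable f → Continuous ψ → HasCompactSupport ψ →
      Integrable fun x => f x * ψ x := fun hf hψ hc => by
    simpa [mul_comm] using hf.integrable_smul_left_of_hasCompactSupport hψ hc
  have hpair : ∀ {w k : ℝ → E → ℝ}, IsSlicedSolution T w k → ∀ {ψ : E → ℝ}, ContDiff ℝ ∞ ψ →
      HasCompactSupport ψ → ∀ t ∈ Icc 0 T, Integrable fun x => w t x * Δ ψ x + k t x * ψ x :=
    fun h ψ hψ hc t ht => (hint (h.locallyIntegrable t ht) (contDiff_laplacian hψ).continuous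
      (HasCompactSupport.laplacian hψ hc)).add (hint (h.source t ht) hψ.continuous hc)
  have hsub : ∀ {ψ : E → ℝ}, ContDiff ℝ ∞ ψ → HasCompactSupport ψ → ∀ t ∈ Icc 0 T,
      ∫ x, ((w t x - w' t x) * Δ ψ x + (k t x - k' t x) * ψ x) =
      (∫ x, (w t x * Δ ψ x + k t x * ψ x)) - ∫ x, (w' t x * Δ ψ x + k' t x * ψ x) := by
    intro ψ hψ hc t ht
    rw [← integral_sub (hpair h hψ hc t ht) (hpair h' hψ hc t ht)]
    congr 1
    ext x
    ring
  refine ⟨fun t ht => (h.locallyIntegrable t ht).sub (h'.locallyIntegrable t ht),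
    fun t ht => (h.source t ht).sub (h'.source t ht), fun ψ hψ hc => ?_,
    fun ψ hψ hc s hs t ht => ?_⟩
  · refine ((h.intervalIntegrable ψ hψ hc).sub (h'.intervalIntegrable ψ hψ hc)).congr
      fun t ht => ?_
    rw [uIoc_of_le hT] at ht
    exact (hsub hψ hc t (Ioc_subset_Icc_self ht)).symm
  · have ht' : t ∈ Icc 0 T := ⟨hs.1.trans ht.1, ht.2⟩
    have hsplit : ∀ t ∈ Icc 0 T, ∫ x, (w t x - w' t x) * ψ x =
        (∫ x, w t x * ψ x) - ∫ x, w' t x * ψ x := by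
      intro t ht
      simp only [sub_mul]
      exact integral_sub (hint (h.locallyIntegrable t ht) hψ.continuous hc)
        (hint (h'.locallyIntegrable t ht) hψ.continuous hc)
    have hst : uIcc s t ⊆ Icc 0 T := by
      rw [uIcc_of_le ht.1]
      exact Icc_subset_Icc hs.1 ht.2
    have hst' : uIcc s t ⊆ uIcc 0 T := by rwa [uIcc_of_le (hs.1.trans hs.2)]
    rw [hsplit t ht', hsplit s hs, intervalIntegral.integral_congr fun r hr => hsub hψ hc r (hst hr),
      intervalIntegral.integral_sub ((h.intervalIntegrable ψ hψ hc).mono_set hst')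
      ((h'.intervalIntegrable ψ hψ hc).mono_set hst'), ← h.eq ψ hψ hc s hs t ht,
      ← h'.eq ψ hψ hc s hs t ht]
    ring

variable {n : ℕ} {ε : ℝ} {u₀ : EuclideanSpace ℝ (Fin (n + 1)) → ℝ}
  {v : ℝ → EuclideanSpace ℝ (Fin (n + 1)) → ℝ}

/-- The space-time bound controls only almost every time slice. Pairings with test functions are
continuous in time, so their bounds extend to every t and then give back a bound on the slice. -/
theorem IsAllenCahnSolution.exists_ae_bound (h : IsAllenCahnSolution ε u₀ v) {T : ℝ} (hT : 0 < T) :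
    ∃ C, (∀ᵐ p ∂((volume : Measure ℝ).restrict (Icc 0 T)).prod
      (volume : Measure (EuclideanSpace ℝ (Fin (n + 1)))), ‖v p.1 p.2‖ ≤ C) ∧
      0 ≤ C ∧ ∀ t ∈ Icc 0 T, ∀ᵐ x, ‖v t x‖ ≤ C := by
  have h1 := h.bounded T hT
  set C := (eLpNormEssSup (fun p : ℝ × EuclideanSpace ℝ (Fin (n + 1)) => v p.1 p.2)
    (volume.restrict (Icc 0 T ×ˢ univ))).toReal with hC
  have h2 : ∀ᵐ p ∂(volume : Measure (ℝ × EuclideanSpace ℝ (Fin (n + 1)))).restrict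
      (Icc 0 T ×ˢ univ), ‖v p.1 p.2‖ ≤ C := by
    have h3 : eLpNormEssSup (fun p : ℝ × EuclideanSpace ℝ (Fin (n + 1)) => v p.1 p.2)
        (volume.restrict (Icc 0 T ×ˢ univ)) ≠ ⊤ := by
      simpa using h1.eLpNorm_ne_top
    filter_upwards [ae_le_eLpNormEssSup (f := fun p : ℝ × EuclideanSpace ℝ (Fin (n + 1)) =>
      v p.1 p.2) (μ := volume.restrict (Icc 0 T ×ˢ univ))] with p hp
    have := ENNReal.toReal_mono h3 hp
    simpa using this
  rw [Measure.volume_eq_prod, ← Measure.prod_restrict, Measure.restrict_univ] at h2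
  have h3 : ∀ᵐ t ∂(volume : Measure ℝ).restrict (Icc 0 T), ∀ᵐ x, ‖v t x‖ ≤ C :=
    Measure.ae_ae_of_ae_prod h2
  refine ⟨C, h2, ENNReal.toReal_nonneg, fun t ht => ?_⟩
  refine ae_norm_le_of_integral_mul_le (h.locallyIntegrable t ht.1) fun ψ hψ hc => ?_
  have hψi : Integrable ψ := hψ.continuous.integrable_of_hasCompactSupport hc
  set D := C * ∫ x, ‖ψ x‖
  have hcont : ContinuousOn (fun t => ‖∫ x, v t x * ψ x‖) (Icc 0 T) :=
    ((h.continuous_distribution ψ hψ hc).mono Icc_subset_Ici_self).norm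
  -- The maximum with `D` rewrites the almost everywhere inequality as an equality of continuous
  -- functions, which then holds everywhere on [0, T].
  have h4 : (fun t => max ‖∫ x, v t x * ψ x‖ D) =ᵐ[volume.restrict (Icc 0 T)] fun _ => D := by
    filter_upwards [h3] with t ht
    refine max_eq_right ?_
    rw [show D = ∫ x, C * ‖ψ x‖ from (integral_const_mul _ _).symm]
    refine norm_integral_le_of_norm_le (hψi.norm.const_mul C) ?_
    filter_upwards [ht] with x hx
    rw [norm_mul]
    exact mul_le_mul_of_nonneg_right hx (norm_nonneg _)
  have h5 := Measure.eqOn_Icc_of_ae_eq volume hT.ne h4 (hcont.sup continuousOn_const)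
    continuousOn_const ht
  exact max_eq_right_iff.1 h5

/-- Testing with χ(t)ψ(x) says that t ↦ ∫ v(t)ψ has an integrable weak derivative on (0, T). Since
it is continuous up to both ends, it is the primitive of that derivative, also from s = 0. -/
theorem IsAllenCahnSolution.isSlicedSolution (h : IsAllenCahnSolution ε u₀ v) {T : ℝ} (hT : 0 < T) :
    IsSlicedSolution T v fun t x => -(1 / ε ^ 2 * allenCahnReaction (v t x)) := by
  obtain ⟨C, hvb₀, hC0, hC⟩ := h.exists_ae_bound hT
  set K := ‖1 / ε ^ 2‖ * ((6 * C ^ 2 + 2) * C)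
  set k : ℝ → EuclideanSpace ℝ (Fin (n + 1)) → ℝ := fun t x =>
    -(1 / ε ^ 2 * allenCahnReaction (v t x)) with hkdef
  have hkb : ∀ {t x}, ‖v t x‖ ≤ C → ‖k t x‖ ≤ K := by
    intro t x hx
    rw [hkdef, norm_neg, norm_mul]
    exact mul_le_mul_of_nonneg_left (norm_allenCahnReaction_le hx) (norm_nonneg _)
  have hkc : Continuous fun a => -(1 / ε ^ 2 * allenCahnReaction a) :=
    (continuous_const.mul continuous_allenCahnReaction).neg
  have hk : ∀ t ∈ Icc 0 T, ∀ᵐ x, ‖k t x‖ ≤ K := fun t ht => by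
    filter_upwards [hC t ht] with x hx using hkb hx
  have hkl : ∀ t ∈ Icc 0 T, LocallyIntegrable (k t) := fun t ht =>
    locallyIntegrable_of_ae_norm_le (hkc.comp_aestronglyMeasurable
      (h.locallyIntegrable t ht.1).aestronglyMeasurable) (hk t ht)
  set μ := ((volume : Measure ℝ).restrict (Ioc 0 T)).prod
    (volume : Measure (EuclideanSpace ℝ (Fin (n + 1)))) with hμ
  have hμr : (volume : Measure (ℝ × EuclideanSpace ℝ (Fin (n + 1)))).restrict (Ioc 0 T ×ˢ univ) =
      μ := by
    rw [Measure.volume_eq_prod, ← Measure.prod_restrict, Measure.restrict_univ]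
  have hvm : AEStronglyMeasurable (fun p : ℝ × EuclideanSpace ℝ (Fin (n + 1)) => v p.1 p.2) μ := by
    rw [← hμr]
    exact (h.bounded T hT).aestronglyMeasurable.mono_measure
      (Measure.restrict_mono_set _ (prod_mono_left Ioc_subset_Icc_self))
  have hkm : AEStronglyMeasurable (fun p : ℝ × EuclideanSpace ℝ (Fin (n + 1)) => k p.1 p.2) μ :=
    hkc.comp_aestronglyMeasurable hvm
  have hvb : ∀ᵐ p ∂μ, ‖v p.1 p.2‖ ≤ C :=
    (Measure.absolutelyContinuous_of_le (Measure.restrict_mono_set _ Ioc_subset_Icc_self)).prod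
      Measure.AbsolutelyContinuous.rfl hvb₀
  have hkb' : ∀ᵐ p ∂μ, ‖k p.1 p.2‖ ≤ K := by
    filter_upwards [hvb] with p hp using hkb hp
  have hφi : ∀ {χ : ℝ → ℝ} {ψ : EuclideanSpace ℝ (Fin (n + 1)) → ℝ}, Continuous χ → Continuous ψ →
      HasCompactSupport ψ → Integrable (fun p : ℝ × EuclideanSpace ℝ (Fin (n + 1)) =>
        χ p.1 * ψ p.2) μ := fun hχ hψ hc =>
    ((hχ.integrableOn_Icc (a := 0) (b := T)).mono_set Ioc_subset_Icc_self).mul_prod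
      (hψ.integrable_of_hasCompactSupport hc)
  have hint : ∀ {ψ : EuclideanSpace ℝ (Fin (n + 1)) → ℝ}, ContDiff ℝ ∞ ψ → HasCompactSupport ψ →
      ∀ {χ : ℝ → ℝ}, Continuous χ →
      Integrable (fun p : ℝ × EuclideanSpace ℝ (Fin (n + 1)) => v p.1 p.2 * (χ p.1 * ψ p.2)) μ ∧
      Integrable (fun p : ℝ × EuclideanSpace ℝ (Fin (n + 1)) =>
        v p.1 p.2 * (χ p.1 * Δ ψ p.2)) μ ∧
      Integrable (fun p : ℝ × EuclideanSpace ℝ (Fin (n + 1)) => k p.1 p.2 * (χ p.1 * ψ p.2)) μ :=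
    fun hψ hc _ hχ => ⟨(hφi hχ hψ.continuous hc).bdd_mul hvm hvb,
      (hφi hχ (contDiff_laplacian hψ).continuous (HasCompactSupport.laplacian hψ hc)).bdd_mul hvm hvb,
      (hφi hχ hψ.continuous hc).bdd_mul hkm hkb'⟩
  have hβ : ∀ ψ : EuclideanSpace ℝ (Fin (n + 1)) → ℝ, ContDiff ℝ ∞ ψ → HasCompactSupport ψ →
      IntervalIntegrable (fun t => ∫ x, (v t x * Δ ψ x + k t x * ψ x)) volume 0 T := by
    intro ψ hψ hc
    rw [intervalIntegrable_iff_integrableOn_Ioc_of_le hT.le]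
    obtain ⟨-, h1, h2⟩ := hint hψ hc (χ := fun _ => 1) continuous_const
    have := (h1.add h2).integral_prod_left
    simp only [Pi.add_apply, one_mul] at this
    exact this
  refine ⟨fun t ht => h.locallyIntegrable t ht.1, hkl, hβ, fun ψ hψ hc s hs t ht => ?_⟩
  refine sub_eq_integral_of_weak_deriv hT ((h.continuous_distribution ψ hψ hc).mono
    Icc_subset_Ici_self) (hβ ψ hψ hc) (fun χ hχ hχc hχs => ?_) hs ⟨hs.1.trans ht.1, ht.2⟩
  have hsupp : tsupport (fun p : ℝ × EuclideanSpace ℝ (Fin (n + 1)) => χ p.1 * ψ p.2) ⊆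
      tsupport χ ×ˢ tsupport ψ := by
    refine closure_minimal (fun p hp => ?_) ((isClosed_tsupport _).prod (isClosed_tsupport _))
    have hp' := mul_ne_zero_iff.1 (Function.mem_support.1 hp)
    exact ⟨subset_tsupport _ hp'.1, subset_tsupport _ hp'.2⟩
  have h1 := h.equation (fun p => χ p.1 * ψ p.2)
    ((hχ.comp contDiff_fst).mul (hψ.comp contDiff_snd))
    (IsCompact.of_isClosed_subset (hχc.isCompact.prod hc.isCompact) (isClosed_tsupport _) hsupp)
    (hsupp.trans (prod_mono (hχs.trans Ioo_subset_Ioi_self) (subset_univ _)))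
  have hχd : Differentiable ℝ χ := hχ.differentiable (by simp)
  have hψ2 : ContDiff ℝ 2 ψ := contDiff_infty.1 hψ 2
  have hint1 : ∀ p : ℝ × EuclideanSpace ℝ (Fin (n + 1)),
      v p.1 p.2 * (deriv (fun t => χ t * ψ p.2) p.1 + Δ (fun x => χ p.1 * ψ x) p.2) -
        1 / ε ^ 2 * allenCahnReaction (v p.1 p.2) * (χ p.1 * ψ p.2) =
      v p.1 p.2 * (deriv χ p.1 * ψ p.2) + (v p.1 p.2 * (χ p.1 * Δ ψ p.2) +
        k p.1 p.2 * (χ p.1 * ψ p.2)) := by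
    intro p
    have h2 : Δ (fun x => χ p.1 * ψ x) p.2 = χ p.1 * Δ ψ p.2 := by
      have := InnerProductSpace.laplacian_smul (χ p.1) (f := ψ) (x := p.2) hψ2.contDiffAt
      simpa [Pi.smul_def] using this
    rw [h2, deriv_mul_const (hχd _), hkdef]
    ring
  simp only [hint1] at h1
  rw [setIntegral_eq_of_subset_of_forall_sdiff_eq_zero (s := Ioc 0 T ×ˢ univ)
    (measurableSet_Ioi.prod MeasurableSet.univ) (prod_mono_left Ioc_subset_Ioi_self)
    (fun p hp => ?_), hμr] at h1
  · have hχ' : Continuous (deriv χ) := hχ.continuous_deriv (by simp)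
    have i1 := (hint hψ hc hχ').1
    obtain ⟨-, i2, i3⟩ := hint hψ hc hχ.continuous
    have i4 : Integrable (fun p : ℝ × EuclideanSpace ℝ (Fin (n + 1)) =>
        v p.1 p.2 * (deriv χ p.1 * ψ p.2) + (v p.1 p.2 * (χ p.1 * Δ ψ p.2) +
        k p.1 p.2 * (χ p.1 * ψ p.2))) μ := i1.add (i2.add i3)
    rw [hμ, integral_prod _ i4] at h1
    rw [intervalIntegral.integral_of_le hT.le]
    refine Eq.trans ?_ h1
    refine setIntegral_congr_fun measurableSet_Ioc fun r hr => ?_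
    have hr' := Ioc_subset_Icc_self hr
    have hli : ∀ {f ψ : EuclideanSpace ℝ (Fin (n + 1)) → ℝ}, LocallyIntegrable f → Continuous ψ →
        HasCompactSupport ψ → Integrable fun x => f x * ψ x := fun hf hψ hc => by
      simpa [mul_comm] using hf.integrable_smul_left_of_hasCompactSupport hψ hc
    have j1 := hli (h.locallyIntegrable r hr'.1) hψ.continuous hc
    have j2 : Integrable fun x => v r x * Δ ψ x + k r x * ψ x := (hli (h.locallyIntegrable r hr'.1) (contDiff_laplacian hψ).continuous
      (HasCompactSupport.laplacian hψ hc)).add (hli (hkl r hr') hψ.continuous hc)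
    simp only
    rw [← integral_const_mul, ← integral_const_mul, ← integral_add (j1.const_mul _) (j2.const_mul _)]
    congr 1
    ext x
    ring
  · have hpT : T < p.1 := by
      by_contra h2
      exact hp.2 ⟨⟨hp.1.1, not_lt.1 h2⟩, trivial⟩
    have h2 : p.1 ∉ tsupport χ := fun h2 => absurd (hχs h2).2 (not_lt.2 hpT.le)
    have h3 : χ p.1 = 0 := image_eq_zero_of_notMem_tsupport h2
    have h4 : deriv χ p.1 = 0 := Function.notMem_support.1 fun h3 =>
      h2 (support_deriv_subset h3)
    rw [h3, h4]
    ring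

theorem IsAllenCahnSolution.ae_eq (h : IsAllenCahnSolution ε u₀ v)
    {u : ℝ → EuclideanSpace ℝ (Fin (n + 1)) → ℝ} (h' : IsAllenCahnSolution ε u₀ u) {t : ℝ}
    (ht : 0 ≤ t) : v t =ᵐ[volume] u t := by
  -- A horizon beyond t keeps the interval nondegenerate also when t = 0.
  have hT : 0 < t + 1 := by linarith
  obtain ⟨C, -, hC0, hC⟩ := h.exists_ae_bound hT
  obtain ⟨C', -, hC0', hC'⟩ := h'.exists_ae_bound hT
  have h1 := (h.isSlicedSolution hT).sub hT.le (h'.isSlicedSolution hT)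
  have h2 := h1.ae_eq_zero (C := C + C') (L := ‖1 / ε ^ 2‖ * (6 * (max C C') ^ 2 + 2)) (t := t)
    (by filter_upwards [h.initial, h'.initial] with x hx hx'; simp [hx, hx'])
    (fun r hr => by
      filter_upwards [hC r hr, hC' r hr] with x hx hx'
      exact (norm_sub_le _ _).trans (add_le_add hx hx'))
    (by positivity)
    (fun r hr => by
      filter_upwards [hC r hr, hC' r hr] with x hx hx'
      rw [← norm_neg, show -(-(1 / ε ^ 2 * allenCahnReaction (v r x)) -
        -(1 / ε ^ 2 * allenCahnReaction (u r x))) = 1 / ε ^ 2 * (allenCahnReaction (v r x) -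
          allenCahnReaction (u r x)) by ring, norm_mul, mul_assoc]
      exact mul_le_mul_of_nonneg_left (norm_allenCahnReaction_sub_le (hx.trans (le_max_left _ _))
        (hx'.trans (le_max_right _ _))) (norm_nonneg _)) ⟨ht, by linarith⟩
  filter_upwards [h2] with x hx
  exact sub_eq_zero.1 hx

end WeakUniqueness

/-! ### Null level sets of the distance and continuity of the data -/

section LevelSets

open Filter Topology Module

variable {E : Type*} [NormedAddCommGroup E] [InnerProductSpace ℝ E] [FiniteDimensional ℝ E]
  [MeasurableSpace E] [BorelSpace E]

/-- The positive level sets of a distance function are porous. -/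
theorem exists_ball_disjoint_infDist_eq {M : Set E} (hM : IsClosed M) (hne : M.Nonempty) {r : ℝ}
    {x : E} (hx : Metric.infDist x M = r) {ρ : ℝ} (hρ : 0 < ρ) (hρr : ρ / 2 ≤ r) :
    ∃ y, Metric.ball y (ρ / 2) ⊆ Metric.closedBall x ρ ∧
      Disjoint {z | Metric.infDist z M = r} (Metric.ball y (ρ / 2)) := by
  obtain ⟨p, hp, hxp⟩ := hM.exists_infDist_eq_dist hne x
  rw [hx] at hxp
  have hr : 0 < r := by linarith
  have hnorm : ‖p - x‖ = r := by rw [hxp, dist_comm, dist_eq_norm]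
  set c := ρ / 2 / r with hc
  have hc0 : 0 ≤ c := by positivity
  have hc1 : c ≤ 1 := (div_le_one hr).2 hρr
  have hcr : c * r = ρ / 2 := div_mul_cancel₀ _ hr.ne'
  -- The centre lies ρ/2 along the segment from x to its nearest point p, at distance r - ρ/2 from
  -- p, so every point of the open ball of radius ρ/2 is closer than r to `M`.
  refine ⟨x + c • (p - x), fun z hz => ?_, ?_⟩
  · have h1 : dist (x + c • (p - x)) x = ρ / 2 := by
      rw [dist_eq_norm, add_sub_cancel_left, norm_smul, hnorm, Real.norm_of_nonneg hc0, hcr]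
    have h2 := dist_triangle z (x + c • (p - x)) x
    rw [Metric.mem_ball] at hz
    rw [Metric.mem_closedBall]
    linarith
  · rw [Set.disjoint_left]
    intro z hz hz'
    have h1 : dist (x + c • (p - x)) p = r - ρ / 2 := by
      rw [dist_eq_norm, show x + c • (p - x) - p = (-(1 - c)) • (p - x) by module, norm_smul, hnorm,
        norm_neg, Real.norm_of_nonneg (sub_nonneg.2 hc1), sub_mul, one_mul, hcr]
    have h2 := dist_triangle z (x + c • (p - x)) p
    have h3 : Metric.infDist z M ≤ dist z p := Metric.infDist_le_dist_of_mem hp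
    rw [Metric.mem_ball] at hz'
    rw [mem_ofPred_eq] at hz
    linarith

/-- By porosity, every small ball centred on the level set misses at least the fraction 2^{-d} of
its volume, so no point of the set is a density point; by Lebesgue's density theorem the set is
null. -/
theorem volume_infDist_eq_zero {M : Set E} (hM : IsClosed M) (hne : M.Nonempty) {r : ℝ}
    (hr : 0 < r) : volume {x : E | Metric.infDist x M = r} = 0 := by
  set F := {x : E | Metric.infDist x M = r} with hF
  have hFc : IsClosed F := isClosed_eq (Metric.continuous_infDist_pt M) continuous_const
  set d := finrank ℝ E
  have hsmall : ∀ x ∈ F, ∀ ρ, 0 < ρ → ρ / 2 ≤ r →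
      (volume (F ∩ Metric.closedBall x ρ) / volume (Metric.closedBall x ρ)).toReal ≤
        1 - (1 / 2) ^ d := by
    intro x hx ρ hρ hρr
    obtain ⟨y, hy, hdisj⟩ := exists_ball_disjoint_infDist_eq hM hne hx hρ hρr
    have hfin : volume (Metric.closedBall x ρ) ≠ ⊤ := measure_closedBall_lt_top.ne
    have h1 : volume.real (F ∩ Metric.closedBall x ρ) + volume.real (Metric.ball y (ρ / 2)) ≤
        volume.real (Metric.closedBall x ρ) := by
      rw [← measureReal_union (hdisj.mono_left inter_subset_left) measurableSet_ball
        (measure_ne_top_of_subset inter_subset_right hfin) measure_ball_lt_top.ne]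
      exact measureReal_mono (union_subset inter_subset_right hy) hfin
    have h2 : volume.real (Metric.ball y (ρ / 2)) = (1 / 2) ^ d * volume.real (Metric.closedBall x ρ) := by
      rw [measureReal_def, measureReal_def, Measure.addHaar_ball_of_pos _ _ (half_pos hρ),
        Measure.addHaar_closedBall _ _ hρ.le, ENNReal.toReal_mul, ENNReal.toReal_mul,
        ENNReal.toReal_ofReal (by positivity), ENNReal.toReal_ofReal (by positivity)]
      ring
    have h3 : 0 < volume.real (Metric.closedBall x ρ) :=
      ENNReal.toReal_pos (Metric.measure_closedBall_pos volume x hρ).ne' hfin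
    rw [ENNReal.toReal_div]
    refine (div_le_iff₀ h3).2 ?_
    simp only [measureReal_def] at h1 h2 h3 ⊢
    linarith
  have hae := ae_restrict_iff' hFc.measurableSet |>.1
    (Besicovitch.ae_tendsto_measure_inter_div (volume : Measure E) F)
  refine measure_eq_zero_iff_ae_notMem.2 ?_
  filter_upwards [hae] with x hx hxF
  have h1 := (ENNReal.tendsto_toReal ENNReal.one_ne_top).comp (hx hxF)
  have h2 : ∀ᶠ ρ in 𝓝[>] (0 : ℝ), (volume (F ∩ Metric.closedBall x ρ) /
      volume (Metric.closedBall x ρ)).toReal ≤ 1 - (1 / 2) ^ d := by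
    filter_upwards [Ioo_mem_nhdsGT hr] with ρ hρ
    exact hsmall x hxF ρ hρ.1 (by linarith [hρ.1, hρ.2])
  have h3 := le_of_tendsto h1 h2
  rw [ENNReal.toReal_one] at h3
  have h4 : (0 : ℝ) < (1 / 2) ^ d := by positivity
  linarith

variable {n : ℕ} {Ω : Set (EuclideanSpace ℝ (Fin (n + 1)))}

/-- Since n + κ < n + 1, finite ℋ^{n+κ} forces ℋ^{n+1} to vanish, and Lebesgue measure is absolutely
continuous with respect to ℋ^{n+1}. -/
theorem BoundsGeneralisedHypersurface.volume_frontier (hΩ : BoundsGeneralisedHypersurface Ω) :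
    volume (frontier Ω) = 0 := by
  obtain ⟨κ, -, hκ, hfin, -⟩ := hΩ.density
  have h1 : (n : ℝ) + κ < finrank ℝ (EuclideanSpace ℝ (Fin (n + 1))) := by
    rw [finrank_euclideanSpace_fin]
    push_cast
    linarith
  have h2 : Measure.hausdorffMeasure (finrank ℝ (EuclideanSpace ℝ (Fin (n + 1))) : ℝ)
      (frontier Ω) = 0 :=
    (Measure.hausdorffMeasure_zero_or_top h1 (frontier Ω)).resolve_right hfin.ne
  exact Measure.absolutelyContinuous_isAddHaarMeasure (volume : Measure (EuclideanSpace ℝ (Fin (n + 1))))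
    (Measure.hausdorffMeasure (finrank ℝ (EuclideanSpace ℝ (Fin (n + 1))) : ℝ)) h2

theorem BoundsGeneralisedHypersurface.volume_signedDistance_eq
    (hΩ : BoundsGeneralisedHypersurface Ω) (hne : Ω.Nonempty) (s : ℝ) :
    volume {x | signedDistance Ω x = s} = 0 := by
  have hM : (frontier Ω).Nonempty := by
    -- A bounded set is not the whole space, whose dimension n + 1 is positive, so the boundary is
    -- nonempty. Over an empty boundary `Metric.infDist` would be identically 0.
    refine nonempty_frontier_iff.2 ⟨hne, fun h => ?_⟩
    exact NormedSpace.unbounded_univ ℝ (EuclideanSpace ℝ (Fin (n + 1))) (h ▸ hΩ.isBounded)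
  have habs : {x | signedDistance Ω x = s} ⊆ {x | Metric.infDist x (frontier Ω) = |s|} := by
    rintro x rfl
    have h0 : 0 ≤ Metric.infDist x (frontier Ω) := Metric.infDist_nonneg
    rw [mem_ofPred_eq, signedDistance]
    split_ifs
    · rw [abs_of_nonneg h0]
    · rw [abs_neg, abs_of_nonneg h0]
  refine measure_mono_null habs ?_
  rcases eq_or_ne s 0 with rfl | hs
  · refine measure_mono_null (fun x hx => ?_) hΩ.volume_frontier
    rw [mem_ofPred_eq, abs_zero] at hx
    exact (isClosed_frontier.mem_iff_infDist_zero hM).2 hx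
  · exact volume_infDist_eq_zero isClosed_frontier hM (abs_pos.2 hs)

theorem measurable_signedDistance (hΩ : IsOpen Ω) : Measurable (signedDistance Ω) := by
  classical
  have h := (Metric.continuous_infDist_pt (frontier Ω)).measurable
  exact Measurable.ite hΩ.measurableSet h h.neg

theorem measurable_leafInitialDatum (hΩ : IsOpen Ω) (s : ℝ) : Measurable (leafInitialDatum Ω s) :=
  ((measurable_const.indicator (measurableSet_le measurable_const
    (measurable_signedDistance hΩ))).const_mul 2).sub_const 1

theorem leafInitialDatum_of_le {s : ℝ} {x : EuclideanSpace ℝ (Fin (n + 1))}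
    (h : s ≤ signedDistance Ω x) : leafInitialDatum Ω s x = 1 := by
  rw [leafInitialDatum, indicator_of_mem (show x ∈ leafRegion Ω s from h)]
  norm_num

theorem leafInitialDatum_of_lt {s : ℝ} {x : EuclideanSpace ℝ (Fin (n + 1))}
    (h : signedDistance Ω x < s) : leafInitialDatum Ω s x = -1 := by
  rw [leafInitialDatum, indicator_of_notMem (show x ∉ leafRegion Ω s from not_le.2 h)]
  norm_num

theorem norm_leafInitialDatum_le (s : ℝ) (x : EuclideanSpace ℝ (Fin (n + 1))) :
    ‖leafInitialDatum Ω s x‖ ≤ 1 := by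
  rcases le_or_gt s (signedDistance Ω x) with h | h
  · simp [leafInitialDatum_of_le h]
  · simp [leafInitialDatum_of_lt h]

theorem leafInitialDatum_antitone {s₁ s₂ : ℝ} (h : s₁ ≤ s₂)
    (x : EuclideanSpace ℝ (Fin (n + 1))) : leafInitialDatum Ω s₂ x ≤ leafInitialDatum Ω s₁ x := by
  rcases le_or_gt s₂ (signedDistance Ω x) with h2 | h2
  · rw [leafInitialDatum_of_le h2, leafInitialDatum_of_le (h.trans h2)]
  · rw [leafInitialDatum_of_lt h2]
    exact neg_le_of_abs_le (norm_leafInitialDatum_le s₁ x)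

/-- Off the null set {d = s} the value at x is constant for parameters near s. The exceptional set
depends on s, which is all that dominated convergence at s requires. -/
theorem BoundsGeneralisedHypersurface.ae_continuousAt_leafInitialDatum
    (hΩ : BoundsGeneralisedHypersurface Ω) (hne : Ω.Nonempty) (s : ℝ) :
    ∀ᵐ x, ContinuousAt (fun s => leafInitialDatum Ω s x) s := by
  filter_upwards [measure_eq_zero_iff_ae_notMem.1 (hΩ.volume_signedDistance_eq hne s)] with x hx
  rcases lt_or_gt_of_ne (show signedDistance Ω x ≠ s from hx) with h | h
  · refine continuousAt_const.congr (f := fun _ => (-1 : ℝ)) ?_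
    filter_upwards [Ioi_mem_nhds h] with s' hs' using (leafInitialDatum_of_lt hs').symm
  · refine continuousAt_const.congr (f := fun _ => (1 : ℝ)) ?_
    filter_upwards [Iio_mem_nhds h] with s' hs' using (leafInitialDatum_of_le (le_of_lt hs')).symm

end LevelSets

/-! ### The Allen–Cahn nonlinearity and its flow -/

section Existence

open Filter Topology

/-- The Allen–Cahn source `a ↦ Λ a - ε⁻² f(a)` with `Λ = 4 ε⁻²`. -/
noncomputable def allenCahnSource (ε a : ℝ) : ℝ :=
  4 * (1 / ε ^ 2) * a - 1 / ε ^ 2 * allenCahnReaction a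

/-- The Allen–Cahn source, made constant outside `[-1, 1]`. -/
noncomputable def truncatedAllenCahnSource (ε a : ℝ) : ℝ :=
  allenCahnSource ε (max (-1) (min a 1))

theorem allenCahnSource_sub (ε a b : ℝ) : allenCahnSource ε a - allenCahnSource ε b =
    1 / ε ^ 2 * (6 - 2 * (a ^ 2 + a * b + b ^ 2)) * (a - b) := by
  unfold allenCahnSource allenCahnReaction
  ring

/-- The number 4 is the maximum of f'(a) = 6a² - 2 on [-1,1], so the source is monotone there; f(±1)
= 0 then makes its extreme values ±Λ. The difference quotient is ε⁻²(6 - 2(a² + ab + b²)), with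
second factor in [0, 6], whence the Lipschitz constant. -/
theorem isMonotoneReaction_truncatedAllenCahnSource {ε : ℝ} (hε : 0 < ε) :
    IsMonotoneReaction (4 * (1 / ε ^ 2)) (6 * (1 / ε ^ 2)) (truncatedAllenCahnSource ε) := by
  have he : 0 < 1 / ε ^ 2 := by positivity
  set c : ℝ → ℝ := fun a => max (-1) (min a 1) with hc
  have hcm : Monotone c := monotone_const.max (monotone_id.min monotone_const)
  have hcl : ∀ a b, ‖c a - c b‖ ≤ ‖a - b‖ := fun a b =>
    (show ‖c a - c b‖ ≤ |min a 1 - min b 1| by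
      have h := abs_max_sub_max_le_abs (min a 1) (min b 1) (-1)
      rwa [max_comm, max_comm _ (-1 : ℝ)] at h).trans ((abs_min_sub_min_le_max a 1 b 1).trans_eq (by simp))
  have hc1 : ∀ a, -1 ≤ c a ∧ c a ≤ 1 := fun a =>
    ⟨le_max_left _ _, max_le (by norm_num) (min_le_right _ _)⟩
  have hq : ∀ a b : ℝ, -1 ≤ a ∧ a ≤ 1 → -1 ≤ b ∧ b ≤ 1 →
      0 ≤ 6 - 2 * (a ^ 2 + a * b + b ^ 2) ∧ 6 - 2 * (a ^ 2 + a * b + b ^ 2) ≤ 6 := by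
    rintro a b ⟨ha, ha'⟩ ⟨hb, hb'⟩
    constructor <;> nlinarith [sq_nonneg (a + b), sq_nonneg (a - b)]
  have hmono : ∀ a b : ℝ, -1 ≤ a ∧ a ≤ 1 → -1 ≤ b ∧ b ≤ 1 → a ≤ b →
      allenCahnSource ε a ≤ allenCahnSource ε b := by
    intro a b ha hb hab
    rw [← sub_nonneg, allenCahnSource_sub]
    exact mul_nonneg (mul_nonneg he.le (hq b a hb ha).1) (sub_nonneg.2 hab)
  have h1 : allenCahnSource ε 1 = 4 * (1 / ε ^ 2) := by simp [allenCahnSource, allenCahnReaction]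
  have h2 : allenCahnSource ε (-1) = -(4 * (1 / ε ^ 2)) := by
    simp [allenCahnSource, allenCahnReaction]
  have hcont : Continuous (allenCahnSource ε) := by
    unfold allenCahnSource allenCahnReaction
    fun_prop
  refine ⟨by positivity, by positivity, hcont.comp (by fun_prop), fun a b hab =>
    hmono _ _ (hc1 a) (hc1 b) (hcm hab), fun a => abs_le.2 ⟨?_, ?_⟩, fun a b => ?_⟩
  · rw [← h2]
    exact hmono _ _ (by norm_num) (hc1 a) (hc1 a).1
  · rw [← h1]
    exact hmono _ _ (hc1 a) (by norm_num) (hc1 a).2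
  · have h3 := hq _ _ (hc1 a) (hc1 b)
    rw [truncatedAllenCahnSource, truncatedAllenCahnSource, allenCahnSource_sub, norm_mul, norm_mul,
      Real.norm_of_nonneg he.le]
    refine mul_le_mul ?_ (hcl a b) (norm_nonneg _) (by positivity)
    rw [mul_comm 6]
    refine mul_le_mul_of_nonneg_left ?_ he.le
    rw [Real.norm_of_nonneg h3.1]
    exact h3.2

theorem isReactionExtension_allenCahnSource (ε : ℝ) :
    IsReactionExtension (truncatedAllenCahnSource ε) (allenCahnSource ε)
      fun a => 1 / ε ^ 2 * (6 - 6 * a ^ 2) := by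
  refine ⟨fun a ha => ?_, fun a => ?_, by fun_prop⟩
  · obtain ⟨h1, h2⟩ := abs_le.1 ha
    rw [truncatedAllenCahnSource, min_eq_left h2, max_eq_right h1]
  · have h1 : allenCahnSource ε = fun a => 1 / ε ^ 2 * (6 * a - 2 * a ^ 3) := by
      ext a
      unfold allenCahnSource allenCahnReaction
      ring
    rw [h1]
    refine ((((hasDerivAt_id a).const_mul 6).sub ((hasDerivAt_pow 3 a).const_mul 2)).const_mul
      (1 / ε ^ 2)).congr_deriv ?_
    congr 1
    norm_num
    ring

variable {n : ℕ}

/-- The solution of the Allen–Cahn equation with initial datum `U`. -/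
noncomputable def allenCahnFlow (ε : ℝ) (U : EuclideanSpace ℝ (Fin (n + 1)) → ℝ) :
    ℝ → EuclideanSpace ℝ (Fin (n + 1)) → ℝ :=
  mildSolution (4 * (1 / ε ^ 2)) (truncatedAllenCahnSource ε) U

variable {ε : ℝ} {U : EuclideanSpace ℝ (Fin (n + 1)) → ℝ}

theorem hasDerivAt_allenCahnFlow (hε : 0 < ε) (hU : Measurable U) (hU1 : ∀ y, ‖U y‖ ≤ 1) {t : ℝ}
    (ht : 0 < t) (x : EuclideanSpace ℝ (Fin (n + 1))) :
    HasDerivAt (fun τ => allenCahnFlow ε U τ x)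
      (Δ (allenCahnFlow ε U t) x - 1 / ε ^ 2 * allenCahnReaction (allenCahnFlow ε U t x)) t := by
  refine (hasDerivAt_mildSolution (isMonotoneReaction_truncatedAllenCahnSource hε)
    (isReactionExtension_allenCahnSource ε) hU hU1 ht x).congr_deriv ?_
  rw [allenCahnSource, allenCahnFlow]
  ring

theorem isAllenCahnSolution_allenCahnFlow (hε : 0 < ε) (hU : Measurable U)
    (hU1 : ∀ y, ‖U y‖ ≤ 1) : IsAllenCahnSolution ε U (allenCahnFlow ε U) := by
  have hg := isMonotoneReaction_truncatedAllenCahnSource hε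
  have hf := isReactionExtension_allenCahnSource ε
  have hm := measurable_mildSolution hg hU hU1
  have hb := norm_mildSolution_le hg hU hU1
  refine ⟨fun T _ => ?_, fun t _ => ?_, fun φ hφ hc => ?_, ?_, fun φ hφ hc hs => ?_⟩
  · exact memLp_top_of_bound hm.aestronglyMeasurable 1 (Eventually.of_forall fun p => hb p.1 p.2)
  · exact locallyIntegrable_of_ae_norm_le (hm.comp (f := fun x => (t, x))
      (by fun_prop)).aestronglyMeasurable (Eventually.of_forall (hb t))
  · exact (continuousOn_integral_mildSolution_mul (S := Unit) hg (U := fun _ => U) (fun _ => hU)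
      (fun _ => hU1) (fun _ => Eventually.of_forall fun _ => continuousAt_const) hφ.continuous
      hc).comp (f := fun t : ℝ => ((), t)) (by fun_prop) fun _ ht => ⟨mem_univ _, ht⟩
  · rw [allenCahnFlow, mildSolution_zero hg hU hU1]
  · have hw := continuousOn_mildSolution_uncurry hg hU hU1
    exact integral_weak_form_eq_zero (fun t ht => contDiff_mildSolution hg hf hU hU1 ht) hw
      (continuousOn_laplacian_mildSolution hg hf hU hU1)
      (continuousOn_const.mul (continuous_allenCahnReaction.comp_continuousOn hw))
      (fun t ht x => hasDerivAt_allenCahnFlow hε hU hU1 ht x) hφ hc hs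

end Existence

/-! ### The family of solutions issuing from the leaves -/

theorem mainTheorem8 {n : ℕ} (Ω : Set (EuclideanSpace ℝ (Fin (n + 1)))) (hne : Ω.Nonempty)
    (hΩ : BoundsGeneralisedHypersurface Ω) (η : ℝ) (hη : 0 < η)
    (ε : ℝ) (hε : ε ∈ Ioo (0 : ℝ) 1) :
    ∃ u : ℝ → ℝ → EuclideanSpace ℝ (Fin (n + 1)) → ℝ,
      -- each `u s` solves the initial value problem with datum `2 χ_{M_s} - 1`
      (∀ s ∈ Icc (-η) η,
        IsAllenCahnSolution ε (leafInitialDatum Ω s) (u s) ∧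
        u s 0 = leafInitialDatum Ω s ∧
        ∀ t : ℝ, 0 < t → ContDiff ℝ 2 (u s t) ∧ ∀ x,
          HasDerivAt (fun τ => u s τ x)
            (Δ (u s t) x - 1 / ε ^ 2 * allenCahnReaction (u s t x)) t) ∧
      -- it is the only such solution
      (∀ s ∈ Icc (-η) η, ∀ v : ℝ → EuclideanSpace ℝ (Fin (n + 1)) → ℝ,
        IsAllenCahnSolution ε (leafInitialDatum Ω s) v →
          ∀ t : ℝ, 0 ≤ t → v t =ᵐ[volume] u s t) ∧
      -- the family is continuous, pointwise for positive times
      ContinuousOn (fun q : ℝ × ℝ × EuclideanSpace ℝ (Fin (n + 1)) => u q.1 q.2.1 q.2.2)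
        (Icc (-η) η ×ˢ Ioi 0 ×ˢ univ) ∧
      -- and in the sense of distributions up to the initial time
      (∀ φ : EuclideanSpace ℝ (Fin (n + 1)) → ℝ, ContDiff ℝ ∞ φ → HasCompactSupport φ →
        ContinuousOn (fun q : ℝ × ℝ => ∫ x, u q.1 q.2 x * φ x) (Icc (-η) η ×ˢ Ici 0)) ∧
      -- and it is monotone
      (∀ s₁ ∈ Icc (-η) η, ∀ s₂ ∈ Icc (-η) η, s₁ ≤ s₂ →
        ∀ t : ℝ, 0 ≤ t → ∀ x, u s₂ t x ≤ u s₁ t x) := by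
  have hg := isMonotoneReaction_truncatedAllenCahnSource hε.1
  have hf := isReactionExtension_allenCahnSource ε
  have hm := measurable_leafInitialDatum hΩ.isOpen
  have hb := norm_leafInitialDatum_le (Ω := Ω)
  have hc := hΩ.ae_continuousAt_leafInitialDatum hne
  have hsol := fun s => isAllenCahnSolution_allenCahnFlow hε.1 (hm s) (hb s)
  refine ⟨fun s => allenCahnFlow ε (leafInitialDatum Ω s), fun s _ => ⟨hsol s,
    mildSolution_zero hg (hm s) (hb s), fun t ht => ⟨contDiff_mildSolution hg hf (hm s) (hb s) ht,
    hasDerivAt_allenCahnFlow hε.1 (hm s) (hb s) ht⟩⟩, fun s _ v hv t ht => hv.ae_eq (hsol s) ht,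
    (continuousOn_mildSolution hg hm hb hc).mono (prod_mono_left (subset_univ _)),
    fun φ hφ hφc => (continuousOn_integral_mildSolution_mul hg hm hb hc hφ.continuous hφc).mono
      (prod_mono_left (subset_univ _)), fun s₁ _ s₂ _ h t _ x =>
      mildSolution_mono hg (hm s₂) (hm s₁) (hb s₂) (hb s₁) (leafInitialDatum_antitone h) t x⟩
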